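/- Let $\Bbbk$ be an algebraically closed field of characteristic $0$, let $n\ge 1$, let $l$ be an odd positive integer and let $q\in\Bbbk$ be a primitive $l$-th root of unity. For $1\le i,j\le n$ put $\theta(i,j)=q$ if $i>j$, $\theta(i,j)=1$ if $i=j$, and $\theta(i,j)=q^{-1}$ if $i<j$. The $n$-rank Taft algebra $\overline{\mathscr A}_q(n)$ is the Hopf algebra over $\Bbbk$ generated by $x_1,\dots,x_n,g_1,\dots,g_n$ with the relations $$g_ig_j=g_jg_i,\quad g_i^l=1,\quad g_ix_j=\theta(i,j)q^{\delta_{i,j}}x_jg_i,\quad x_ix_j=\theta(i,j)x_jx_i,\quad x_i^l=0$$ and the structure maps $\Delta(g_i)=g_i\otimes g_i$, $\Delta(x_i)=x_i\otimes 1+g_i\otimes x_i$, $\epsilon(g_i)=1$, $\epsilon(x_i)=0$, $S(g_i)=g_i^{-1}$, $S(x_i)=-g_i^{-1}x_i$. The Drinfeld double of a finite-dimensional Hopf algebra $H$ is the Hopf algebra $D(H)$ that equals $(H^*)^{\mathrm{cop}}\otimes H$ as a coalgebra and has the multiplication $(f\otimes h)(g\otimes m)=\sum f\,[h_{(1)}\rightharpoonup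 g\leftharpoonup S^{-1}(h_{(3)})]\otimes h_{(2)}m$, where $\langle a\rightharpoonup g\leftharpoonup b,c\rangle=\langle g,bca\rangle$; one writes $fh$ for $f\otimes h$. Its standard universal $R$-matrix is $\mathcal R=\sum_i(\epsilon\otimes e_i)\otimes(e^i\otimes 1)$, for a basis $(e_i)$ of $H$ with dual basis $(e^i)$. A Hopf algebra $H$ with an element $R\in H\otimes H$ is quasitriangular if $R$ is invertible, $(\Delta\otimes\mathrm{id})(R)=R_{13}R_{23}$, $(\mathrm{id}\otimes\Delta)(R)=R_{13}R_{12}$ and $\Delta^{\mathrm{op}}(h)R=R\Delta(h)$ for all $h\in H$; it is factorizable if moreover the map $H^*\to H$, $a\mapsto(a\otimes\mathrm{id})(R_{21}R)$, is bijective. A Hopf algebra is pointed if all its simple subcoalgebras are one-dimensional. Let $\chi:\overline{\mathscr A}_q(n)\to\Bbbk$ be the algebra map with $\chi(x_i)=0$ and $\chi(g_i)=q$ for all $i$, let $\langle\chi g_n\rangle$ be the group algebra generated by the grouplike element $\chi g_n$ of $D(\overline{\mathscr A}_q(n))$, let $\langle\chi g_n\rangle^+$ be the kernel of its counit, and let $I=D(\overline{\mathscr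 A}_q(n))\langle\chi g_n\rangle^+$. Then $I$ is a (two-sided) Hopf ideal of $D(\overline{\mathscr A}_q(n))$, and the quotient Hopf algebra $D(\overline{\mathscr A}_q(n))/I$, with the image $\overline{\mathcal R}$ of $\mathcal R$ in $(D(\overline{\mathscr A}_q(n))/I)\otimes (D(\overline{\mathscr A}_q(n))/I)$, is factorizable. It is pointed and has dimension $l^{4n-1}$. Moreover, suppose that $n=1$ and $l>1$, and let $p\in\Bbbk$ be the primitive $l$-th root of unity with $p^2=q$. Then $D(\overline{\mathscr A}_q(1))/I$ is isomorphic as a Hopf algebra to the small quantum group $u_p(sl_2)$, that is, the Hopf algebra generated by $E,F,K$ with the relations $$K^l=1,\quad E^l=F^l=0,\quad KE=p^2EK,\quad KF=p^{-2}FK,\quad EF-FE=\frac{K-K^{-1}}{p-p^{-1}}$$ and the structure maps $\Delta(E)=1\otimes E+E\otimes K$, $\Delta(F)=K^{-1}\otimes F+F\otimes 1$, $\Delta(K)=K\otimes K$, $\epsilon(E)=\epsilon(F)=0$, $\epsilon(K)=1$, $S(E)=-EK^{-1}$, $S(F)=-KF$, $S(K)=K^{-1}$. -/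

import Mathlib

open scoped TensorProduct

/-! ### A `q`-binomial identity at a root of unity -/

namespace QBinom

/-- Gaussian binomial coefficients, by the Pascal recursion. -/
def coeff {k : Type*} [CommRing k] (q : k) : ℕ → ℕ → k
  | _, 0 => 1
  | 0, _ + 1 => 0
  | m + 1, i + 1 => coeff q m i + q ^ (i + 1) * coeff q m (i + 1)

/-- The `q`-integer `1 + q + ⋯ + q ^ (m - 1)`. -/
def qint {k : Type*} [CommRing k] (q : k) (m : ℕ) : k := ∑ t ∈ Finset.range m, q ^ t

/-- The `q`-factorial. -/
def qfact {k : Type*} [CommRing k] (q : k) (m : ℕ) : k := ∏ t ∈ Finset.range m, qint q (t + 1)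

theorem coeff_of_lt {k : Type*} [CommRing k] (q : k) :
    ∀ m i : ℕ, m < i → coeff q m i = 0
  | _, 0, h => by omega
  | 0, _ + 1, _ => rfl
  | m + 1, i + 1, h => by
    rw [coeff, coeff_of_lt q m i (by omega), coeff_of_lt q m (i + 1) (by omega)]; simp

theorem coeff_self {k : Type*} [CommRing k] (q : k) : ∀ m : ℕ, coeff q m m = 1
  | 0 => rfl
  | m + 1 => by rw [coeff, coeff_self q m, coeff_of_lt q m (m + 1) (by omega)]; simp

theorem qint_add {k : Type*} [CommRing k] (q : k) (a b : ℕ) :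
    qint q (a + b) = qint q a + q ^ a * qint q b := by
  simp [qint, Finset.sum_range_add, Finset.mul_sum, pow_add]

theorem coeff_mul_qfact {k : Type*} [CommRing k] (q : k) :
    ∀ i j : ℕ, coeff q (i + j) i * (qfact q i * qfact q j) = qfact q (i + j)
  | 0, j => by simp [coeff, qfact]
  | i + 1, 0 => by simp [coeff_self, qfact]
  | i + 1, j + 1 => by
    have h1 := coeff_mul_qfact q i (j + 1)
    have h2 := coeff_mul_qfact q (i + 1) j
    have e1 : qfact q (i + 1) = qfact q i * qint q (i + 1) := Finset.prod_range_succ _ _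
    have e2 : qfact q (j + 1) = qfact q j * qint q (j + 1) := Finset.prod_range_succ _ _
    have e3 : qfact q (i + 1 + (j + 1)) = qfact q (i + (j + 1)) * qint q (i + 1 + (j + 1)) := by
      rw [show i + 1 + (j + 1) = i + (j + 1) + 1 by ring]; exact Finset.prod_range_succ _ _
    have e4 : coeff q (i + 1 + (j + 1)) (i + 1) =
        coeff q (i + (j + 1)) i + q ^ (i + 1) * coeff q (i + (j + 1)) (i + 1) := by
      rw [show i + 1 + (j + 1) = i + (j + 1) + 1 by ring, coeff]
    rw [show i + 1 + j = i + (j + 1) by ring] at h2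
    rw [e3, e4, qint_add, mul_add]
    rw [e1] at h2 ⊢
    rw [e2] at h1 ⊢
    linear_combination qint q (i + 1) * h1 + q ^ (i + 1) * qint q (j + 1) * h2

theorem coeff_eq_zero {k : Type*} [Field k] {q : k} {l : ℕ} (hq : IsPrimitiveRoot q l)
    {i : ℕ} (h0 : 0 < i) (hi : i < l) : coeff q l i = 0 := by
  have hne : ∀ m, m ≠ 0 → m < l → qint q m ≠ 0 := by
    intro m hm hml h
    have := hq.pow_ne_one_of_pos_of_lt hm hml
    have h2 := mul_neg_geom_sum q m
    rw [show ∑ t ∈ Finset.range m, q ^ t = 0 from h] at h2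
    apply this; linear_combination h2
  have hfact : ∀ m, m < l → qfact q m ≠ 0 := fun m hm =>
    Finset.prod_ne_zero_iff.2 fun t ht => hne _ (by omega) (by simp at ht; omega)
  have hl : qfact q l = 0 := by
    refine Finset.prod_eq_zero (i := l - 1) (by simp; omega) ?_
    rw [show l - 1 + 1 = l by omega]
    exact hq.geom_sum_eq_zero (by omega)
  have h := coeff_mul_qfact q i (l - i)
  rw [show i + (l - i) = l by omega, hl] at h
  exact (mul_eq_zero.1 h).resolve_right (mul_ne_zero (hfact _ hi) (hfact _ (by omega)))

theorem pow_mul_of_mul {k A : Type*} [CommRing k] [Ring A] [Algebra k A] {q : k} {a b : A}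
    (h : b * a = q • (a * b)) (i : ℕ) : b * a ^ i = q ^ i • (a ^ i * b) := by
  induction i with
  | zero => simp
  | succ i ih =>
    rw [pow_succ, ← mul_assoc, ih, smul_mul_assoc, mul_assoc, h, mul_smul_comm, smul_smul,
      mul_assoc, pow_succ]

theorem add_pow {k A : Type*} [CommRing k] [Ring A] [Algebra k A] {q : k} {a b : A}
    (h : b * a = q • (a * b)) (m : ℕ) :
    (a + b) ^ m = ∑ i ∈ Finset.range (m + 1), coeff q m i • (a ^ i * b ^ (m - i)) := by
  induction m with
  | zero => simp [coeff]
  | succ m ih =>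
    have e1 : ∀ i ∈ Finset.range (m + 1), (a + b) * (coeff q m i • (a ^ i * b ^ (m - i))) =
        coeff q m i • (a ^ (i + 1) * b ^ (m - i)) +
          (q ^ i * coeff q m i) • (a ^ i * b ^ (m + 1 - i)) := by
      intro i hi
      have : i ≤ m := by simp at hi; omega
      rw [add_mul, mul_smul_comm, mul_smul_comm, ← mul_assoc, ← mul_assoc, ← pow_succ',
        pow_mul_of_mul h, smul_mul_assoc, mul_assoc _ b, ← pow_succ', smul_smul,
        show m + 1 - i = m - i + 1 by omega, mul_comm (q ^ i)]
    rw [pow_succ', ih, Finset.mul_sum, Finset.sum_congr rfl e1, Finset.sum_add_distrib]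
    have e2 : ∑ i ∈ Finset.range (m + 1), (q ^ i * coeff q m i) • (a ^ i * b ^ (m + 1 - i)) =
        ∑ i ∈ Finset.range (m + 2), (q ^ i * coeff q m i) • (a ^ i * b ^ (m + 1 - i)) := by
      rw [Finset.sum_range_succ _ (m + 1), coeff_of_lt q m (m + 1) (by omega)]; simp
    rw [e2, Finset.sum_range_succ' (n := m + 1), Finset.sum_range_succ' (n := m + 1), ← add_assoc,
      ← Finset.sum_add_distrib]
    congr 1
    · refine Finset.sum_congr rfl fun i _ => ?_
      rw [show m + 1 - (i + 1) = m - i by omega, ← add_smul, coeff]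
    · simp [coeff]

theorem add_pow_root {k A : Type*} [Field k] [Ring A] [Algebra k A] {q : k} {l : ℕ}
    (hq : IsPrimitiveRoot q l) (hl : l ≠ 0) {a b : A} (h : b * a = q • (a * b)) :
    (a + b) ^ l = a ^ l + b ^ l := by
  rw [add_pow h, Finset.sum_range_succ, coeff_self]
  obtain ⟨m, rfl⟩ := Nat.exists_eq_succ_of_ne_zero hl
  rw [Finset.sum_range_succ', Finset.sum_eq_zero]
  · simp [coeff, add_comm]
  · intro i hi
    rw [coeff_eq_zero hq (by omega) (by simp at hi; omega), zero_smul]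

end QBinom

/-! ### Hopf algebras from generators -/

namespace HopfAlgebra

/-- If the antipode identities hold on a set of algebra generators, for an algebra
antihomomorphism `S`, then they hold everywhere. -/
noncomputable abbrev ofGenerators {k A : Type*} [CommRing k] [Ring A] [Bialgebra k A]
    (S : A →ₐ[k] Aᵐᵒᵖ) (s : Set A) (hs : Algebra.adjoin k s = ⊤)
    (h₁ : ∀ a ∈ s, LinearMap.mul' k A
      (((MulOpposite.opLinearEquiv k).symm.toLinearMap ∘ₗ S.toLinearMap).rTensor A
        (Coalgebra.comul a)) = algebraMap k A (Coalgebra.counit a))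
    (h₂ : ∀ a ∈ s, LinearMap.mul' k A
      (((MulOpposite.opLinearEquiv k).symm.toLinearMap ∘ₗ S.toLinearMap).lTensor A
        (Coalgebra.comul a)) = algebraMap k A (Coalgebra.counit a)) :
    HopfAlgebra k A where
  antipode := (MulOpposite.opLinearEquiv k).symm.toLinearMap ∘ₗ S.toLinearMap
  mul_antipode_rTensor_comul := by
    have key : ∀ (t u : A ⊗[k] A) (r : k), LinearMap.mul' k A
        (((MulOpposite.opLinearEquiv k).symm.toLinearMap ∘ₗ S.toLinearMap).rTensor A t) =
          algebraMap k A r → LinearMap.mul' k A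
        (((MulOpposite.opLinearEquiv k).symm.toLinearMap ∘ₗ S.toLinearMap).rTensor A (t * u)) =
          r • LinearMap.mul' k A
        (((MulOpposite.opLinearEquiv k).symm.toLinearMap ∘ₗ S.toLinearMap).rTensor A u) := by
      intro t u r ht
      induction u with
      | zero => simp
      | add u v hu hv => rw [mul_add, map_add, map_add, map_add, map_add, hu, hv, smul_add]
      | tmul c d =>
        have : ∀ t : A ⊗[k] A, LinearMap.mul' k A
            (((MulOpposite.opLinearEquiv k).symm.toLinearMap ∘ₗ S.toLinearMap).rTensor A
              (t * c ⊗ₜ d)) = (S c).unop * LinearMap.mul' k A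
            (((MulOpposite.opLinearEquiv k).symm.toLinearMap ∘ₗ S.toLinearMap).rTensor A t)
              * d := by
          intro t
          induction t with
          | zero => simp
          | add t v hu hv => rw [add_mul, map_add, map_add, hu, hv, map_add, map_add]; noncomm_ring
          | tmul a b => simp [mul_assoc]
        rw [this, ht]
        simp [Algebra.algebraMap_eq_smul_one]
    ext a
    have ha : a ∈ Algebra.adjoin k s := hs ▸ Algebra.mem_top
    induction ha using Algebra.adjoin_induction with
    | mem x hx => exact h₁ x hx
    | algebraMap r => simp [Algebra.algebraMap_eq_smul_one, Algebra.TensorProduct.one_def]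
    | add x y _ _ hx hy => simp_all
    | mul x y _ _ hx hy =>
      simp only [LinearMap.comp_apply, Algebra.linearMap_apply] at hx hy ⊢
      rw [Bialgebra.comul_mul, key _ _ _ hx, hy, Bialgebra.counit_mul, map_mul, Algebra.smul_def]
  mul_antipode_lTensor_comul := by
    have key : ∀ (t u : A ⊗[k] A) (r : k), LinearMap.mul' k A
        (((MulOpposite.opLinearEquiv k).symm.toLinearMap ∘ₗ S.toLinearMap).lTensor A u) =
          algebraMap k A r → LinearMap.mul' k A
        (((MulOpposite.opLinearEquiv k).symm.toLinearMap ∘ₗ S.toLinearMap).lTensor A (t * u)) =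
          r • LinearMap.mul' k A
        (((MulOpposite.opLinearEquiv k).symm.toLinearMap ∘ₗ S.toLinearMap).lTensor A t) := by
      intro t u r hu
      induction t with
      | zero => simp
      | add u v hu hv => rw [add_mul, map_add, map_add, map_add, map_add, hu, hv, smul_add]
      | tmul c d =>
        have : ∀ u : A ⊗[k] A, LinearMap.mul' k A
            (((MulOpposite.opLinearEquiv k).symm.toLinearMap ∘ₗ S.toLinearMap).lTensor A
              (c ⊗ₜ d * u)) = c * LinearMap.mul' k A
            (((MulOpposite.opLinearEquiv k).symm.toLinearMap ∘ₗ S.toLinearMap).lTensor A u)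
              * (S d).unop := by
          intro t
          induction t with
          | zero => simp
          | add t v hu hv => rw [mul_add, map_add, map_add, hu, hv, map_add, map_add]; noncomm_ring
          | tmul a b => simp [mul_assoc]
        rw [this, hu]
        simp [Algebra.algebraMap_eq_smul_one]
    ext a
    have ha : a ∈ Algebra.adjoin k s := hs ▸ Algebra.mem_top
    induction ha using Algebra.adjoin_induction with
    | mem x hx => exact h₂ x hx
    | algebraMap r => simp [Algebra.algebraMap_eq_smul_one, Algebra.TensorProduct.one_def]
    | add x y _ _ hx hy => simp_all
    | mul x y _ _ hx hy =>
      simp only [LinearMap.comp_apply, Algebra.linearMap_apply] at hx hy ⊢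
      rw [Bialgebra.comul_mul, key _ _ _ hy, hx, Bialgebra.counit_mul, Algebra.smul_def, ← map_mul,
        mul_comm]

end HopfAlgebra

/-! ### The `n`-rank Taft algebra -/

/-- The generators `x₁, …, xₙ, g₁, …, gₙ`. -/
inductive TaftGen (n : ℕ) : Type
  | x (i : Fin n) : TaftGen n
  | g (i : Fin n) : TaftGen n

/-- The scalars `θ(i, j)`: `q` for `i > j`, `1` for `i = j`, `q⁻¹` for `i < j`. -/
def taftTheta {k : Type*} [Field k] (q : k) {n : ℕ} (i j : Fin n) : k :=
  if j < i then q else if i = j then 1 else q⁻¹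

/-- The defining relations of the `n`-rank Taft algebra. -/
inductive TaftRel {k : Type*} [Field k] (q : k) (l n : ℕ) :
    FreeAlgebra k (TaftGen n) → FreeAlgebra k (TaftGen n) → Prop
  | gg (i j : Fin n) : TaftRel q l n
      (FreeAlgebra.ι k (TaftGen.g i) * FreeAlgebra.ι k (TaftGen.g j))
      (FreeAlgebra.ι k (TaftGen.g j) * FreeAlgebra.ι k (TaftGen.g i))
  | g_pow (i : Fin n) : TaftRel q l n (FreeAlgebra.ι k (TaftGen.g i) ^ l) 1
  | gx (i j : Fin n) : TaftRel q l n
      (FreeAlgebra.ι k (TaftGen.g i) * FreeAlgebra.ι k (TaftGen.x j))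
      ((taftTheta q i j * q ^ (if i = j then 1 else 0)) •
        (FreeAlgebra.ι k (TaftGen.x j) * FreeAlgebra.ι k (TaftGen.g i)))
  | xx (i j : Fin n) : TaftRel q l n
      (FreeAlgebra.ι k (TaftGen.x i) * FreeAlgebra.ι k (TaftGen.x j))
      (taftTheta q i j • (FreeAlgebra.ι k (TaftGen.x j) * FreeAlgebra.ι k (TaftGen.x i)))
  | x_pow (i : Fin n) : TaftRel q l n (FreeAlgebra.ι k (TaftGen.x i) ^ l) 0

/-- The `n`-rank Taft algebra, as an algebra given by generators and relations. -/
def TaftAlgebra (k : Type*) [Field k] (q : k) (l n : ℕ) : Type _ := RingQuot (TaftRel q l n)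

namespace TaftAlgebra

noncomputable instance {k : Type*} [Field k] (q : k) (l n : ℕ) : Ring (TaftAlgebra k q l n) :=
  inferInstanceAs (Ring (RingQuot (TaftRel q l n)))

noncomputable instance {k : Type*} [Field k] (q : k) (l n : ℕ) :
    Algebra k (TaftAlgebra k q l n) :=
  inferInstanceAs (Algebra k (RingQuot (TaftRel q l n)))

/-- The projection from the free algebra. -/
noncomputable def mk {k : Type*} [Field k] (q : k) (l n : ℕ) :
    FreeAlgebra k (TaftGen n) →ₐ[k] TaftAlgebra k q l n := RingQuot.mkAlgHom k (TaftRel q l n)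

/-- The generator `x i`. -/
noncomputable def x {k : Type*} [Field k] (q : k) (l : ℕ) {n : ℕ} (i : Fin n) :
    TaftAlgebra k q l n := mk q l n (FreeAlgebra.ι k (TaftGen.x i))

/-- The generator `g i`. -/
noncomputable def g {k : Type*} [Field k] (q : k) (l : ℕ) {n : ℕ} (i : Fin n) :
    TaftAlgebra k q l n := mk q l n (FreeAlgebra.ι k (TaftGen.g i))

theorem mk_rel {k : Type*} [Field k] {q : k} {l n : ℕ} {a b : FreeAlgebra k (TaftGen n)}
    (h : TaftRel q l n a b) : mk q l n a = mk q l n b := RingQuot.mkAlgHom_rel k h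

theorem g_mul_g {k : Type*} [Field k] (q : k) (l : ℕ) {n : ℕ} (i j : Fin n) :
    g q l i * g q l j = g q l j * g q l i := by
  simpa only [map_mul, g] using mk_rel (TaftRel.gg (q := q) (l := l) i j)

theorem g_pow {k : Type*} [Field k] (q : k) (l : ℕ) {n : ℕ} (i : Fin n) : g q l i ^ l = 1 := by
  simpa only [map_pow, map_one, g] using mk_rel (TaftRel.g_pow (q := q) (l := l) i)

theorem g_mul_x {k : Type*} [Field k] (q : k) (l : ℕ) {n : ℕ} (i j : Fin n) :
    g q l i * x q l j =
      (taftTheta q i j * q ^ (if i = j then 1 else 0)) • (x q l j * g q l i) := by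
  simpa only [map_mul, map_smul, x, g] using mk_rel (TaftRel.gx (q := q) (l := l) i j)

theorem x_mul_x {k : Type*} [Field k] (q : k) (l : ℕ) {n : ℕ} (i j : Fin n) :
    x q l i * x q l j = taftTheta q i j • (x q l j * x q l i) := by
  simpa only [map_mul, map_smul, x, g] using mk_rel (TaftRel.xx (q := q) (l := l) i j)

theorem x_pow {k : Type*} [Field k] (q : k) (l : ℕ) {n : ℕ} (i : Fin n) : x q l i ^ l = 0 := by
  simpa only [map_pow, map_zero, x] using mk_rel (TaftRel.x_pow (q := q) (l := l) i)

/-- The defining relations, for elements `X i` and `G i` of an algebra `B`. -/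
structure Rels {k B : Type*} [Field k] [Ring B] [Algebra k B] (q : k) (l n : ℕ)
    (X G : Fin n → B) : Prop where
  gg : ∀ i j, G i * G j = G j * G i
  gp : ∀ i, G i ^ l = 1
  gx : ∀ i j, G i * X j = (taftTheta q i j * q ^ (if i = j then 1 else 0)) • (X j * G i)
  xx : ∀ i j, X i * X j = taftTheta q i j • (X j * X i)
  xp : ∀ i, X i ^ l = 0

/-- The algebra map given by images of the generators that satisfy the relations. -/
noncomputable def lift {k B : Type*} [Field k] [Ring B] [Algebra k B] {q : k} {l n : ℕ}
    {X G : Fin n → B} (h : Rels q l n X G) : TaftAlgebra k q l n →ₐ[k] B :=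
  RingQuot.liftAlgHom k (s := TaftRel q l n)
    ⟨FreeAlgebra.lift k (TaftGen.rec X G), by
      intro a b hab
      induction hab <;> simp only [map_mul, map_smul, map_pow, map_one, map_zero,
        FreeAlgebra.lift_ι_apply]
      · exact h.gg _ _
      · exact h.gp _
      · exact h.gx _ _
      · exact h.xx _ _
      · exact h.xp _⟩

theorem lift_x {k B : Type*} [Field k] [Ring B] [Algebra k B] {q : k} {l n : ℕ}
    {X G : Fin n → B} (h : Rels q l n X G) (i : Fin n) : lift h (x q l i) = X i :=
  (RingQuot.liftAlgHom_mkAlgHom_apply ..).trans (FreeAlgebra.lift_ι_apply ..)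

theorem lift_g {k B : Type*} [Field k] [Ring B] [Algebra k B] {q : k} {l n : ℕ}
    {X G : Fin n → B} (h : Rels q l n X G) (i : Fin n) : lift h (g q l i) = G i :=
  (RingQuot.liftAlgHom_mkAlgHom_apply ..).trans (FreeAlgebra.lift_ι_apply ..)

theorem hom_ext {k B : Type*} [Field k] [Ring B] [Algebra k B] {q : k} {l n : ℕ}
    {F F' : TaftAlgebra k q l n →ₐ[k] B} (hx : ∀ i, F (x q l i) = F' (x q l i))
    (hg : ∀ i, F (g q l i) = F' (g q l i)) : F = F' := by
  refine RingQuot.ringQuot_ext' k F F' (FreeAlgebra.hom_ext ?_)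
  funext a
  cases a with
  | x i => exact hx i
  | g i => exact hg i

/-- The set of generators. -/
def gens {k : Type*} [Field k] (q : k) (l n : ℕ) : Set (TaftAlgebra k q l n) :=
  Set.range (x q l) ∪ Set.range (g q l)

theorem adjoin_gens {k : Type*} [Field k] (q : k) (l n : ℕ) :
    Algebra.adjoin k (gens q l n) = ⊤ := by
  rw [eq_top_iff]
  intro a _
  obtain ⟨b, rfl⟩ : ∃ b, mk q l n b = a := RingQuot.mkAlgHom_surjective k (TaftRel q l n) a
  induction b using FreeAlgebra.induction with
  | grade0 r => rw [AlgHom.commutes]; exact Subalgebra.algebraMap_mem _ r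
  | grade1 y =>
    apply Algebra.subset_adjoin
    cases y with
    | x i => exact Or.inl ⟨i, rfl⟩
    | g i => exact Or.inr ⟨i, rfl⟩
  | mul a b ha hb => rw [map_mul]; exact mul_mem (ha trivial) (hb trivial)
  | add a b ha hb => rw [map_add]; exact add_mem (ha trivial) (hb trivial)

theorem theta_self {k : Type*} [Field k] (q : k) {n : ℕ} (i : Fin n) : taftTheta q i i = 1 := by
  simp [taftTheta]

theorem theta_mul_theta {k : Type*} [Field k] {q : k} (hq : q ≠ 0) {n : ℕ} (i j : Fin n) :
    taftTheta q i j * taftTheta q j i = 1 := by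
  rcases lt_trichotomy i j with h | h | h
  · simp [taftTheta, h, h.not_gt, h.ne, hq]
  · simp [taftTheta, h]
  · simp [taftTheta, h, h.not_gt, h.ne, h.ne', hq]

theorem comul_rels {k : Type*} [Field k] {q : k} {l : ℕ} (hq : IsPrimitiveRoot q l)
    (hl : l ≠ 0) (n : ℕ) :
    Rels (k := k) (B := TaftAlgebra k q l n ⊗[k] TaftAlgebra k q l n) q l n
      (fun i => x q l i ⊗ₜ 1 + g q l i ⊗ₜ x q l i) (fun i => g q l i ⊗ₜ g q l i) where
  gg := fun i j => by simp [g_mul_g q l i j]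
  gp := fun i => by simp [g_pow, Algebra.TensorProduct.one_def]
  gx := fun i j => by
      simp only [mul_add, add_mul, Algebra.TensorProduct.tmul_mul_tmul, mul_one, one_mul,
        g_mul_x q l i j, g_mul_g q l i j, TensorProduct.smul_tmul', TensorProduct.tmul_smul,
        smul_add]
  xx := fun i j => by
      by_cases hij : i = j
      · subst hij; simp [theta_self]
      · have hθ := theta_mul_theta (hq.ne_zero hl) i j
        simp only [mul_add, add_mul, Algebra.TensorProduct.tmul_mul_tmul, mul_one, one_mul,
          smul_add, g_mul_g q l i j, x_mul_x q l i j, g_mul_x q l i j, g_mul_x q l j i,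
          if_neg hij, if_neg (Ne.symm hij), pow_zero, TensorProduct.smul_tmul',
          TensorProduct.tmul_smul, smul_smul, hθ, one_smul]
        abel
  xp := fun i => by
      rw [QBinom.add_pow_root hq hl]
      · simp [x_pow, zero_pow hl]
      · simp [g_mul_x, theta_self, TensorProduct.smul_tmul']

/-- The comultiplication, as an algebra map:
`g i ↦ g i ⊗ g i` and `x i ↦ x i ⊗ 1 + g i ⊗ x i`. -/
noncomputable def comulHom {k : Type*} [Field k] {q : k} {l : ℕ} (hq : IsPrimitiveRoot q l)
    (hl : l ≠ 0) (n : ℕ) :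
    TaftAlgebra k q l n →ₐ[k] TaftAlgebra k q l n ⊗[k] TaftAlgebra k q l n :=
  lift (comul_rels hq hl n)

theorem character_rels {k : Type*} [Field k] (q : k) {l : ℕ} (hl : l ≠ 0) (n : ℕ) (c : k)
    (hc : c ^ l = 1) : Rels q l n (fun _ => (0 : k)) (fun _ => c) where
  gg _ _ := rfl
  gp _ := hc
  gx _ _ := by simp
  xx _ _ := by simp
  xp _ := by simp [hl]

/-- The algebra map to `k` with `x i ↦ 0` and `g i ↦ c`, where `c ^ l = 1`. -/
noncomputable def character {k : Type*} [Field k] (q : k) {l : ℕ} (hl : l ≠ 0) (n : ℕ) (c : k)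
    (hc : c ^ l = 1) : TaftAlgebra k q l n →ₐ[k] k :=
  lift (character_rels q hl n c hc)

theorem comulHom_x {k : Type*} [Field k] {q : k} {l : ℕ} (hq : IsPrimitiveRoot q l)
    (hl : l ≠ 0) {n : ℕ} (i : Fin n) :
    comulHom hq hl n (x q l i) = x q l i ⊗ₜ 1 + g q l i ⊗ₜ x q l i := lift_x (comul_rels hq hl n) i

theorem comulHom_g {k : Type*} [Field k] {q : k} {l : ℕ} (hq : IsPrimitiveRoot q l)
    (hl : l ≠ 0) {n : ℕ} (i : Fin n) :
    comulHom hq hl n (g q l i) = g q l i ⊗ₜ g q l i := lift_g (comul_rels hq hl n) i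

theorem character_x {k : Type*} [Field k] (q : k) {l : ℕ} (hl : l ≠ 0) {n : ℕ} (c : k)
    (hc : c ^ l = 1) (i : Fin n) : character q hl n c hc (x q l i) = 0 :=
  lift_x (character_rels q hl n c hc) i

theorem character_g {k : Type*} [Field k] (q : k) {l : ℕ} (hl : l ≠ 0) {n : ℕ} (c : k)
    (hc : c ^ l = 1) (i : Fin n) : character q hl n c hc (g q l i) = c :=
  lift_g (character_rels q hl n c hc) i

noncomputable instance instBialgebra {k : Type*} [Field k] (q : k) (l n : ℕ)
    [hq : Fact (IsPrimitiveRoot q l)] [hl : NeZero l] : Bialgebra k (TaftAlgebra k q l n) :=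
  Bialgebra.ofAlgHom (comulHom hq.out hl.out n) (character q hl.out n 1 (one_pow l))
    (by
      apply hom_ext <;> intro i <;>
        simp [comulHom_x, comulHom_g, TensorProduct.add_tmul, TensorProduct.tmul_add,
          Algebra.TensorProduct.one_def, add_assoc])
    (by
      apply hom_ext <;> intro i <;>
        simp [comulHom_x, comulHom_g, character_x, character_g])
    (by
      apply hom_ext <;> intro i <;>
        simp [comulHom_x, comulHom_g, character_x, character_g])

theorem comul_x {k : Type*} [Field k] (q : k) (l : ℕ) {n : ℕ} [Fact (IsPrimitiveRoot q l)]
    [NeZero l] (i : Fin n) :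
    Coalgebra.comul (R := k) (x q l i) = x q l i ⊗ₜ[k] 1 + g q l i ⊗ₜ[k] x q l i :=
  comulHom_x (Fact.out) (NeZero.ne l) i

theorem comul_g {k : Type*} [Field k] (q : k) (l : ℕ) {n : ℕ} [Fact (IsPrimitiveRoot q l)]
    [NeZero l] (i : Fin n) :
    Coalgebra.comul (R := k) (g q l i) = g q l i ⊗ₜ[k] g q l i :=
  comulHom_g (Fact.out) (NeZero.ne l) i

theorem counit_x {k : Type*} [Field k] (q : k) (l : ℕ) {n : ℕ} [Fact (IsPrimitiveRoot q l)]
    [NeZero l] (i : Fin n) : Coalgebra.counit (R := k) (x q l i) = 0 :=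
  character_x q (NeZero.ne l) 1 (one_pow l) i

theorem counit_g {k : Type*} [Field k] (q : k) (l : ℕ) {n : ℕ} [Fact (IsPrimitiveRoot q l)]
    [NeZero l] (i : Fin n) : Coalgebra.counit (R := k) (g q l i) = 1 :=
  character_g q (NeZero.ne l) 1 (one_pow l) i

/-- The inverse `g i ^ (l - 1)` of `g i`. -/
noncomputable def gInv {k : Type*} [Field k] (q : k) (l : ℕ) {n : ℕ} (i : Fin n) :
    TaftAlgebra k q l n := g q l i ^ (l - 1)

theorem g_mul_gInv {k : Type*} [Field k] (q : k) (l : ℕ) {n : ℕ} (hl : l ≠ 0) (i : Fin n) :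
    g q l i * gInv q l i = 1 := by
  rw [gInv, ← pow_succ', Nat.sub_add_cancel (Nat.pos_of_ne_zero hl), g_pow]

theorem gInv_mul_g {k : Type*} [Field k] (q : k) (l : ℕ) {n : ℕ} (hl : l ≠ 0) (i : Fin n) :
    gInv q l i * g q l i = 1 := by
  rw [gInv, ← pow_succ, Nat.sub_add_cancel (Nat.pos_of_ne_zero hl), g_pow]

theorem gInv_mul_gInv {k : Type*} [Field k] (q : k) (l : ℕ) {n : ℕ} (i j : Fin n) :
    gInv q l i * gInv q l j = gInv q l j * gInv q l i :=
  ((show Commute (g q l i) (g q l j) from g_mul_g q l i j).pow_pow _ _).eq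

theorem x_mul_gInv {k : Type*} [Field k] (q : k) (l : ℕ) {n : ℕ} (hl : l ≠ 0) (i j : Fin n) :
    x q l j * gInv q l i =
      (taftTheta q i j * q ^ (if i = j then 1 else 0)) • (gInv q l i * x q l j) := by
  have h : x q l j * gInv q l i = gInv q l i * (g q l i * x q l j) * gInv q l i := by
    rw [← mul_assoc, gInv_mul_g q l hl, one_mul]
  rw [h, g_mul_x, mul_smul_comm, smul_mul_assoc, mul_assoc, mul_assoc, g_mul_gInv q l hl, mul_one]

theorem gInv_mul_x_pow {k : Type*} [Field k] (q : k) (l : ℕ) {n : ℕ} (hl : l ≠ 0) (i : Fin n) :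
    (gInv q l i * x q l i) ^ l = 0 := by
  have h : ∀ m : ℕ, ∃ c : k,
      (gInv q l i * x q l i) ^ m = c • (gInv q l i ^ m * x q l i ^ m) := by
    intro m
    induction m with
    | zero => exact ⟨1, by simp⟩
    | succ m ih =>
      obtain ⟨c, hc⟩ := ih
      have h2 := QBinom.pow_mul_of_mul (x_mul_gInv q l hl i i) m
      refine ⟨(taftTheta q i i * q ^ (if i = i then 1 else 0)) ^ m * c, ?_⟩
      rw [pow_succ', hc, mul_smul_comm, mul_assoc, ← mul_assoc (x q l i), h2, smul_mul_assoc,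
        mul_smul_comm, smul_smul, mul_assoc, ← pow_succ', ← mul_assoc, ← pow_succ', mul_comm c]
  obtain ⟨c, hc⟩ := h l
  rw [hc, x_pow, mul_zero, smul_zero]

theorem antipode_rels {k : Type*} [Field k] {q : k} {l : ℕ} (hq : q ≠ 0) (hl : l ≠ 0)
    (n : ℕ) : Rels (k := k) (B := (TaftAlgebra k q l n)ᵐᵒᵖ) q l n
      (fun i => MulOpposite.op (-(gInv q l i * x q l i)))
      (fun i => MulOpposite.op (gInv q l i)) where
  gg := fun i j => by rw [← MulOpposite.op_mul, ← MulOpposite.op_mul, gInv_mul_gInv]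
  gp := fun i => by
      rw [← MulOpposite.op_pow, gInv, ← pow_mul, mul_comm, pow_mul, g_pow, one_pow,
        MulOpposite.op_one]
  gx := fun i j => by
      rw [← MulOpposite.op_mul, ← MulOpposite.op_mul, ← MulOpposite.op_smul, neg_mul, mul_neg,
        mul_assoc, x_mul_gInv q l hl, mul_smul_comm, ← mul_assoc, ← mul_assoc,
        gInv_mul_gInv q l i j, smul_neg]
  xx := fun i j => by
      rw [← MulOpposite.op_mul, ← MulOpposite.op_mul, ← MulOpposite.op_smul, neg_mul_neg,
        neg_mul_neg]
      congr 1
      have e : ∀ a b : Fin n, gInv q l a * x q l a * (gInv q l b * x q l b) =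
          (taftTheta q b a * q ^ (if b = a then 1 else 0)) •
            (gInv q l a * gInv q l b * (x q l a * x q l b)) := by
        intro a b
        rw [mul_assoc, ← mul_assoc (x q l a), x_mul_gInv q l hl b a, smul_mul_assoc,
          mul_smul_comm]
        simp only [mul_assoc]
      rw [e, e, gInv_mul_gInv q l j i, x_mul_x q l i j, mul_smul_comm, smul_smul, smul_smul]
      by_cases hij : i = j
      · subst hij; simp [theta_self]
      · simp only [if_neg hij, if_neg (Ne.symm hij), pow_zero, mul_one]
        rw [theta_mul_theta hq, one_mul]
  xp := fun i => by
      rw [← MulOpposite.op_pow, neg_pow, gInv_mul_x_pow q l hl, mul_zero, MulOpposite.op_zero]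

/-- The antipode, as an algebra map to the opposite algebra:
`g i ↦ (g i)⁻¹` and `x i ↦ -(g i)⁻¹ * x i`. -/
noncomputable def antipodeHom {k : Type*} [Field k] {q : k} {l : ℕ} (hq : q ≠ 0) (hl : l ≠ 0)
    (n : ℕ) : TaftAlgebra k q l n →ₐ[k] (TaftAlgebra k q l n)ᵐᵒᵖ :=
  lift (antipode_rels hq hl n)

theorem antipodeHom_x {k : Type*} [Field k] {q : k} {l : ℕ} (hq : q ≠ 0) (hl : l ≠ 0)
    {n : ℕ} (i : Fin n) :
    antipodeHom hq hl n (x q l i) = MulOpposite.op (-(gInv q l i * x q l i)) :=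
  lift_x (antipode_rels hq hl n) i

theorem antipodeHom_g {k : Type*} [Field k] {q : k} {l : ℕ} (hq : q ≠ 0) (hl : l ≠ 0)
    {n : ℕ} (i : Fin n) :
    antipodeHom hq hl n (g q l i) = MulOpposite.op (gInv q l i) :=
  lift_g (antipode_rels hq hl n) i

noncomputable instance instHopfAlgebra {k : Type*} [Field k] (q : k) (l n : ℕ)
    [hq : Fact (IsPrimitiveRoot q l)] [hl : NeZero l] : HopfAlgebra k (TaftAlgebra k q l n) :=
  HopfAlgebra.ofGenerators (antipodeHom (hq.out.ne_zero hl.out) hl.out n) (gens q l n)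
    (adjoin_gens q l n)
    (by
      rintro _ (⟨i, rfl⟩ | ⟨i, rfl⟩)
      · simp [comul_x, counit_x, antipodeHom_x, antipodeHom_g]
      · simp [comul_g, counit_g, antipodeHom_g, gInv_mul_g q l hl.out])
    (by
      rintro _ (⟨i, rfl⟩ | ⟨i, rfl⟩)
      · simp [comul_x, counit_x, antipodeHom_x, ← mul_assoc, g_mul_gInv q l hl.out]
      · simp [comul_g, counit_g, antipodeHom_g, g_mul_gInv q l hl.out])

theorem antipode_x {k : Type*} [Field k] (q : k) (l : ℕ) {n : ℕ} [hq : Fact (IsPrimitiveRoot q l)]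
    [hl : NeZero l] (i : Fin n) :
    HopfAlgebra.antipode k (x q l i) = -(gInv q l i * x q l i) :=
  congrArg MulOpposite.unop (antipodeHom_x (hq.out.ne_zero hl.out) hl.out i)

theorem antipode_g {k : Type*} [Field k] (q : k) (l : ℕ) {n : ℕ} [hq : Fact (IsPrimitiveRoot q l)]
    [hl : NeZero l] (i : Fin n) :
    HopfAlgebra.antipode k (g q l i) = gInv q l i :=
  congrArg MulOpposite.unop (antipodeHom_g (hq.out.ne_zero hl.out) hl.out i)

end TaftAlgebra

/-! ### Finite dimension and bijectivity of the antipode -/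

/-- An algebra generated by finitely many elements that commute up to scalars and have scalar
`l`-th powers is finite-dimensional. -/
theorem finite_of_qcommuting {k A ι : Type*} [Field k] [Ring A] [Algebra k A] [Fintype ι]
    (y : ι → A) (l : ℕ) (hl : l ≠ 0) (hgen : Algebra.adjoin k (Set.range y) = ⊤)
    (hc : ∀ i j, ∃ c : k, y i * y j = c • (y j * y i))
    (hp : ∀ i, ∃ c : k, y i ^ l = algebraMap k A c) : Module.Finite k A := by
  classical
  set P : ι → Submodule k A := fun i => Subalgebra.toSubmodule (Algebra.adjoin k {y i}) with hP
  have hPspan : ∀ i, P i = Submodule.span k (Submonoid.powers (y i) : Set A) := fun i => by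
    rw [hP]; simp only [Algebra.adjoin_eq_span, Submonoid.powers_eq_closure]
  have hPP : ∀ i, P i * P i = P i := fun i => Subalgebra.isIdempotentElem_toSubmodule _
  have h1P : ∀ i, (1 : Submodule k A) ≤ P i := fun i => by
    rw [Submodule.one_le]; exact one_mem (Algebra.adjoin k {y i})
  have hfg : ∀ i, (P i).FG := fun i => by
    obtain ⟨c, hc⟩ := hp i
    refine IsIntegral.fg_adjoin_singleton ⟨Polynomial.X ^ l - Polynomial.C c,
      Polynomial.monic_X_pow_sub_C c hl, ?_⟩
    simp [hc]
  have hle : ∀ i j, P i * P j ≤ P j * P i := fun i j => by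
    rw [hPspan i, hPspan j, Submodule.span_mul_span, Submodule.span_mul_span, Submodule.span_le]
    rintro _ ⟨_, ⟨a, rfl⟩, _, ⟨b, rfl⟩, rfl⟩
    obtain ⟨c, hc⟩ := hc i j
    have h1 : ∀ b : ℕ, y i * y j ^ b = c ^ b • (y j ^ b * y i) := QBinom.pow_mul_of_mul hc
    have h2 : ∀ a : ℕ, ∃ d : k, y i ^ a * y j ^ b = d • (y j ^ b * y i ^ a) := by
      intro a
      induction a with
      | zero => exact ⟨1, by simp⟩
      | succ a ih =>
        obtain ⟨d, hd⟩ := ih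
        refine ⟨d * c ^ b, ?_⟩
        rw [pow_succ', mul_assoc, hd, mul_smul_comm, ← mul_assoc, h1, smul_mul_assoc, smul_smul,
          mul_assoc]
    obtain ⟨d, hd⟩ := h2 a
    show y i ^ a * y j ^ b ∈ _
    rw [hd]
    exact Submodule.smul_mem _ _ (Submodule.subset_span ⟨_, ⟨b, rfl⟩, _, ⟨a, rfl⟩, rfl⟩)
  have hcomm : ∀ i j, P i * P j = P j * P i := fun i j => le_antisymm (hle i j) (hle j i)
  have main : ∀ s : Finset ι, ∃ T : Submodule k A, T.FG ∧ 1 ≤ T ∧ T * T = T ∧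
      (∀ i ∈ s, P i ≤ T) ∧ ∀ j, P j * T = T * P j := by
    intro s
    induction s using Finset.induction_on with
    | empty =>
      refine ⟨1, ?_, le_rfl, mul_one _, by simp, by simp⟩
      rw [Submodule.one_eq_span]; exact Submodule.fg_span_singleton _
    | insert i s _ ih =>
      obtain ⟨T, hT, h1, hTT, hs, hj⟩ := ih
      refine ⟨P i * T, (hfg i).mul hT, ?_, ?_, ?_, ?_⟩
      · calc (1 : Submodule k A) = 1 * 1 := (mul_one 1).symm
          _ ≤ P i * T := mul_le_mul' (h1P i) h1
      · rw [mul_assoc, ← mul_assoc T, ← hj i, mul_assoc (P i), hTT, ← mul_assoc, hPP]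
      · intro j hj'
        rcases Finset.mem_insert.1 hj' with rfl | h
        · calc P j = P j * 1 := (mul_one _).symm
            _ ≤ _ := mul_le_mul' le_rfl h1
        · calc P j = 1 * P j := (one_mul _).symm
            _ ≤ _ := mul_le_mul' (h1P i) (hs j h)
      · intro j
        rw [← mul_assoc, hcomm j i, mul_assoc, hj j, mul_assoc]
  obtain ⟨T, hT, h1, hTT, hs, -⟩ := main Finset.univ
  have htop : T = ⊤ := by
    rw [eq_top_iff]
    intro a _
    have ha : a ∈ Algebra.adjoin k (Set.range y) := hgen ▸ Algebra.mem_top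
    have h1' : (1 : A) ∈ T := Submodule.one_le.1 h1
    induction ha using Algebra.adjoin_induction with
    | mem x hx =>
      obtain ⟨i, rfl⟩ := hx
      exact hs i (Finset.mem_univ i) (Algebra.subset_adjoin rfl)
    | algebraMap r => rw [Algebra.algebraMap_eq_smul_one]; exact T.smul_mem _ h1'
    | add x y _ _ hx hy => exact T.add_mem (hx trivial) (hy trivial)
    | mul x y _ _ hx hy => rw [← hTT]; exact Submodule.mul_mem_mul (hx trivial) (hy trivial)
  exact ⟨htop ▸ hT⟩

/-- Hopf algebras with bijective antipode; every finite-dimensional Hopf algebra over a field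
is one. -/
class HasBijectiveAntipode (k H : Type*) [CommRing k] [Ring H] [HopfAlgebra k H] : Prop where
  bijective : Function.Bijective (HopfAlgebra.antipode k : H →ₗ[k] H)

namespace TaftAlgebra

instance {k : Type*} [Field k] (q : k) (l n : ℕ) [hq : Fact (IsPrimitiveRoot q l)]
    [hl : NeZero l] : Module.Finite k (TaftAlgebra k q l n) := by
  refine finite_of_qcommuting (Sum.elim (x q l) (g q l)) l hl.out ?_ ?_ ?_
  · rw [Set.Sum.elim_range]; exact adjoin_gens q l n
  · have h0 := hq.out.ne_zero hl.out
    rintro (i | i) (j | j)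
    · exact ⟨_, x_mul_x q l i j⟩
    · refine ⟨(taftTheta q j i * q ^ (if j = i then 1 else 0))⁻¹, ?_⟩
      have hne : taftTheta q j i * q ^ (if j = i then 1 else 0) ≠ 0 :=
        mul_ne_zero (left_ne_zero_of_mul_eq_one (theta_mul_theta h0 j i)) (pow_ne_zero _ h0)
      show x q l i * g q l j = _ • (g q l j * x q l i)
      rw [g_mul_x, smul_smul, inv_mul_cancel₀ hne, one_smul]
    · exact ⟨_, g_mul_x q l i j⟩
    · exact ⟨1, by rw [one_smul]; exact g_mul_g q l i j⟩
  · rintro (i | i)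
    · exact ⟨0, by rw [map_zero]; exact x_pow q l i⟩
    · exact ⟨1, by rw [map_one]; exact g_pow q l i⟩

instance {k : Type*} [Field k] (q : k) (l n : ℕ) [hq : Fact (IsPrimitiveRoot q l)]
    [hl : NeZero l] : HasBijectiveAntipode k (TaftAlgebra k q l n) := by
  have hmul : ∀ a b, a ∈ LinearMap.range (HopfAlgebra.antipode k (A := TaftAlgebra k q l n)) →
      b ∈ LinearMap.range (HopfAlgebra.antipode k (A := TaftAlgebra k q l n)) →
      a * b ∈ LinearMap.range (HopfAlgebra.antipode k (A := TaftAlgebra k q l n)) := by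
    rintro _ _ ⟨a, rfl⟩ ⟨b, rfl⟩
    exact ⟨b * a, HopfAlgebra.antipode_mul_antidistrib b a⟩
  have hone : 1 ∈ LinearMap.range (HopfAlgebra.antipode k (A := TaftAlgebra k q l n)) :=
    ⟨1, HopfAlgebra.antipode_one⟩
  have hpow : ∀ a, a ∈ LinearMap.range (HopfAlgebra.antipode k (A := TaftAlgebra k q l n)) →
      ∀ m : ℕ, a ^ m ∈ LinearMap.range (HopfAlgebra.antipode k (A := TaftAlgebra k q l n)) := by
    intro a ha m
    induction m with
    | zero => rw [pow_zero]; exact hone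
    | succ m ih => rw [pow_succ]; exact hmul _ _ ih ha
  have hg : ∀ i, g q l i ∈ LinearMap.range
      (HopfAlgebra.antipode k (A := TaftAlgebra k q l n)) := by
    intro i
    have h : g q l i = gInv q l i ^ (l - 1) := by
      have h1 : gInv q l i ^ (l - 1) * (gInv q l i * g q l i) = g q l i := by
        rw [← mul_assoc, ← pow_succ, Nat.sub_add_cancel (Nat.pos_of_ne_zero hl.out), gInv,
          ← pow_mul, mul_comm (l - 1), pow_mul, g_pow, one_pow, one_mul]
      rw [gInv_mul_g q l hl.out, mul_one] at h1
      exact h1.symm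
    rw [h]
    exact hpow _ ⟨g q l i, antipode_g q l i⟩ _
  have hsurj : Function.Surjective (HopfAlgebra.antipode k (A := TaftAlgebra k q l n)) := by
    intro a
    have ha : a ∈ Algebra.adjoin k (gens q l n) := adjoin_gens q l n ▸ Algebra.mem_top
    change a ∈ LinearMap.range (HopfAlgebra.antipode k (A := TaftAlgebra k q l n))
    induction ha using Algebra.adjoin_induction with
    | mem a ha =>
      rcases ha with ⟨i, rfl⟩ | ⟨i, rfl⟩
      · have h : x q l i = -(g q l i * HopfAlgebra.antipode k (x q l i)) := by
          rw [antipode_x, mul_neg, neg_neg, ← mul_assoc, g_mul_gInv q l hl.out, one_mul]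
        rw [h]
        exact neg_mem (hmul _ _ (hg i) ⟨_, rfl⟩)
      · exact hg i
    | algebraMap r => rw [Algebra.algebraMap_eq_smul_one]; exact Submodule.smul_mem _ _ hone
    | add x y _ _ hx hy => exact add_mem hx hy
    | mul x y _ _ hx hy => exact hmul _ _ hx hy
  exact ⟨LinearMap.injective_iff_surjective.2 hsurj, hsurj⟩

end TaftAlgebra

/-! ### The dual Hopf algebra with opposite comultiplication -/

/-- The inverse of the antipode. -/
noncomputable def antipodeInv (k : Type*) {H : Type*} [CommRing k] [Ring H] [HopfAlgebra k H]
    [HasBijectiveAntipode k H] : H →ₗ[k] H :=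
  (LinearEquiv.ofBijective (HopfAlgebra.antipode k (A := H))
    HasBijectiveAntipode.bijective).symm.toLinearMap

theorem antipode_antipodeInv {k H : Type*} [CommRing k] [Ring H] [HopfAlgebra k H]
    [HasBijectiveAntipode k H] (h : H) : HopfAlgebra.antipode k (antipodeInv k h) = h :=
  LinearEquiv.apply_symm_apply (LinearEquiv.ofBijective (HopfAlgebra.antipode k (A := H))
    HasBijectiveAntipode.bijective) h

theorem antipodeInv_antipode {k H : Type*} [CommRing k] [Ring H] [HopfAlgebra k H]
    [HasBijectiveAntipode k H] (h : H) : antipodeInv k (HopfAlgebra.antipode k h) = h :=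
  LinearEquiv.symm_apply_apply (LinearEquiv.ofBijective (HopfAlgebra.antipode k (A := H))
    HasBijectiveAntipode.bijective) h

theorem antipodeInv_one {k H : Type*} [CommRing k] [Ring H] [HopfAlgebra k H]
    [HasBijectiveAntipode k H] : antipodeInv k (1 : H) = 1 := by
  conv_lhs => rw [← HopfAlgebra.antipode_one (R := k) (A := H)]
  exact antipodeInv_antipode 1

/-- `∑ h₂ S⁻¹(h₁) = ε(h) 1`. -/
theorem mul_antipodeInv_left {k H : Type*} [CommRing k] [Ring H] [HopfAlgebra k H]
    [HasBijectiveAntipode k H] (h : H) :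
    LinearMap.mul' k H (TensorProduct.comm k H H ((antipodeInv k).rTensor H
      (Coalgebra.comul h))) = algebraMap k H (Coalgebra.counit h) := by
  apply (HasBijectiveAntipode.bijective (k := k) (H := H)).1
  have e : ∀ t : H ⊗[k] H, HopfAlgebra.antipode k (LinearMap.mul' k H
      (TensorProduct.comm k H H ((antipodeInv k).rTensor H t))) =
      LinearMap.mul' k H ((HopfAlgebra.antipode k).lTensor H t) := by
    intro t
    induction t with
    | zero => simp
    | add x y hx hy => simp only [map_add, hx, hy]
    | tmul a b => simp [HopfAlgebra.antipode_mul_antidistrib, antipode_antipodeInv]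
  rw [e, HopfAlgebra.mul_antipode_lTensor_comul_apply]
  simp [Algebra.algebraMap_eq_smul_one]

/-- `∑ S⁻¹(h₂) h₁ = ε(h) 1`. -/
theorem mul_antipodeInv_right {k H : Type*} [CommRing k] [Ring H] [HopfAlgebra k H]
    [HasBijectiveAntipode k H] (h : H) :
    LinearMap.mul' k H (TensorProduct.comm k H H ((antipodeInv k).lTensor H
      (Coalgebra.comul h))) = algebraMap k H (Coalgebra.counit h) := by
  apply (HasBijectiveAntipode.bijective (k := k) (H := H)).1
  have e : ∀ t : H ⊗[k] H, HopfAlgebra.antipode k (LinearMap.mul' k H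
      (TensorProduct.comm k H H ((antipodeInv k).lTensor H t))) =
      LinearMap.mul' k H ((HopfAlgebra.antipode k).rTensor H t) := by
    intro t
    induction t with
    | zero => simp
    | add x y hx hy => simp only [map_add, hx, hy]
    | tmul a b => simp [HopfAlgebra.antipode_mul_antidistrib, antipode_antipodeInv]
  rw [e, HopfAlgebra.mul_antipode_rTensor_comul_apply]
  simp [Algebra.algebraMap_eq_smul_one]

/-- The Hopf algebra `(H^*)^cop`: linear functionals on `H` with the convolution product, and the
opposite of the comultiplication dual to the product of `H`. -/
def DualCop (k H : Type*) [CommRing k] [AddCommGroup H] [Module k H] : Type _ :=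
  WithConv (H →ₗ[k] k)

namespace DualCop

noncomputable instance {k H : Type*} [CommRing k] [AddCommGroup H] [Module k H] [Coalgebra k H] :
    Ring (DualCop k H) := inferInstanceAs (Ring (WithConv (H →ₗ[k] k)))

noncomputable instance {k H : Type*} [CommRing k] [AddCommGroup H] [Module k H] [Coalgebra k H] :
    Algebra k (DualCop k H) := inferInstanceAs (Algebra k (WithConv (H →ₗ[k] k)))

/-- The underlying space of `DualCop k H` is the dual space of `H`. -/
noncomputable def toDual (k H : Type*) [CommRing k] [AddCommGroup H] [Module k H]
    [Coalgebra k H] : DualCop k H ≃ₗ[k] Module.Dual k H where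
  toFun f := WithConv.ofConv f
  invFun f := WithConv.toConv f
  map_add' _ _ := rfl
  map_smul' _ _ := rfl
  left_inv _ := rfl
  right_inv _ := rfl

theorem ext {k H : Type*} [CommRing k] [AddCommGroup H] [Module k H] [Coalgebra k H]
    {f g : DualCop k H} (h : ∀ a, toDual k H f a = toDual k H g a) : f = g :=
  (toDual k H).injective (LinearMap.ext h)

theorem toDual_one {k H : Type*} [CommRing k] [AddCommGroup H] [Module k H] [Coalgebra k H] :
    toDual k H 1 = Coalgebra.counit := rfl

theorem toDual_mul {k H : Type*} [CommRing k] [AddCommGroup H] [Module k H] [Coalgebra k H]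
    (f g : DualCop k H) (a : H) : toDual k H (f * g) a =
      LinearMap.mul' k k (TensorProduct.map (toDual k H f) (toDual k H g) (Coalgebra.comul a)) :=
  rfl

instance {k H : Type*} [Field k] [AddCommGroup H] [Module k H] [Coalgebra k H]
    [Module.Finite k H] : Module.Finite k (DualCop k H) :=
  Module.Finite.equiv (toDual k H).symm

/-- The identification of `H^* ⊗ H^*` with the dual of `H ⊗ H`. -/
noncomputable def pair (k H : Type*) [Field k] [AddCommGroup H] [Module k H]
    [Coalgebra k H] [Module.Finite k H] :
    DualCop k H ⊗[k] DualCop k H ≃ₗ[k] Module.Dual k (H ⊗[k] H) :=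
  (TensorProduct.congr (toDual k H) (toDual k H)).trans (TensorProduct.dualDistribEquiv k H H)

theorem pair_tmul {k H : Type*} [Field k] [AddCommGroup H] [Module k H]
    [Coalgebra k H] [Module.Finite k H] (f g : DualCop k H) (a b : H) :
    pair k H (f ⊗ₜ g) (a ⊗ₜ b) = toDual k H f a * toDual k H g b := rfl

theorem pair_ext {k H : Type*} [Field k] [AddCommGroup H] [Module k H]
    [Coalgebra k H] [Module.Finite k H] {s t : DualCop k H ⊗[k] DualCop k H}
    (h : ∀ a b, pair k H s (a ⊗ₜ b) = pair k H t (a ⊗ₜ b)) : s = t :=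
  (pair k H).injective (TensorProduct.ext' h)

/-- The same for three factors. -/
noncomputable def pair₃ (k H : Type*) [Field k] [AddCommGroup H] [Module k H]
    [Coalgebra k H] [Module.Finite k H] :
    DualCop k H ⊗[k] (DualCop k H ⊗[k] DualCop k H) ≃ₗ[k] Module.Dual k (H ⊗[k] (H ⊗[k] H)) :=
  (TensorProduct.congr (toDual k H) (pair k H)).trans
    (TensorProduct.dualDistribEquiv k H (H ⊗[k] H))

theorem pair₃_tmul {k H : Type*} [Field k] [AddCommGroup H] [Module k H]
    [Coalgebra k H] [Module.Finite k H] (f : DualCop k H) (s : DualCop k H ⊗[k] DualCop k H)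
    (a : H) (b : H ⊗[k] H) :
    pair₃ k H (f ⊗ₜ s) (a ⊗ₜ b) = toDual k H f a * pair k H s b := rfl

/-- The opposite comultiplication: `∑ f₁(a) f₂(b) = f (b a)`. -/
noncomputable instance {k H : Type*} [Field k] [Ring H] [Bialgebra k H] [Module.Finite k H] :
    CoalgebraStruct k (DualCop k H) where
  comul := (pair k H).symm.toLinearMap ∘ₗ
    LinearMap.dualMap (LinearMap.mul' k H ∘ₗ (TensorProduct.comm k H H).toLinearMap) ∘ₗ
    (toDual k H).toLinearMap
  counit := LinearMap.applyₗ 1 ∘ₗ (toDual k H).toLinearMap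

theorem pair_comul {k H : Type*} [Field k] [Ring H] [Bialgebra k H] [Module.Finite k H]
    (f : DualCop k H) : pair k H (Coalgebra.comul f) =
      toDual k H f ∘ₗ (LinearMap.mul' k H ∘ₗ (TensorProduct.comm k H H).toLinearMap) :=
  LinearEquiv.apply_symm_apply (pair k H) _

theorem pair_comul_tmul {k H : Type*} [Field k] [Ring H] [Bialgebra k H] [Module.Finite k H]
    (f : DualCop k H) (a b : H) :
    pair k H (Coalgebra.comul f) (a ⊗ₜ b) = toDual k H f (b * a) := by
  rw [pair_comul]; rfl

theorem counit_apply {k H : Type*} [Field k] [Ring H] [Bialgebra k H] [Module.Finite k H]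
    (f : DualCop k H) : Coalgebra.counit (R := k) f = toDual k H f 1 := rfl

noncomputable instance {k H : Type*} [Field k] [Ring H] [Bialgebra k H] [Module.Finite k H] :
    Coalgebra k (DualCop k H) where
  coassoc := by
    ext f
    apply (pair₃ k H).injective
    have e1 : ∀ (s : DualCop k H ⊗[k] DualCop k H) (g : DualCop k H) (a b c : H),
        pair₃ k H (TensorProduct.assoc k _ _ _ (s ⊗ₜ[k] g)) (a ⊗ₜ (b ⊗ₜ c)) =
          pair k H s (a ⊗ₜ b) * toDual k H g c := by
      intro s g a b c
      induction s with
      | zero => simp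
      | add x y hx hy => simp only [TensorProduct.add_tmul, map_add, LinearMap.add_apply, hx, hy,
          add_mul]
      | tmul f f' => simp [pair₃_tmul, pair_tmul, mul_assoc]
    have e2 : ∀ (t : DualCop k H ⊗[k] DualCop k H) (a b c : H),
        pair₃ k H (TensorProduct.assoc k _ _ _ (Coalgebra.comul.rTensor _ t))
          (a ⊗ₜ (b ⊗ₜ c)) = pair k H t ((b * a) ⊗ₜ c) := by
      intro t a b c
      induction t with
      | zero => simp
      | add x y hx hy => simp only [map_add, LinearMap.add_apply, hx, hy]
      | tmul f f' => rw [LinearMap.rTensor_tmul, e1, pair_comul_tmul, pair_tmul]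
    have e3 : ∀ (t : DualCop k H ⊗[k] DualCop k H) (a b c : H),
        pair₃ k H (Coalgebra.comul.lTensor _ t)
          (a ⊗ₜ (b ⊗ₜ c)) = pair k H t (a ⊗ₜ (c * b)) := by
      intro t a b c
      induction t with
      | zero => simp
      | add x y hx hy => simp only [map_add, LinearMap.add_apply, hx, hy]
      | tmul f f' => rw [LinearMap.lTensor_tmul, pair₃_tmul, pair_comul_tmul, pair_tmul]
    apply TensorProduct.ext_threefold'
    intro a b c
    simp only [LinearMap.comp_apply, LinearEquiv.coe_coe]
    rw [e2, e3, pair_comul_tmul, pair_comul_tmul, mul_assoc]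
  rTensor_counit_comp_comul := by
    ext f
    apply (TensorProduct.lid k (DualCop k H)).injective
    apply DualCop.ext
    intro b
    have e : ∀ t : DualCop k H ⊗[k] DualCop k H,
        toDual k H (TensorProduct.lid k _ (Coalgebra.counit.rTensor _ t)) b =
          pair k H t (1 ⊗ₜ b) := by
      intro t
      induction t with
      | zero => simp
      | add x y hx hy => simp only [map_add, LinearMap.add_apply, hx, hy]
      | tmul f f' => simp [pair_tmul, counit_apply]
    simp only [LinearMap.comp_apply]
    rw [e, pair_comul_tmul]
    simp
  lTensor_counit_comp_comul := by
    ext f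
    apply (TensorProduct.rid k (DualCop k H)).injective
    apply DualCop.ext
    intro b
    have e : ∀ t : DualCop k H ⊗[k] DualCop k H,
        toDual k H (TensorProduct.rid k _ (Coalgebra.counit.lTensor _ t)) b =
          pair k H t (b ⊗ₜ 1) := by
      intro t
      induction t with
      | zero => simp
      | add x y hx hy => simp only [map_add, LinearMap.add_apply, hx, hy]
      | tmul f f' => simp [pair_tmul, counit_apply, mul_comm]
    simp only [LinearMap.comp_apply]
    rw [e, pair_comul_tmul]
    simp

theorem pair_mul {k H : Type*} [Field k] [AddCommGroup H] [Module k H]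
    [Coalgebra k H] [Module.Finite k H] (s t : DualCop k H ⊗[k] DualCop k H) :
    WithConv.toConv (pair k H (s * t)) =
      WithConv.toConv (pair k H s) * WithConv.toConv (pair k H t) := by
  have key : ∀ f g f' g' : DualCop k H,
      WithConv.toConv (pair k H ((f ⊗ₜ[k] g) * (f' ⊗ₜ[k] g'))) =
        WithConv.toConv (pair k H (f ⊗ₜ[k] g)) * WithConv.toConv (pair k H (f' ⊗ₜ[k] g')) := by
    intro f g f' g'
    apply WithConv.ofConv_injective
    apply TensorProduct.ext'
    intro a b
    rw [Algebra.TensorProduct.tmul_mul_tmul]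
    simp only
    rw [pair_tmul, toDual_mul, toDual_mul, LinearMap.convMul_apply]
    simp only [TensorProduct.comul_tmul]
    generalize (Coalgebra.comul a : H ⊗[k] H) = u
    generalize (Coalgebra.comul b : H ⊗[k] H) = v
    induction u with
    | zero => simp
    | add x y hx hy => simp only [TensorProduct.add_tmul, map_add, add_mul, hx, hy]
    | tmul a a' =>
      induction v with
      | zero => simp
      | add x y hx hy => simp only [TensorProduct.tmul_add, map_add, mul_add, hx, hy]
      | tmul b b' => simp [pair_tmul]; ring
  induction s with
  | zero => simp
  | add x y hx hy => simp only [add_mul, map_add, WithConv.toConv_add, hx, hy]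
  | tmul f g =>
    induction t with
    | zero => simp
    | add x y hx hy => simp only [mul_add, map_add, WithConv.toConv_add, hx, hy]
    | tmul f' g' => exact key f g f' g'

noncomputable instance {k H : Type*} [Field k] [Ring H] [Bialgebra k H] [Module.Finite k H] :
    Bialgebra k (DualCop k H) :=
  Bialgebra.mk' k (DualCop k H)
    (by rw [counit_apply, toDual_one, Bialgebra.counit_one])
    (by intro f g; simp [counit_apply, toDual_mul, Algebra.TensorProduct.one_def])
    (by
      apply pair_ext
      intro a b
      rw [pair_comul_tmul, Algebra.TensorProduct.one_def, pair_tmul, toDual_one,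
        Bialgebra.counit_mul, mul_comm])
    (by
      intro f g
      apply (pair k H).injective
      apply WithConv.toConv_injective
      rw [pair_mul, pair_comul, pair_comul, pair_comul]
      exact congrArg WithConv.toConv (LinearMap.convMul_comp_coalgHom_distrib
        (f : WithConv (H →ₗ[k] k)) g
        ((Bialgebra.mulCoalgHom k H).comp
          (Bialgebra.TensorProduct.comm k H H : H ⊗[k] H →ₗc[k] H ⊗[k] H))))

noncomputable instance {k H : Type*} [Field k] [Ring H] [HopfAlgebra k H] [Module.Finite k H]
    [HasBijectiveAntipode k H] : HopfAlgebra k (DualCop k H) where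
  antipode := (toDual k H).symm.toLinearMap ∘ₗ LinearMap.dualMap (antipodeInv k) ∘ₗ
    (toDual k H).toLinearMap
  mul_antipode_rTensor_comul := by
    ext f
    apply DualCop.ext
    intro a
    have e : ∀ (t : DualCop k H ⊗[k] DualCop k H) , toDual k H (LinearMap.mul' k _
        (LinearMap.rTensor _ ((toDual k H).symm.toLinearMap ∘ₗ LinearMap.dualMap (antipodeInv k) ∘ₗ
          (toDual k H).toLinearMap) t)) a =
        pair k H t ((antipodeInv k).rTensor H (Coalgebra.comul a)) := by
      intro t
      induction t with
      | zero => simp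
      | add x y hx hy => simp only [map_add, LinearMap.add_apply, hx, hy]
      | tmul f g =>
        rw [LinearMap.rTensor_tmul, LinearMap.mul'_apply, toDual_mul]
        generalize (Coalgebra.comul a : H ⊗[k] H) = u
        induction u with
        | zero => simp
        | add x y hx hy => simp only [map_add, hx, hy]
        | tmul b b' => simp [pair_tmul]
    refine (e _).trans ?_
    rw [pair_comul]
    simp only [LinearMap.comp_apply, LinearEquiv.coe_coe]
    rw [mul_antipodeInv_left]
    simp [Algebra.algebraMap_eq_smul_one, counit_apply, toDual_one, mul_comm]
  mul_antipode_lTensor_comul := by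
    ext f
    apply DualCop.ext
    intro a
    have e : ∀ (t : DualCop k H ⊗[k] DualCop k H) , toDual k H (LinearMap.mul' k _
        (LinearMap.lTensor _ ((toDual k H).symm.toLinearMap ∘ₗ LinearMap.dualMap (antipodeInv k) ∘ₗ
          (toDual k H).toLinearMap) t)) a =
        pair k H t ((antipodeInv k).lTensor H (Coalgebra.comul a)) := by
      intro t
      induction t with
      | zero => simp
      | add x y hx hy => simp only [map_add, LinearMap.add_apply, hx, hy]
      | tmul f g =>
        rw [LinearMap.lTensor_tmul, LinearMap.mul'_apply, toDual_mul]
        generalize (Coalgebra.comul a : H ⊗[k] H) = u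
        induction u with
        | zero => simp
        | add x y hx hy => simp only [map_add, hx, hy]
        | tmul b b' => simp [pair_tmul]
    refine (e _).trans ?_
    rw [pair_comul]
    simp only [LinearMap.comp_apply, LinearEquiv.coe_coe]
    rw [mul_antipodeInv_right]
    simp [Algebra.algebraMap_eq_smul_one, counit_apply, toDual_one, mul_comm]

theorem antipode_apply {k H : Type*} [Field k] [Ring H] [HopfAlgebra k H] [Module.Finite k H]
    [HasBijectiveAntipode k H] (f : DualCop k H) (a : H) :
    toDual k H (HopfAlgebra.antipode k f) a = toDual k H f (antipodeInv k a) := rfl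

end DualCop

/-! ### Deformation of a product by a two-cocycle -/

namespace ConvTwist

open WithConv

/-- A scalar-valued map as an algebra-valued one. -/
noncomputable def eta {k X : Type*} (B : Type*) [CommRing k] [AddCommGroup X] [Module k X]
    [Ring B] [Algebra k B] (u : WithConv (X →ₗ[k] k)) : WithConv (X →ₗ[k] B) :=
  toConv (Algebra.linearMap k B ∘ₗ u.ofConv)

theorem eta_mul {k X B : Type*} [CommRing k] [AddCommGroup X] [Module k X]
    [Coalgebra k X] [Ring B] [Algebra k B] (u v : WithConv (X →ₗ[k] k)) :
    eta B (u * v) = eta B u * eta B v :=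
  congrArg toConv (LinearMap.algHom_comp_convMul_distrib (Algebra.ofId k B) u v)

theorem eta_one {k X B : Type*} [CommRing k] [AddCommGroup X] [Module k X]
    [Coalgebra k X] [Ring B] [Algebra k B] : eta B (1 : WithConv (X →ₗ[k] k)) = 1 := rfl

theorem eta_self {k X : Type*} [CommRing k] [AddCommGroup X] [Module k X]
    (u : WithConv (X →ₗ[k] k)) : eta k u = u := rfl

theorem eta_mul_apply {k X B : Type*} [CommRing k] [AddCommGroup X] [Module k X]
    [Coalgebra k X] [Ring B] [Algebra k B] (u : WithConv (X →ₗ[k] k))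
    (F : WithConv (X →ₗ[k] B)) :
    (eta B u * F).ofConv = (TensorProduct.lid k B).toLinearMap ∘ₗ
      TensorProduct.map u.ofConv F.ofConv ∘ₗ Coalgebra.comul := by
  have : LinearMap.mul' k B ∘ₗ TensorProduct.map (eta B u).ofConv F.ofConv =
      (TensorProduct.lid k B).toLinearMap ∘ₗ TensorProduct.map u.ofConv F.ofConv := by
    ext; simp [eta, Algebra.smul_def]
  rw [LinearMap.convMul_def, ofConv_toConv, ← LinearMap.comp_assoc, this, LinearMap.comp_assoc]

theorem mul_eta_apply {k X B : Type*} [CommRing k] [AddCommGroup X] [Module k X]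
    [Coalgebra k X] [Ring B] [Algebra k B] (u : WithConv (X →ₗ[k] k))
    (F : WithConv (X →ₗ[k] B)) :
    (F * eta B u).ofConv = (TensorProduct.rid k B).toLinearMap ∘ₗ
      TensorProduct.map F.ofConv u.ofConv ∘ₗ Coalgebra.comul := by
  have : LinearMap.mul' k B ∘ₗ TensorProduct.map F.ofConv (eta B u).ofConv =
      (TensorProduct.rid k B).toLinearMap ∘ₗ TensorProduct.map F.ofConv u.ofConv := by
    ext; simp [eta, Algebra.smul_def, Algebra.commutes]
  rw [LinearMap.convMul_def, ofConv_toConv, ← LinearMap.comp_assoc, this, LinearMap.comp_assoc]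

/-- Scalar factors pass through linear maps. -/
theorem comp_eta_mul {k X B B' : Type*} [CommRing k] [AddCommGroup X] [Module k X]
    [Coalgebra k X] [Ring B] [Algebra k B] [Ring B'] [Algebra k B'] (φ : B →ₗ[k] B')
    (u v : WithConv (X →ₗ[k] k)) (F : WithConv (X →ₗ[k] B)) :
    toConv (φ ∘ₗ (eta B u * F * eta B v).ofConv) =
      eta B' u * toConv (φ ∘ₗ F.ofConv) * eta B' v := by
  apply ofConv_injective
  rw [mul_eta_apply, mul_eta_apply, eta_mul_apply, eta_mul_apply, ofConv_toConv]
  have h1 : φ ∘ₗ (TensorProduct.rid k B).toLinearMap =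
      (TensorProduct.rid k B').toLinearMap ∘ₗ φ.rTensor k := by ext; simp
  have h2 : φ ∘ₗ (TensorProduct.lid k B).toLinearMap =
      (TensorProduct.lid k B').toLinearMap ∘ₗ φ.lTensor k := by ext; simp
  rw [← LinearMap.comp_assoc, h1, LinearMap.comp_assoc, ← LinearMap.comp_assoc _ _ (φ.rTensor k),
    LinearMap.rTensor_comp_map, ← LinearMap.comp_assoc _ _ φ, h2, LinearMap.comp_assoc,
    ← LinearMap.comp_assoc _ _ (φ.lTensor k), LinearMap.lTensor_comp_map]

theorem comp_coalgHom_mul {k X Y B : Type*} [CommRing k] [AddCommGroup X] [Module k X]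
    [Coalgebra k X] [AddCommGroup Y] [Module k Y] [Coalgebra k Y] [Ring B] [Algebra k B]
    (f g : WithConv (X →ₗ[k] B)) (h : Y →ₗc[k] X) :
    toConv ((f * g).ofConv ∘ₗ h.toLinearMap) =
      toConv (f.ofConv ∘ₗ h.toLinearMap) * toConv (g.ofConv ∘ₗ h.toLinearMap) :=
  congrArg toConv (LinearMap.convMul_comp_coalgHom_distrib f g h)

theorem comp_coalgHom_one {k X Y B : Type*} [CommRing k] [AddCommGroup X] [Module k X]
    [Coalgebra k X] [AddCommGroup Y] [Module k Y] [Coalgebra k Y] [Ring B] [Algebra k B]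
    (h : Y →ₗc[k] X) :
    toConv ((1 : WithConv (X →ₗ[k] B)).ofConv ∘ₗ h.toLinearMap) = 1 := by
  ext y; simp

/-- The deformed product `x y = ∑ s(x₁, y₁) x₂ y₂ s'(x₃, y₃)`. -/
noncomputable def twist {k C : Type*} [CommRing k] [Ring C] [Bialgebra k C]
    (s s' : WithConv (C ⊗[k] C →ₗ[k] k)) : WithConv (C ⊗[k] C →ₗ[k] C) :=
  eta C s * toConv (LinearMap.mul' k C) * eta C s'

/-- Linear maps out of a coalgebra into a bialgebra, compared with the comultiplication. -/
theorem map_map_comul {k X C : Type*} [CommRing k] [AddCommGroup X] [Module k X]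
    [Coalgebra k X] [Ring C] [Algebra k C] (F : WithConv (X →ₗ[k] C)) :
    toConv (TensorProduct.map F.ofConv F.ofConv ∘ₗ Coalgebra.comul) =
      toConv ((Algebra.TensorProduct.includeLeft : C →ₐ[k] C ⊗[k] C).toLinearMap ∘ₗ F.ofConv) *
      toConv ((Algebra.TensorProduct.includeRight : C →ₐ[k] C ⊗[k] C).toLinearMap ∘ₗ
        F.ofConv) := by
  rw [LinearMap.convMul_def, ← LinearMap.comp_assoc]
  congr 2
  ext; simp

/-- The deformed product is a coalgebra map. -/
noncomputable def twistCoalgHom {k C : Type*} [CommRing k] [Ring C] [Bialgebra k C]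
    (s s' : WithConv (C ⊗[k] C →ₗ[k] k)) (h : s * s' = 1) (h' : s' * s = 1) :
    C ⊗[k] C →ₗc[k] C where
  toLinearMap := (twist s s').ofConv
  counit_comp := by
    apply toConv_injective
    rw [twist, comp_eta_mul, eta_self, eta_self, ofConv_toConv]
    have : toConv (Coalgebra.counit ∘ₗ LinearMap.mul' k C) =
        (1 : WithConv (C ⊗[k] C →ₗ[k] k)) := by
      apply ofConv_injective
      exact (Bialgebra.mulCoalgHom k C).counit_comp
    rw [this, mul_one, h]
    rfl
  map_comp_comul := by
    apply toConv_injective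
    rw [map_map_comul, twist, comp_eta_mul, comp_eta_mul, comp_eta_mul]
    have hm := map_map_comul (toConv (Bialgebra.mulCoalgHom k C).toLinearMap)
    rw [ofConv_toConv, (Bialgebra.mulCoalgHom k C).map_comp_comul] at hm
    have e : ∀ a b : WithConv (C ⊗[k] C →ₗ[k] C ⊗[k] C),
        eta (C ⊗[k] C) s * a * eta (C ⊗[k] C) s' * (eta (C ⊗[k] C) s * b * eta (C ⊗[k] C) s') =
        eta (C ⊗[k] C) s * (a * b) * eta (C ⊗[k] C) s' := by
      intro a b
      have : eta (C ⊗[k] C) s' * eta (C ⊗[k] C) s = 1 := by rw [← eta_mul, h', eta_one]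
      calc _ = eta (C ⊗[k] C) s * a * (eta (C ⊗[k] C) s' * eta (C ⊗[k] C) s) *
            (b * eta (C ⊗[k] C) s') := by simp only [mul_assoc]
        _ = _ := by rw [this, mul_one]; simp only [mul_assoc]
    rw [e]
    exact congrArg (fun z => eta (C ⊗[k] C) s * z * eta (C ⊗[k] C) s') hm.symm

/-- The map `x ⊗ y ↦ u(x) ε(y)`. -/
noncomputable def extL {k X Y : Type*} [CommRing k] [AddCommGroup X] [Module k X]
    [AddCommGroup Y] [Module k Y] [Coalgebra k Y] (u : WithConv (X →ₗ[k] k)) :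
    WithConv (X ⊗[k] Y →ₗ[k] k) :=
  toConv (LinearMap.mul' k k ∘ₗ TensorProduct.map u.ofConv Coalgebra.counit)

/-- The map `y ⊗ x ↦ ε(y) u(x)`. -/
noncomputable def extR {k X Y : Type*} [CommRing k] [AddCommGroup X] [Module k X]
    [AddCommGroup Y] [Module k Y] [Coalgebra k Y] (u : WithConv (X →ₗ[k] k)) :
    WithConv (Y ⊗[k] X →ₗ[k] k) :=
  toConv (LinearMap.mul' k k ∘ₗ TensorProduct.map Coalgebra.counit u.ofConv)

theorem map_twist_id {k C : Type*} [CommRing k] [Ring C] [Bialgebra k C]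
    (s s' : WithConv (C ⊗[k] C →ₗ[k] k)) :
    toConv (TensorProduct.map (twist s s').ofConv (LinearMap.id : C →ₗ[k] C)) =
      eta (C ⊗[k] C) (extL s) *
        toConv (TensorProduct.map (LinearMap.mul' k C) (LinearMap.id : C →ₗ[k] C)) *
      eta (C ⊗[k] C) (extL s') := by
  have e : ∀ u : WithConv (C ⊗[k] C →ₗ[k] k), eta (C ⊗[k] C) (extL (Y := C) u) =
      toConv (TensorProduct.map (eta C u).ofConv (1 : WithConv (C →ₗ[k] C)).ofConv) := by
    intro u
    apply ofConv_injective
    ext x y z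
    simp [eta, extL, LinearMap.convOne_def, Algebra.algebraMap_eq_smul_one,
      TensorProduct.smul_tmul', Algebra.TensorProduct.one_def, mul_smul]
    rw [smul_comm]
  have h1 := TensorProduct.map_convMul_map (R := k) (f := eta C s)
    (h := toConv (LinearMap.mul' k C)) (g := (1 : WithConv (C →ₗ[k] C)))
    (k := toConv LinearMap.id)
  have h2 := TensorProduct.map_convMul_map (R := k) (f := eta C s * toConv (LinearMap.mul' k C))
    (h := eta C s') (g := (1 : WithConv (C →ₗ[k] C)) * toConv LinearMap.id)
    (k := (1 : WithConv (C →ₗ[k] C)))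
  rw [e, e]
  dsimp only at h1
  rw [h1, h2, one_mul, mul_one]
  rfl

theorem map_id_twist {k C : Type*} [CommRing k] [Ring C] [Bialgebra k C]
    (s s' : WithConv (C ⊗[k] C →ₗ[k] k)) :
    toConv (TensorProduct.map (LinearMap.id : C →ₗ[k] C) (twist s s').ofConv) =
      eta (C ⊗[k] C) (extR s) *
        toConv (TensorProduct.map (LinearMap.id : C →ₗ[k] C) (LinearMap.mul' k C)) *
      eta (C ⊗[k] C) (extR s') := by
  have e : ∀ u : WithConv (C ⊗[k] C →ₗ[k] k), eta (C ⊗[k] C) (extR (Y := C) u) =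
      toConv (TensorProduct.map (1 : WithConv (C →ₗ[k] C)).ofConv (eta C u).ofConv) := by
    intro u
    apply ofConv_injective
    ext x y z
    simp [eta, extR, LinearMap.convOne_def, Algebra.algebraMap_eq_smul_one,
      TensorProduct.smul_tmul', Algebra.TensorProduct.one_def, mul_smul]
    rw [smul_comm]
  have h1 := TensorProduct.map_convMul_map (R := k) (g := eta C s)
    (k := toConv (LinearMap.mul' k C)) (f := (1 : WithConv (C →ₗ[k] C)))
    (h := toConv LinearMap.id)
  have h2 := TensorProduct.map_convMul_map (R := k) (g := eta C s * toConv (LinearMap.mul' k C))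
    (k := eta C s') (f := (1 : WithConv (C →ₗ[k] C)) * toConv LinearMap.id)
    (h := (1 : WithConv (C →ₗ[k] C)))
  rw [e, e]
  dsimp only at h1
  rw [h1, h2, one_mul, mul_one]
  rfl

theorem comp_map_twist_id {k C B : Type*} [CommRing k] [Ring C] [Bialgebra k C] [Ring B]
    [Algebra k B] (s s' : WithConv (C ⊗[k] C →ₗ[k] k)) (φ : C ⊗[k] C →ₗ[k] B) :
    toConv (φ ∘ₗ TensorProduct.map (twist s s').ofConv (LinearMap.id : C →ₗ[k] C)) =
      eta B (extL s) *
        toConv (φ ∘ₗ TensorProduct.map (LinearMap.mul' k C) (LinearMap.id : C →ₗ[k] C)) *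
      eta B (extL s') := by
  have := comp_eta_mul φ (extL s) (extL s')
    (toConv (TensorProduct.map (LinearMap.mul' k C) (LinearMap.id : C →ₗ[k] C)))
  rw [← map_twist_id] at this
  exact this

theorem comp_map_id_twist {k C B : Type*} [CommRing k] [Ring C] [Bialgebra k C] [Ring B]
    [Algebra k B] (s s' : WithConv (C ⊗[k] C →ₗ[k] k)) (φ : C ⊗[k] C →ₗ[k] B) :
    toConv (φ ∘ₗ TensorProduct.map (LinearMap.id : C →ₗ[k] C) (twist s s').ofConv) =
      eta B (extR s) *
        toConv (φ ∘ₗ TensorProduct.map (LinearMap.id : C →ₗ[k] C) (LinearMap.mul' k C)) *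
      eta B (extR s') := by
  have := comp_eta_mul φ (extR s) (extR s')
    (toConv (TensorProduct.map (LinearMap.id : C →ₗ[k] C) (LinearMap.mul' k C)))
  rw [← map_id_twist] at this
  exact this

theorem extL_mul {k X Y : Type*} [CommRing k] [AddCommGroup X] [Module k X] [Coalgebra k X]
    [AddCommGroup Y] [Module k Y] [Coalgebra k Y] {u v : WithConv (X →ₗ[k] k)} (h : u * v = 1) :
    extL (Y := Y) u * extL v = 1 := by
  have h1 := congrArg toConv (LinearMap.algHom_comp_convMul_distrib
    (Algebra.TensorProduct.lmul' k (S := k))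
    (toConv (TensorProduct.map u.ofConv (1 : WithConv (Y →ₗ[k] k)).ofConv))
    (toConv (TensorProduct.map v.ofConv (1 : WithConv (Y →ₗ[k] k)).ofConv)))
  rw [TensorProduct.map_convMul_map, h, mul_one] at h1
  refine Eq.trans h1.symm ?_
  apply ofConv_injective
  ext x y
  simp [LinearMap.convOne_def, mul_comm]

theorem extR_mul {k X Y : Type*} [CommRing k] [AddCommGroup X] [Module k X] [Coalgebra k X]
    [AddCommGroup Y] [Module k Y] [Coalgebra k Y] {u v : WithConv (X →ₗ[k] k)} (h : u * v = 1) :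
    extR (Y := Y) u * extR v = 1 := by
  have h1 := congrArg toConv (LinearMap.algHom_comp_convMul_distrib
    (Algebra.TensorProduct.lmul' k (S := k))
    (toConv (TensorProduct.map (1 : WithConv (Y →ₗ[k] k)).ofConv u.ofConv))
    (toConv (TensorProduct.map (1 : WithConv (Y →ₗ[k] k)).ofConv v.ofConv)))
  rw [TensorProduct.map_convMul_map, h, mul_one] at h1
  refine Eq.trans h1.symm ?_
  apply ofConv_injective
  ext x y
  simp [LinearMap.convOne_def, mul_comm]

set_option maxHeartbeats 400000 in
/-- Associativity of the product deformed by a two-cocycle. -/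
theorem twist_assoc {k C : Type*} [CommRing k] [Ring C] [Bialgebra k C]
    (s s' : WithConv (C ⊗[k] C →ₗ[k] k)) (h : s * s' = 1) (h' : s' * s = 1)
    (hc : extL s * toConv (s.ofConv ∘ₗ
        TensorProduct.map (LinearMap.mul' k C) (LinearMap.id : C →ₗ[k] C)) =
      toConv ((extR s * toConv (s.ofConv ∘ₗ
        TensorProduct.map (LinearMap.id : C →ₗ[k] C) (LinearMap.mul' k C))).ofConv ∘ₗ
        (TensorProduct.assoc k C C C).toLinearMap))
    (x y z : C) : (twist s s').ofConv ((twist s s').ofConv (x ⊗ₜ y) ⊗ₜ z) =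
      (twist s s').ofConv (x ⊗ₜ (twist s s').ofConv (y ⊗ₜ z)) := by
  set L : (C ⊗[k] C) ⊗[k] C →ₗc[k] C ⊗[k] C :=
    Coalgebra.TensorProduct.map (twistCoalgHom s s' h h') (CoalgHom.id k C) with hL
  set R : C ⊗[k] (C ⊗[k] C) →ₗc[k] C ⊗[k] C :=
    Coalgebra.TensorProduct.map (CoalgHom.id k C) (twistCoalgHom s s' h h') with hR
  set mL : (C ⊗[k] C) ⊗[k] C →ₗc[k] C ⊗[k] C :=
    Coalgebra.TensorProduct.map (Bialgebra.mulCoalgHom k C) (CoalgHom.id k C) with hmL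
  set mR : C ⊗[k] (C ⊗[k] C) →ₗc[k] C ⊗[k] C :=
    Coalgebra.TensorProduct.map (CoalgHom.id k C) (Bialgebra.mulCoalgHom k C) with hmR
  set as : (C ⊗[k] C) ⊗[k] C →ₗc[k] C ⊗[k] (C ⊗[k] C) :=
    (Coalgebra.TensorProduct.assoc k k C C C).toCoalgHom with has
  -- the left bracketing
  have canc : ∀ {X : Type _} [AddCommGroup X] [Module k X] [Coalgebra k X]
      (a a' p p' : WithConv (X →ₗ[k] k)) (m : WithConv (X →ₗ[k] C)), a' * a = 1 →
      eta C (a * p * a') * (eta C a * m * eta C a') * eta C (a * p' * a') =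
        eta C (a * p) * m * eta C (p' * a') := by
    intro X _ _ _ a a' p p' m ha
    have h1 : eta C a' * eta C a = 1 := by rw [← eta_mul, ha, eta_one]
    simp only [eta_mul]
    calc _ = eta C a * eta C p * (eta C a' * eta C a) * m * (eta C a' * eta C a) *
          (eta C p' * eta C a') := by simp only [mul_assoc]
      _ = _ := by rw [h1, mul_one, mul_one]
  have eL : toConv ((twist s s').ofConv ∘ₗ L.toLinearMap) =
      eta C (extL s * toConv (s.ofConv ∘ₗ mL.toLinearMap)) *
        toConv (LinearMap.mul' k C ∘ₗ mL.toLinearMap) *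
        eta C (toConv (s'.ofConv ∘ₗ mL.toLinearMap) * extL s') := by
    have e1 : toConv (s.ofConv ∘ₗ L.toLinearMap) =
        extL s * toConv (s.ofConv ∘ₗ mL.toLinearMap) * extL s' := comp_map_twist_id s s' s.ofConv
    have e2 : toConv (s'.ofConv ∘ₗ L.toLinearMap) =
        extL s * toConv (s'.ofConv ∘ₗ mL.toLinearMap) * extL s' := comp_map_twist_id s s' s'.ofConv
    refine Eq.trans ?_ (canc (extL s) (extL s') (toConv (s.ofConv ∘ₗ mL.toLinearMap))
      (toConv (s'.ofConv ∘ₗ mL.toLinearMap)) (toConv (LinearMap.mul' k C ∘ₗ mL.toLinearMap))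
      (extL_mul h'))
    have e3 : toConv (LinearMap.mul' k C ∘ₗ L.toLinearMap) = eta C (extL s) *
        toConv (LinearMap.mul' k C ∘ₗ mL.toLinearMap) * eta C (extL s') :=
      comp_map_twist_id s s' (LinearMap.mul' k C)
    rw [← e1, ← e2, ← e3, twist, comp_coalgHom_mul, comp_coalgHom_mul]
    rfl
  have eR : toConv ((twist s s').ofConv ∘ₗ R.toLinearMap) =
      eta C (extR s * toConv (s.ofConv ∘ₗ mR.toLinearMap)) *
        toConv (LinearMap.mul' k C ∘ₗ mR.toLinearMap) *
        eta C (toConv (s'.ofConv ∘ₗ mR.toLinearMap) * extR s') := by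
    have e1 : toConv (s.ofConv ∘ₗ R.toLinearMap) =
        extR s * toConv (s.ofConv ∘ₗ mR.toLinearMap) * extR s' := comp_map_id_twist s s' s.ofConv
    have e2 : toConv (s'.ofConv ∘ₗ R.toLinearMap) =
        extR s * toConv (s'.ofConv ∘ₗ mR.toLinearMap) * extR s' := comp_map_id_twist s s' s'.ofConv
    refine Eq.trans ?_ (canc (extR s) (extR s') (toConv (s.ofConv ∘ₗ mR.toLinearMap))
      (toConv (s'.ofConv ∘ₗ mR.toLinearMap)) (toConv (LinearMap.mul' k C ∘ₗ mR.toLinearMap))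
      (extR_mul h'))
    have e3 : toConv (LinearMap.mul' k C ∘ₗ R.toLinearMap) = eta C (extR s) *
        toConv (LinearMap.mul' k C ∘ₗ mR.toLinearMap) * eta C (extR s') :=
      comp_map_id_twist s s' (LinearMap.mul' k C)
    rw [← e1, ← e2, ← e3, twist, comp_coalgHom_mul, comp_coalgHom_mul]
    rfl
  -- the inverse of the cocycle identity
  have invL : (toConv (s'.ofConv ∘ₗ mL.toLinearMap) * extL s') *
      (extL s * toConv (s.ofConv ∘ₗ mL.toLinearMap)) = 1 := by
    have h1 : toConv (s'.ofConv ∘ₗ mL.toLinearMap) * toConv (s.ofConv ∘ₗ mL.toLinearMap) = 1 := by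
      rw [← comp_coalgHom_mul, h', comp_coalgHom_one]
    rw [mul_assoc, ← mul_assoc (extL s'), extL_mul h', one_mul, h1]
  have invR : (extR s * toConv (s.ofConv ∘ₗ mR.toLinearMap)) *
      (toConv (s'.ofConv ∘ₗ mR.toLinearMap) * extR s') = 1 := by
    have h1 : toConv (s.ofConv ∘ₗ mR.toLinearMap) * toConv (s'.ofConv ∘ₗ mR.toLinearMap) = 1 := by
      rw [← comp_coalgHom_mul, h, comp_coalgHom_one]
    rw [mul_assoc, ← mul_assoc (toConv (s.ofConv ∘ₗ mR.toLinearMap)), h1, one_mul, extR_mul h]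
  have hc' : toConv (s'.ofConv ∘ₗ mL.toLinearMap) * extL s' =
      toConv ((toConv (s'.ofConv ∘ₗ mR.toLinearMap) * extR s').ofConv ∘ₗ as.toLinearMap) := by
    refine left_inv_eq_right_inv invL ?_
    have hc2 : extL s * toConv (s.ofConv ∘ₗ mL.toLinearMap) =
      toConv ((extR s * toConv (s.ofConv ∘ₗ mR.toLinearMap)).ofConv ∘ₗ as.toLinearMap) := hc
    rw [hc2, ← comp_coalgHom_mul, invR, comp_coalgHom_one]
  have hm : toConv (LinearMap.mul' k C ∘ₗ mL.toLinearMap) =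
      toConv ((LinearMap.mul' k C ∘ₗ mR.toLinearMap) ∘ₗ as.toLinearMap) := by
    congr 1
    ext a b c
    exact mul_assoc a b c
  have final : toConv ((twist s s').ofConv ∘ₗ L.toLinearMap) =
      toConv (((twist s s').ofConv ∘ₗ R.toLinearMap) ∘ₗ as.toLinearMap) := by
    have eR' := congrArg ofConv eR
    rw [ofConv_toConv] at eR'
    rw [eL, eR', comp_coalgHom_mul, comp_coalgHom_mul, hc', ofConv_toConv, hm]
    have hc2 : extL s * toConv (s.ofConv ∘ₗ mL.toLinearMap) =
      toConv ((extR s * toConv (s.ofConv ∘ₗ mR.toLinearMap)).ofConv ∘ₗ as.toLinearMap) := hc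
    rw [hc2]
    rfl
  exact LinearMap.congr_fun (congrArg ofConv final) ((x ⊗ₜ y) ⊗ₜ z)

end ConvTwist

/-! ### The Drinfeld double -/

namespace DualCop

/-- The left action of `H` on its dual, `(a ⇀ g)(c) = g (c a)`. -/
noncomputable def hitL (k H : Type*) [Field k] [Ring H] [Bialgebra k H] :
    H →ₗ[k] Module.End k (DualCop k H) :=
  LinearMap.mk₂ k (fun a g => (toDual k H).symm (toDual k H g ∘ₗ LinearMap.mulRight k a))
    (fun a b g => DualCop.ext fun c => by simp [mul_add])
    (fun r a g => DualCop.ext fun c => by simp)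
    (fun a g h => DualCop.ext fun c => by simp)
    (fun r a g => DualCop.ext fun c => by simp)

/-- The right action of `H` on its dual, `(g ↼ b)(c) = g (b c)`. -/
noncomputable def hitR (k H : Type*) [Field k] [Ring H] [Bialgebra k H] :
    H →ₗ[k] Module.End k (DualCop k H) :=
  LinearMap.mk₂ k (fun b g => (toDual k H).symm (toDual k H g ∘ₗ LinearMap.mulLeft k b))
    (fun a b g => DualCop.ext fun c => by simp [add_mul])
    (fun r a g => DualCop.ext fun c => by simp)
    (fun a g h => DualCop.ext fun c => by simp)
    (fun r a g => DualCop.ext fun c => by simp)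

theorem hitL_apply {k H : Type*} [Field k] [Ring H] [Bialgebra k H] (a c : H)
    (g : DualCop k H) : toDual k H (hitL k H a g) c = toDual k H g (c * a) := rfl

theorem hitR_apply {k H : Type*} [Field k] [Ring H] [Bialgebra k H] (b c : H)
    (g : DualCop k H) : toDual k H (hitR k H b g) c = toDual k H g (b * c) := rfl

/-- The operator `g ↦ a ⇀ g ↼ S⁻¹(c)`, bilinear in `a` and `c`. -/
noncomputable def act (k H : Type*) [Field k] [Ring H] [HopfAlgebra k H]
    [HasBijectiveAntipode k H] : H →ₗ[k] H →ₗ[k] Module.End k (DualCop k H) :=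
  (LinearMap.mul k (Module.End k (DualCop k H))).flip.compl₁₂ (hitL k H)
    (hitR k H ∘ₗ antipodeInv k)

theorem act_apply {k H : Type*} [Field k] [Ring H] [HopfAlgebra k H]
    [HasBijectiveAntipode k H] (a c d : H) (g : DualCop k H) :
    toDual k H (act k H a c g) d = toDual k H g (antipodeInv k c * d * a) := rfl

end DualCop

/-- The underlying space and coalgebra `(H^*)^cop ⊗ H` of the Drinfeld double of `H`. -/
def DrinfeldDouble (k H : Type*) [Field k] [Ring H] [HopfAlgebra k H] : Type _ :=
  DualCop k H ⊗[k] H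

namespace DrinfeldDouble

open DualCop WithConv ConvTwist

/-- The map `a ⊗ b ⊗ c ↦ (g ↦ (a ⇀ g ↼ S⁻¹(c)) ⊗ b)`. -/
noncomputable def exchangeAux (k H : Type*) [Field k] [Ring H] [HopfAlgebra k H]
    [HasBijectiveAntipode k H] :
    H ⊗[k] (H ⊗[k] H) →ₗ[k] DualCop k H →ₗ[k] DualCop k H ⊗[k] H :=
  TensorProduct.lift ((LinearMap.llcomp k (DualCop k H) (DualCop k H)
      (DualCop k H ⊗[k] H)).compl₁₂ (TensorProduct.mk k (DualCop k H) H).flip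
      (TensorProduct.lift (act k H))) ∘ₗ
    (TensorProduct.leftComm k H H H).toLinearMap

theorem exchangeAux_tmul {k H : Type*} [Field k] [Ring H] [HopfAlgebra k H]
    [HasBijectiveAntipode k H] (a b c : H) (g : DualCop k H) :
    exchangeAux k H (a ⊗ₜ (b ⊗ₜ c)) g = act k H a c g ⊗ₜ b := rfl

/-- The exchange map `h ⊗ g ↦ ∑ (h₁ ⇀ g ↼ S⁻¹(h₃)) ⊗ h₂`. -/
noncomputable def exchange (k H : Type*) [Field k] [Ring H] [HopfAlgebra k H]
    [HasBijectiveAntipode k H] : H ⊗[k] DualCop k H →ₗ[k] DualCop k H ⊗[k] H :=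
  TensorProduct.lift (exchangeAux k H ∘ₗ Coalgebra.comul.lTensor H ∘ₗ Coalgebra.comul)

/-- The product of the Drinfeld double,
`(f ⊗ h)(g ⊗ m) = ∑ f (h₁ ⇀ g ↼ S⁻¹(h₃)) ⊗ h₂ m`. The maps `includeLeft`, `includeRight` and
`mul'` refer to the tensor product algebra. -/
noncomputable def mulMap (k H : Type*) [Field k] [Ring H] [HopfAlgebra k H]
    [HasBijectiveAntipode k H] :
    (DualCop k H ⊗[k] H) ⊗[k] (DualCop k H ⊗[k] H) →ₗ[k] DualCop k H ⊗[k] H :=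
  LinearMap.mul' k (DualCop k H ⊗[k] H) ∘ₗ
    (LinearMap.mul' k (DualCop k H ⊗[k] H)).lTensor (DualCop k H ⊗[k] H) ∘ₗ
    TensorProduct.map
      (Algebra.TensorProduct.includeLeft : DualCop k H →ₐ[k] DualCop k H ⊗[k] H).toLinearMap
      (TensorProduct.map (exchange k H)
        (Algebra.TensorProduct.includeRight : H →ₐ[k] DualCop k H ⊗[k] H).toLinearMap) ∘ₗ
    (TensorProduct.assoc k H (DualCop k H) H).symm.toLinearMap.lTensor (DualCop k H) ∘ₗ
    (TensorProduct.assoc k (DualCop k H) H (DualCop k H ⊗[k] H)).toLinearMap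

theorem mulMap_tmul {k H : Type*} [Field k] [Ring H] [HopfAlgebra k H]
    [HasBijectiveAntipode k H] (f g : DualCop k H) (h m : H) :
    mulMap k H ((f ⊗ₜ h) ⊗ₜ (g ⊗ₜ m)) =
      (f ⊗ₜ 1) * (exchange k H (h ⊗ₜ g) * (1 ⊗ₜ m)) := rfl

/-- Evaluation `h ⊗ g ↦ g(h)`. -/
noncomputable def ev (k H : Type*) [Field k] [Ring H] [HopfAlgebra k H] :
    WithConv (H ⊗[k] DualCop k H →ₗ[k] k) :=
  toConv (TensorProduct.lift (toDual k H).toLinearMap.flip)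

/-- The map `h ⊗ g ↦ g(S⁻¹(h))`. -/
noncomputable def evInv (k H : Type*) [Field k] [Ring H] [HopfAlgebra k H]
    [HasBijectiveAntipode k H] : WithConv (H ⊗[k] DualCop k H →ₗ[k] k) :=
  toConv (TensorProduct.lift ((toDual k H).toLinearMap.flip ∘ₗ antipodeInv k))

theorem ev_tmul {k H : Type*} [Field k] [Ring H] [HopfAlgebra k H] (h : H) (g : DualCop k H) :
    (ev k H).ofConv (h ⊗ₜ g) = toDual k H g h := rfl

theorem evInv_tmul {k H : Type*} [Field k] [Ring H] [HopfAlgebra k H]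
    [HasBijectiveAntipode k H] (h : H) (g : DualCop k H) :
    (evInv k H).ofConv (h ⊗ₜ g) = toDual k H g (antipodeInv k h) := rfl

theorem contract_left {k H : Type*} [Field k] [Ring H] [HopfAlgebra k H] [Module.Finite k H]
    (a : H) (g : DualCop k H) :
    TensorProduct.lid k _ (((toDual k H).toLinearMap.flip a).rTensor _ (Coalgebra.comul g)) =
      hitL k H a g := by
  apply DualCop.ext
  intro d
  have e : ∀ t : DualCop k H ⊗[k] DualCop k H, toDual k H (TensorProduct.lid k _
      (((toDual k H).toLinearMap.flip a).rTensor _ t)) d = pair k H t (a ⊗ₜ d) := by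
    intro t
    induction t with
    | zero => simp
    | add x y hx hy => simp only [map_add, LinearMap.add_apply, hx, hy]
    | tmul f f' => simp [pair_tmul]
  rw [e, pair_comul_tmul, hitL_apply]

theorem contract_right {k H : Type*} [Field k] [Ring H] [HopfAlgebra k H] [Module.Finite k H]
    (a : H) (g : DualCop k H) :
    TensorProduct.rid k _ (((toDual k H).toLinearMap.flip a).lTensor _ (Coalgebra.comul g)) =
      hitR k H a g := by
  apply DualCop.ext
  intro d
  have e : ∀ t : DualCop k H ⊗[k] DualCop k H, toDual k H (TensorProduct.rid k _
      (((toDual k H).toLinearMap.flip a).lTensor _ t)) d = pair k H t (d ⊗ₜ a) := by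
    intro t
    induction t with
    | zero => simp
    | add x y hx hy => simp only [map_add, LinearMap.add_apply, hx, hy]
    | tmul f f' => simp [pair_tmul, mul_comm]
  rw [e, pair_comul_tmul, hitR_apply]

/-- Contraction of `(a ⊗ b) ⊗ Δ(g)` against a functional `h ⊗ g ↦ g(T h)` on the left. -/
theorem contract_left_map {k H B : Type*} [Field k] [Ring H] [HopfAlgebra k H]
    [Module.Finite k H] [AddCommGroup B] [Module k B] (T : H →ₗ[k] H)
    (F : H ⊗[k] DualCop k H →ₗ[k] B) (a b : H) (g : DualCop k H) :
    TensorProduct.lid k B (TensorProduct.map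
      (TensorProduct.lift ((toDual k H).toLinearMap.flip ∘ₗ T)) F
      (TensorProduct.tensorTensorTensorComm k H H (DualCop k H) (DualCop k H)
        ((a ⊗ₜ b) ⊗ₜ Coalgebra.comul g))) = F (b ⊗ₜ hitL k H (T a) g) := by
  rw [← contract_left]
  generalize (Coalgebra.comul g : DualCop k H ⊗[k] DualCop k H) = t
  induction t with
  | zero => simp
  | add x y hx hy => simp only [map_add, TensorProduct.tmul_add, hx, hy]
  | tmul f f' => simp

theorem contract_right_map {k H B : Type*} [Field k] [Ring H] [HopfAlgebra k H]
    [Module.Finite k H] [AddCommGroup B] [Module k B] (T : H →ₗ[k] H)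
    (F : H ⊗[k] DualCop k H →ₗ[k] B) (a b : H) (g : DualCop k H) :
    TensorProduct.rid k B (TensorProduct.map F
      (TensorProduct.lift ((toDual k H).toLinearMap.flip ∘ₗ T))
      (TensorProduct.tensorTensorTensorComm k H H (DualCop k H) (DualCop k H)
        ((a ⊗ₜ b) ⊗ₜ Coalgebra.comul g))) = F (a ⊗ₜ hitR k H (T b) g) := by
  rw [← contract_right]
  generalize (Coalgebra.comul g : DualCop k H ⊗[k] DualCop k H) = t
  induction t with
  | zero => simp
  | add x y hx hy => simp only [map_add, TensorProduct.tmul_add, hx, hy]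
  | tmul f f' => simp

/-- The exchange map as a deformation of the flip. -/
theorem exchange_eq {k H : Type*} [Field k] [Ring H] [HopfAlgebra k H] [Module.Finite k H]
    [HasBijectiveAntipode k H] :
    eta (DualCop k H ⊗[k] H) (ev k H) *
      toConv (TensorProduct.comm k H (DualCop k H)).toLinearMap *
      eta (DualCop k H ⊗[k] H) (evInv k H) = toConv (exchange k H) := by
  apply ofConv_injective
  rw [mul_assoc, eta_mul_apply, mul_eta_apply]
  apply TensorProduct.ext'
  intro h g
  simp only [LinearMap.comp_apply, ofConv_toConv, exchange, TensorProduct.lift.tmul,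
    LinearEquiv.coe_coe, TensorProduct.comul_tmul]
  generalize (Coalgebra.comul h : H ⊗[k] H) = t
  induction t with
  | zero => simp
  | add x y hx hy => simp only [map_add, TensorProduct.add_tmul, LinearMap.add_apply, hx, hy]
  | tmul a b =>
    refine (contract_left_map LinearMap.id _ a b g).trans ?_
    simp only [LinearMap.comp_apply, LinearEquiv.coe_coe, TensorProduct.comul_tmul,
      LinearMap.lTensor_tmul, LinearMap.id_apply]
    generalize (Coalgebra.comul b : H ⊗[k] H) = t
    induction t with
    | zero => simp
    | add x y hx hy => simp only [map_add, TensorProduct.add_tmul, TensorProduct.tmul_add,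
        LinearMap.add_apply, hx, hy]
    | tmul b c =>
      refine (contract_right_map (antipodeInv k) _ b c _).trans ?_
      rfl

theorem ev_mul_evInv {k H : Type*} [Field k] [Ring H] [HopfAlgebra k H] [Module.Finite k H]
    [HasBijectiveAntipode k H] : ev k H * evInv k H = 1 := by
  apply ofConv_injective
  rw [← eta_self (ev k H), eta_mul_apply]
  apply TensorProduct.ext'
  intro h g
  have e : ∀ t : H ⊗[k] H, TensorProduct.lid k k (TensorProduct.map (ev k H).ofConv
      (evInv k H).ofConv (TensorProduct.tensorTensorTensorComm k H H (DualCop k H) (DualCop k H)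
        (t ⊗ₜ Coalgebra.comul g))) = toDual k H g (LinearMap.mul' k H (TensorProduct.comm k H H
          ((antipodeInv k).lTensor H t))) := by
    intro t
    induction t with
    | zero => simp
    | add x y hx hy => simp only [map_add, TensorProduct.add_tmul, hx, hy]
    | tmul a b => exact contract_left_map LinearMap.id _ a b g
  refine (e _).trans ?_
  rw [mul_antipodeInv_right]
  simp [Algebra.algebraMap_eq_smul_one, LinearMap.convOne_def, DualCop.counit_apply, mul_comm]

theorem evInv_mul_ev {k H : Type*} [Field k] [Ring H] [HopfAlgebra k H] [Module.Finite k H]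
    [HasBijectiveAntipode k H] : evInv k H * ev k H = 1 := by
  apply ofConv_injective
  rw [← eta_self (evInv k H), eta_mul_apply]
  apply TensorProduct.ext'
  intro h g
  have e : ∀ t : H ⊗[k] H, TensorProduct.lid k k (TensorProduct.map (evInv k H).ofConv
      (ev k H).ofConv (TensorProduct.tensorTensorTensorComm k H H (DualCop k H) (DualCop k H)
        (t ⊗ₜ Coalgebra.comul g))) = toDual k H g (LinearMap.mul' k H (TensorProduct.comm k H H
          ((antipodeInv k).rTensor H t))) := by
    intro t
    induction t with
    | zero => simp
    | add x y hx hy => simp only [map_add, TensorProduct.add_tmul, hx, hy]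
    | tmul a b => exact contract_left_map (antipodeInv k) _ a b g
  refine (e _).trans ?_
  rw [mul_antipodeInv_left]
  simp [Algebra.algebraMap_eq_smul_one, LinearMap.convOne_def, DualCop.counit_apply, mul_comm]

/-- The coalgebra map `(f ⊗ h) ⊗ (g ⊗ m) ↦ ε(f) ε(m) h ⊗ g`. -/
noncomputable def middle (k H : Type*) [Field k] [Ring H] [HopfAlgebra k H] [Module.Finite k H] :
    (DualCop k H ⊗[k] H) ⊗[k] (DualCop k H ⊗[k] H) →ₗc[k] H ⊗[k] DualCop k H :=
  Coalgebra.TensorProduct.map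
    ((Coalgebra.TensorProduct.lid k H).toCoalgHom.comp
      (Coalgebra.TensorProduct.map (Coalgebra.counitCoalgHom k (DualCop k H)) (CoalgHom.id k H)))
    ((Coalgebra.TensorProduct.rid k k (DualCop k H)).toCoalgHom.comp
      (Coalgebra.TensorProduct.map (CoalgHom.id k (DualCop k H)) (Coalgebra.counitCoalgHom k H)))

theorem middle_tmul {k H : Type*} [Field k] [Ring H] [HopfAlgebra k H] [Module.Finite k H]
    (f g : DualCop k H) (h m : H) : middle k H ((f ⊗ₜ h) ⊗ₜ (g ⊗ₜ m)) =
      (Coalgebra.counit (R := k) f • h) ⊗ₜ (Coalgebra.counit (R := k) m • g) := rfl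

/-- The two-cocycle `(f ⊗ h) ⊗ (g ⊗ m) ↦ ε(f) g(h) ε(m)`. -/
noncomputable def cocycle (k H : Type*) [Field k] [Ring H] [HopfAlgebra k H] [Module.Finite k H] :
    WithConv ((DualCop k H ⊗[k] H) ⊗[k] (DualCop k H ⊗[k] H) →ₗ[k] k) :=
  toConv ((ev k H).ofConv ∘ₗ (middle k H).toLinearMap)

/-- The convolution inverse of the two-cocycle. -/
noncomputable def cocycleInv (k H : Type*) [Field k] [Ring H] [HopfAlgebra k H]
    [Module.Finite k H] [HasBijectiveAntipode k H] :
    WithConv ((DualCop k H ⊗[k] H) ⊗[k] (DualCop k H ⊗[k] H) →ₗ[k] k) :=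
  toConv ((evInv k H).ofConv ∘ₗ (middle k H).toLinearMap)

theorem cocycle_tmul {k H : Type*} [Field k] [Ring H] [HopfAlgebra k H] [Module.Finite k H]
    (f g : DualCop k H) (h m : H) : (cocycle k H).ofConv ((f ⊗ₜ h) ⊗ₜ (g ⊗ₜ m)) =
      Coalgebra.counit (R := k) f * Coalgebra.counit (R := k) m * toDual k H g h := by
  refine (congrArg (ev k H).ofConv (middle_tmul f g h m)).trans ?_
  rw [ev_tmul]
  simp; ring

theorem cocycleInv_tmul {k H : Type*} [Field k] [Ring H] [HopfAlgebra k H] [Module.Finite k H]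
    [HasBijectiveAntipode k H]
    (f g : DualCop k H) (h m : H) : (cocycleInv k H).ofConv ((f ⊗ₜ h) ⊗ₜ (g ⊗ₜ m)) =
      Coalgebra.counit (R := k) f * Coalgebra.counit (R := k) m *
        toDual k H g (antipodeInv k h) := by
  refine (congrArg (evInv k H).ofConv (middle_tmul f g h m)).trans ?_
  rw [evInv_tmul]
  simp; ring

theorem cocycle_mul {k H : Type*} [Field k] [Ring H] [HopfAlgebra k H] [Module.Finite k H]
    [HasBijectiveAntipode k H] : cocycle k H * cocycleInv k H = 1 := by
  rw [cocycle, cocycleInv, ← comp_coalgHom_mul, ev_mul_evInv, comp_coalgHom_one]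

theorem cocycleInv_mul {k H : Type*} [Field k] [Ring H] [HopfAlgebra k H] [Module.Finite k H]
    [HasBijectiveAntipode k H] : cocycleInv k H * cocycle k H = 1 := by
  rw [cocycle, cocycleInv, ← comp_coalgHom_mul, evInv_mul_ev, comp_coalgHom_one]

end DrinfeldDouble

namespace DrinfeldDouble

open DualCop WithConv ConvTwist

/-- The map `h ⊗ g ↦ (f ⊗ h) ⊗ (g ⊗ m)`. -/
noncomputable def slice (k H : Type*) [Field k] [Ring H] [HopfAlgebra k H]
    (f : DualCop k H) (m : H) :
    H ⊗[k] DualCop k H →ₗ[k] (DualCop k H ⊗[k] H) ⊗[k] (DualCop k H ⊗[k] H) :=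
  TensorProduct.map (TensorProduct.mk k (DualCop k H) H f)
    ((TensorProduct.mk k (DualCop k H) H).flip m)

theorem slice_tmul {k H : Type*} [Field k] [Ring H] [HopfAlgebra k H]
    (f g : DualCop k H) (h m : H) : slice k H f m (h ⊗ₜ g) = (f ⊗ₜ h) ⊗ₜ (g ⊗ₜ m) := rfl

theorem slice_add_left {k H : Type*} [Field k] [Ring H] [HopfAlgebra k H]
    (f f' : DualCop k H) (m : H) : slice k H (f + f') m = slice k H f m + slice k H f' m := by
  simp [slice, TensorProduct.map_add_left]

theorem slice_add_right {k H : Type*} [Field k] [Ring H] [HopfAlgebra k H]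
    (f : DualCop k H) (m m' : H) : slice k H f (m + m') = slice k H f m + slice k H f m' := by
  simp [slice, TensorProduct.map_add_right]

theorem slice_zero_left {k H : Type*} [Field k] [Ring H] [HopfAlgebra k H]
    (m : H) : slice k H 0 m = 0 := by
  simp [slice, TensorProduct.map_zero_left]

theorem slice_zero_right {k H : Type*} [Field k] [Ring H] [HopfAlgebra k H]
    (f : DualCop k H) : slice k H f 0 = 0 := by
  simp [slice, TensorProduct.map_zero_right]

theorem slice_smul {k H : Type*} [Field k] [Ring H] [HopfAlgebra k H]
    (r s : k) (f : DualCop k H) (m : H) : slice k H (r • f) (s • m) = (r * s) • slice k H f m := by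
  simp [slice, TensorProduct.map_smul_left, TensorProduct.map_smul_right, mul_smul]
  rw [smul_comm]

theorem ext_slice {k H B : Type*} [Field k] [Ring H] [HopfAlgebra k H] [AddCommGroup B] [Module k B]
    (F G : (DualCop k H ⊗[k] H) ⊗[k] (DualCop k H ⊗[k] H) →ₗ[k] B)
    (h : ∀ f m, F ∘ₗ slice k H f m = G ∘ₗ slice k H f m) : F = G := by
  apply TensorProduct.ext_fourfold'
  intro f a g m
  exact LinearMap.congr_fun (h f m) (a ⊗ₜ g)

/-- Contraction with the counit on the left. -/
noncomputable def cL (k : Type*) {X : Type*} [Field k] [AddCommGroup X] [Module k X]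
    [Coalgebra k X] : X ⊗[k] X →ₗ[k] X :=
  (TensorProduct.lid k X).toLinearMap ∘ₗ Coalgebra.counit.rTensor X

/-- Contraction with the counit on the right. -/
noncomputable def cR (k : Type*) {X : Type*} [Field k] [AddCommGroup X] [Module k X]
    [Coalgebra k X] : X ⊗[k] X →ₗ[k] X :=
  (TensorProduct.rid k X).toLinearMap ∘ₗ Coalgebra.counit.lTensor X

theorem cL_tmul {k X : Type*} [Field k] [AddCommGroup X] [Module k X]
    [Coalgebra k X] (a b : X) : cL k (a ⊗ₜ[k] b) = Coalgebra.counit (R := k) a • b := rfl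

theorem cR_tmul {k X : Type*} [Field k] [AddCommGroup X] [Module k X]
    [Coalgebra k X] (a b : X) : cR k (a ⊗ₜ[k] b) = Coalgebra.counit (R := k) b • a := rfl

theorem cL_comul {k X : Type*} [Field k] [AddCommGroup X] [Module k X]
    [Coalgebra k X] (a : X) : cL k (Coalgebra.comul (R := k) a) = a := by
  simp [cL]

theorem cR_comul {k X : Type*} [Field k] [AddCommGroup X] [Module k X]
    [Coalgebra k X] (a : X) : cR k (Coalgebra.comul (R := k) a) = a := by
  simp [cR]

theorem cocycle_slice_aux {k H B : Type*} [Field k] [Ring H] [HopfAlgebra k H] [Module.Finite k H]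
    [AddCommGroup B] [Module k B]
    (F : (DualCop k H ⊗[k] H) ⊗[k] (DualCop k H ⊗[k] H) →ₗ[k] B)
    (s : (DualCop k H ⊗[k] H) ⊗[k] (DualCop k H ⊗[k] H) →ₗ[k] k) (v : H ⊗[k] DualCop k H →ₗ[k] k)
    (hs : ∀ f h g m, s ((f ⊗ₜ h) ⊗ₜ (g ⊗ₜ m)) =
      Coalgebra.counit (R := k) f * Coalgebra.counit (R := k) m * v (h ⊗ₜ g))
    (tf tg : DualCop k H ⊗[k] DualCop k H) (th tm : H ⊗[k] H) :
    TensorProduct.lid k B (TensorProduct.map s F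
      (TensorProduct.tensorTensorTensorComm k _ _ _ _
        (TensorProduct.tensorTensorTensorComm k _ _ _ _ (tf ⊗ₜ th) ⊗ₜ
          TensorProduct.tensorTensorTensorComm k _ _ _ _ (tg ⊗ₜ tm)))) =
      TensorProduct.lid k B (TensorProduct.map v (F ∘ₗ slice k H (cL k tf) (cL k tm))
        (TensorProduct.tensorTensorTensorComm k _ _ _ _ (th ⊗ₜ tg))) := by
  induction tf with
  | zero => simp [slice_zero_left]
  | add x y hx hy => simp only [TensorProduct.add_tmul, map_add, hx, hy, slice_add_left,
      LinearMap.comp_add, TensorProduct.map_add_right, LinearMap.add_apply]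
  | tmul f f' =>
  induction tm with
  | zero => simp [slice_zero_right]
  | add x y hx hy => simp only [TensorProduct.tmul_add, map_add, hx, hy, slice_add_right,
      LinearMap.comp_add, TensorProduct.map_add_right, LinearMap.add_apply]
  | tmul m m' =>
  induction th with
  | zero => simp
  | add x y hx hy => simp only [TensorProduct.add_tmul, TensorProduct.tmul_add, map_add, hx, hy]
  | tmul h h' =>
  induction tg with
  | zero => simp
  | add x y hx hy => simp only [TensorProduct.add_tmul, TensorProduct.tmul_add, map_add, hx, hy]
  | tmul g g' =>
    simp only [TensorProduct.tensorTensorTensorComm_tmul, TensorProduct.map_tmul,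
      TensorProduct.lid_tmul, hs, cL_tmul, slice_smul, LinearMap.comp_smul, LinearMap.smul_apply,
      LinearMap.comp_apply, slice_tmul, smul_smul]
    congr 1
    ring

theorem cocycle_slice {k H B : Type*} [Field k] [Ring H] [HopfAlgebra k H] [Module.Finite k H]
    [Ring B] [Algebra k B]
    (F : WithConv ((DualCop k H ⊗[k] H) ⊗[k] (DualCop k H ⊗[k] H) →ₗ[k] B))
    (f : DualCop k H) (m : H) :
    (eta B (cocycle k H) * F).ofConv ∘ₗ slice k H f m =
      (eta B (ev k H) * toConv (F.ofConv ∘ₗ slice k H f m)).ofConv := by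
  rw [eta_mul_apply, eta_mul_apply]
  apply TensorProduct.ext'
  intro h g
  have := cocycle_slice_aux F.ofConv (cocycle k H).ofConv (ev k H).ofConv
    (fun f h g m => cocycle_tmul f g h m) (Coalgebra.comul f) (Coalgebra.comul g)
    (Coalgebra.comul h) (Coalgebra.comul m)
  rw [cL_comul, cL_comul] at this
  exact this

theorem slice_cocycle_aux {k H B : Type*} [Field k] [Ring H] [HopfAlgebra k H] [Module.Finite k H]
    [AddCommGroup B] [Module k B]
    (F : (DualCop k H ⊗[k] H) ⊗[k] (DualCop k H ⊗[k] H) →ₗ[k] B)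
    (s : (DualCop k H ⊗[k] H) ⊗[k] (DualCop k H ⊗[k] H) →ₗ[k] k) (v : H ⊗[k] DualCop k H →ₗ[k] k)
    (hs : ∀ f h g m, s ((f ⊗ₜ h) ⊗ₜ (g ⊗ₜ m)) =
      Coalgebra.counit (R := k) f * Coalgebra.counit (R := k) m * v (h ⊗ₜ g))
    (tf tg : DualCop k H ⊗[k] DualCop k H) (th tm : H ⊗[k] H) :
    TensorProduct.rid k B (TensorProduct.map F s
      (TensorProduct.tensorTensorTensorComm k _ _ _ _
        (TensorProduct.tensorTensorTensorComm k _ _ _ _ (tf ⊗ₜ th) ⊗ₜ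
          TensorProduct.tensorTensorTensorComm k _ _ _ _ (tg ⊗ₜ tm)))) =
      TensorProduct.rid k B (TensorProduct.map (F ∘ₗ slice k H (cR k tf) (cR k tm)) v
        (TensorProduct.tensorTensorTensorComm k _ _ _ _ (th ⊗ₜ tg))) := by
  induction tf with
  | zero => simp [slice_zero_left]
  | add x y hx hy => simp only [TensorProduct.add_tmul, map_add, hx, hy, slice_add_left,
      LinearMap.comp_add, TensorProduct.map_add_left, LinearMap.add_apply]
  | tmul f f' =>
  induction tm with
  | zero => simp [slice_zero_right]
  | add x y hx hy => simp only [TensorProduct.tmul_add, map_add, hx, hy, slice_add_right,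
      LinearMap.comp_add, TensorProduct.map_add_left, LinearMap.add_apply]
  | tmul m m' =>
  induction th with
  | zero => simp
  | add x y hx hy => simp only [TensorProduct.add_tmul, TensorProduct.tmul_add, map_add, hx, hy]
  | tmul h h' =>
  induction tg with
  | zero => simp
  | add x y hx hy => simp only [TensorProduct.add_tmul, TensorProduct.tmul_add, map_add, hx, hy]
  | tmul g g' =>
    simp only [TensorProduct.tensorTensorTensorComm_tmul, TensorProduct.map_tmul,
      TensorProduct.rid_tmul, hs, cR_tmul, slice_smul, LinearMap.comp_smul, LinearMap.smul_apply,
      LinearMap.comp_apply, slice_tmul, smul_smul]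
    congr 1
    ring

theorem slice_cocycle {k H B : Type*} [Field k] [Ring H] [HopfAlgebra k H] [Module.Finite k H]
    [HasBijectiveAntipode k H] [Ring B] [Algebra k B]
    (F : WithConv ((DualCop k H ⊗[k] H) ⊗[k] (DualCop k H ⊗[k] H) →ₗ[k] B))
    (f : DualCop k H) (m : H) :
    (F * eta B (cocycleInv k H)).ofConv ∘ₗ slice k H f m =
      (toConv (F.ofConv ∘ₗ slice k H f m) * eta B (evInv k H)).ofConv := by
  rw [mul_eta_apply, mul_eta_apply]
  apply TensorProduct.ext'
  intro h g
  have := slice_cocycle_aux F.ofConv (cocycleInv k H).ofConv (evInv k H).ofConv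
    (fun f h g m => cocycleInv_tmul f g h m) (Coalgebra.comul f) (Coalgebra.comul g)
    (Coalgebra.comul h) (Coalgebra.comul m)
  rw [cR_comul, cR_comul] at this
  exact this

/-- The product of the Drinfeld double is a deformation of that of the tensor product. -/
theorem twist_eq_mulMap {k H : Type*} [Field k] [Ring H] [HopfAlgebra k H] [Module.Finite k H]
    [HasBijectiveAntipode k H] :
    (twist (cocycle k H) (cocycleInv k H)).ofConv = mulMap k H := by
  have key : ∀ (f : DualCop k H) (m : H),
      (twist (cocycle k H) (cocycleInv k H)).ofConv ∘ₗ slice k H f m =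
        mulMap k H ∘ₗ slice k H f m := by
    intro f m
    rw [twist, slice_cocycle, cocycle_slice]
    set φ : DualCop k H ⊗[k] H →ₗ[k] DualCop k H ⊗[k] H :=
      LinearMap.mulLeft k (f ⊗ₜ 1) ∘ₗ LinearMap.mulRight k (1 ⊗ₜ m) with hφ
    have h1 : LinearMap.mul' k (DualCop k H ⊗[k] H) ∘ₗ slice k H f m =
        φ ∘ₗ (TensorProduct.comm k H (DualCop k H)).toLinearMap := by
      apply TensorProduct.ext'
      intro h g
      simp [slice_tmul, hφ]
    have h2 := comp_eta_mul φ (ev k H) (evInv k H)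
      (toConv (TensorProduct.comm k H (DualCop k H)).toLinearMap)
    rw [exchange_eq] at h2
    rw [ofConv_toConv, toConv_ofConv, h1]
    refine (congrArg ofConv h2).symm.trans ?_
    apply TensorProduct.ext'
    intro h g
    simp [slice_tmul, hφ, mulMap_tmul]
  exact ext_slice _ _ key

/-- Additivity in each of six variables. -/
structure SixAdd {A B k : Type*} [Add A] [Add B] [Add k] (Ψ : A → B → A → B → A → B → k) :
    Prop where
  h₁ : ∀ a a' b c d e f, Ψ (a + a') b c d e f = Ψ a b c d e f + Ψ a' b c d e f
  h₂ : ∀ a b b' c d e f, Ψ a (b + b') c d e f = Ψ a b c d e f + Ψ a b' c d e f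
  h₃ : ∀ a b c c' d e f, Ψ a b (c + c') d e f = Ψ a b c d e f + Ψ a b c' d e f
  h₄ : ∀ a b c d d' e f, Ψ a b c (d + d') e f = Ψ a b c d e f + Ψ a b c d' e f
  h₅ : ∀ a b c d e e' f, Ψ a b c d (e + e') f = Ψ a b c d e f + Ψ a b c d e' f
  h₆ : ∀ a b c d e f f', Ψ a b c d e (f + f') = Ψ a b c d e f + Ψ a b c d e f'

theorem ext_six {k K H : Type*} [Field k] [AddCommGroup K] [Module k K] [AddCommGroup H]
    [Module k H] (Φ : ((K ⊗[k] K) ⊗[k] (H ⊗[k] H)) ⊗[k] ((K ⊗[k] K) ⊗[k] (H ⊗[k] H)) ⊗[k]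
      ((K ⊗[k] K) ⊗[k] (H ⊗[k] H)) →ₗ[k] k)
    (Ψ : K ⊗[k] K → H ⊗[k] H → K ⊗[k] K → H ⊗[k] H → K ⊗[k] K → H ⊗[k] H → k)
    (hΨ : SixAdd Ψ)
    (h : ∀ a a' b b' c c' d d' e e' f f',
      Φ ((((a ⊗ₜ a') ⊗ₜ (b ⊗ₜ b')) ⊗ₜ ((c ⊗ₜ c') ⊗ₜ (d ⊗ₜ d'))) ⊗ₜ
        ((e ⊗ₜ e') ⊗ₜ (f ⊗ₜ f'))) =
        Ψ (a ⊗ₜ a') (b ⊗ₜ b') (c ⊗ₜ c') (d ⊗ₜ d') (e ⊗ₜ e') (f ⊗ₜ f'))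
    (a : K ⊗[k] K) (b : H ⊗[k] H) (c : K ⊗[k] K) (d : H ⊗[k] H) (e : K ⊗[k] K)
    (f : H ⊗[k] H) :
    Φ (((a ⊗ₜ b) ⊗ₜ (c ⊗ₜ d)) ⊗ₜ (e ⊗ₜ f)) = Ψ a b c d e f := by
  obtain ⟨h₁, h₂, h₃, h₄, h₅, h₆⟩ := hΨ
  have z₁ : ∀ b c d e f, Ψ 0 b c d e f = 0 := fun b c d e f => by simpa using h₁ 0 0 b c d e f
  have z₂ : ∀ a c d e f, Ψ a 0 c d e f = 0 := fun a c d e f => by simpa using h₂ a 0 0 c d e f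
  have z₃ : ∀ a b d e f, Ψ a b 0 d e f = 0 := fun a b d e f => by simpa using h₃ a b 0 0 d e f
  have z₄ : ∀ a b c e f, Ψ a b c 0 e f = 0 := fun a b c e f => by simpa using h₄ a b c 0 0 e f
  have z₅ : ∀ a b c d f, Ψ a b c d 0 f = 0 := fun a b c d f => by simpa using h₅ a b c d 0 0 f
  have z₆ : ∀ a b c d e, Ψ a b c d e 0 = 0 := fun a b c d e => by simpa using h₆ a b c d e 0 0
  induction a with
  | zero => simp only [TensorProduct.zero_tmul, map_zero, z₁]
  | add x y hx hy => simp only [TensorProduct.add_tmul, map_add, hx, hy, h₁]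
  | tmul a a' =>
  induction b with
  | zero => simp only [TensorProduct.zero_tmul, TensorProduct.tmul_zero, map_zero, z₂]
  | add x y hx hy => simp only [TensorProduct.add_tmul, TensorProduct.tmul_add, map_add, hx, hy,
      h₂]
  | tmul b b' =>
  induction c with
  | zero => simp only [TensorProduct.zero_tmul, TensorProduct.tmul_zero, map_zero, z₃]
  | add x y hx hy => simp only [TensorProduct.add_tmul, TensorProduct.tmul_add, map_add, hx, hy,
      h₃]
  | tmul c c' =>
  induction d with
  | zero => simp only [TensorProduct.zero_tmul, TensorProduct.tmul_zero, map_zero, z₄]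
  | add x y hx hy => simp only [TensorProduct.add_tmul, TensorProduct.tmul_add, map_add, hx, hy,
      h₄]
  | tmul d d' =>
  induction e with
  | zero => simp only [TensorProduct.zero_tmul, TensorProduct.tmul_zero, map_zero, z₅]
  | add x y hx hy => simp only [TensorProduct.add_tmul, TensorProduct.tmul_add, map_add, hx, hy,
      h₅]
  | tmul e e' =>
  induction f with
  | zero => simp only [TensorProduct.tmul_zero, map_zero, z₆]
  | add x y hx hy => simp only [TensorProduct.tmul_add, map_add, hx, hy, h₆]
  | tmul f f' => exact h a a' b b' c c' d d' e e' f f'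

theorem ext_three {k K H : Type*} [Field k] [AddCommGroup K] [Module k K] [AddCommGroup H]
    [Module k H] (L : ((K ⊗[k] H) ⊗[k] (K ⊗[k] H)) ⊗[k] (K ⊗[k] H) →ₗ[k] k)
    (R : (K ⊗[k] H) ⊗[k] ((K ⊗[k] H) ⊗[k] (K ⊗[k] H)) →ₗ[k] k)
    (h : ∀ f h g m p r, L (((f ⊗ₜ h) ⊗ₜ (g ⊗ₜ m)) ⊗ₜ (p ⊗ₜ r)) =
      R ((f ⊗ₜ h) ⊗ₜ ((g ⊗ₜ m) ⊗ₜ (p ⊗ₜ r)))) :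
    L = R ∘ₗ (TensorProduct.assoc k (K ⊗[k] H) (K ⊗[k] H) (K ⊗[k] H)).toLinearMap := by
  apply TensorProduct.ext
  apply TensorProduct.ext_fourfold'
  intro a b c d
  apply TensorProduct.ext'
  intro p r
  exact h a b c d p r

/-- Reordering of the tensor factors. -/
noncomputable def reorderL (k K H : Type*) [Field k] [AddCommGroup K] [Module k K]
    [AddCommGroup H] [Module k H] :
    ((K ⊗[k] K) ⊗[k] (H ⊗[k] H)) ⊗[k] ((K ⊗[k] K) ⊗[k] (H ⊗[k] H)) ⊗[k]
      ((K ⊗[k] K) ⊗[k] (H ⊗[k] H)) →ₗ[k]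
    (((K ⊗[k] H) ⊗[k] (K ⊗[k] H)) ⊗[k] (K ⊗[k] H)) ⊗[k]
      (((K ⊗[k] H) ⊗[k] (K ⊗[k] H)) ⊗[k] (K ⊗[k] H)) :=
  (TensorProduct.tensorTensorTensorComm k _ _ _ _).toLinearMap ∘ₗ
    TensorProduct.map ((TensorProduct.tensorTensorTensorComm k _ _ _ _).toLinearMap ∘ₗ
      TensorProduct.map (TensorProduct.tensorTensorTensorComm k _ _ _ _).toLinearMap
        (TensorProduct.tensorTensorTensorComm k _ _ _ _).toLinearMap)
      (TensorProduct.tensorTensorTensorComm k _ _ _ _).toLinearMap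

/-- Reordering of the tensor factors. -/
noncomputable def reorderR (k K H : Type*) [Field k] [AddCommGroup K] [Module k K]
    [AddCommGroup H] [Module k H] :
    ((K ⊗[k] K) ⊗[k] (H ⊗[k] H)) ⊗[k] ((K ⊗[k] K) ⊗[k] (H ⊗[k] H)) ⊗[k]
      ((K ⊗[k] K) ⊗[k] (H ⊗[k] H)) →ₗ[k]
    ((K ⊗[k] H) ⊗[k] ((K ⊗[k] H) ⊗[k] (K ⊗[k] H))) ⊗[k]
      ((K ⊗[k] H) ⊗[k] ((K ⊗[k] H) ⊗[k] (K ⊗[k] H))) :=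
  (TensorProduct.tensorTensorTensorComm k _ _ _ _).toLinearMap ∘ₗ
    TensorProduct.map (TensorProduct.tensorTensorTensorComm k _ _ _ _).toLinearMap
      ((TensorProduct.tensorTensorTensorComm k _ _ _ _).toLinearMap ∘ₗ
      TensorProduct.map (TensorProduct.tensorTensorTensorComm k _ _ _ _).toLinearMap
        (TensorProduct.tensorTensorTensorComm k _ _ _ _).toLinearMap) ∘ₗ
    (TensorProduct.assoc k _ _ _).toLinearMap

theorem comul_reorderL {k K H : Type*} [Field k] [AddCommGroup K] [Module k K] [Coalgebra k K]
    [AddCommGroup H] [Module k H] [Coalgebra k H] (f g p : K) (h m r : H) :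
    Coalgebra.comul (R := k) (((f ⊗ₜ[k] h) ⊗ₜ[k] (g ⊗ₜ[k] m)) ⊗ₜ[k] (p ⊗ₜ[k] r)) =
      reorderL k K H (((Coalgebra.comul f ⊗ₜ Coalgebra.comul h) ⊗ₜ
        (Coalgebra.comul g ⊗ₜ Coalgebra.comul m)) ⊗ₜ (Coalgebra.comul p ⊗ₜ Coalgebra.comul r)) := by
  simp only [TensorProduct.comul_tmul, reorderL, LinearMap.comp_apply, TensorProduct.map_tmul,
    LinearEquiv.coe_coe, TensorProduct.AlgebraTensorModule.tensorTensorTensorComm_eq]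

theorem comul_reorderR {k K H : Type*} [Field k] [AddCommGroup K] [Module k K] [Coalgebra k K]
    [AddCommGroup H] [Module k H] [Coalgebra k H] (f g p : K) (h m r : H) :
    Coalgebra.comul (R := k) ((f ⊗ₜ[k] h) ⊗ₜ[k] ((g ⊗ₜ[k] m) ⊗ₜ[k] (p ⊗ₜ[k] r))) =
      reorderR k K H (((Coalgebra.comul f ⊗ₜ Coalgebra.comul h) ⊗ₜ
        (Coalgebra.comul g ⊗ₜ Coalgebra.comul m)) ⊗ₜ (Coalgebra.comul p ⊗ₜ Coalgebra.comul r)) := by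
  simp only [TensorProduct.comul_tmul, reorderR, LinearMap.comp_apply, TensorProduct.map_tmul,
    LinearEquiv.coe_coe, TensorProduct.assoc_tmul,
    TensorProduct.AlgebraTensorModule.tensorTensorTensorComm_eq]

/-- The left side of the cocycle identity. -/
noncomputable def cocycleL (k H : Type*) [Field k] [Ring H] [HopfAlgebra k H]
    [Module.Finite k H] : WithConv (((DualCop k H ⊗[k] H) ⊗[k] (DualCop k H ⊗[k] H)) ⊗[k]
      (DualCop k H ⊗[k] H) →ₗ[k] k) :=
  toConv ((cocycle k H).ofConv ∘ₗ TensorProduct.map (LinearMap.mul' k (DualCop k H ⊗[k] H))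
        (LinearMap.id : DualCop k H ⊗[k] H →ₗ[k] DualCop k H ⊗[k] H))

theorem cocycleL_tmul {k H : Type*} [Field k] [Ring H] [HopfAlgebra k H]
    [Module.Finite k H] (f g p : DualCop k H) (h m r : H) :
    (cocycleL k H).ofConv (((f ⊗ₜ h) ⊗ₜ (g ⊗ₜ m)) ⊗ₜ (p ⊗ₜ r)) =
    Coalgebra.counit (R := k) f * Coalgebra.counit (R := k) g * Coalgebra.counit (R := k) r *
      toDual k H p (h * m) := by
  simp only [cocycleL, ofConv_toConv, LinearMap.comp_apply, TensorProduct.map_tmul,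
    LinearMap.mul'_apply, Algebra.TensorProduct.tmul_mul_tmul, LinearMap.id_apply, cocycle_tmul,
    Bialgebra.counit_mul]

theorem extL_cocycle_tmul {k H : Type*} [Field k] [Ring H] [HopfAlgebra k H]
    [Module.Finite k H] (f g p : DualCop k H) (h m r : H) :
    (extL (Y := DualCop k H ⊗[k] H) (cocycle k H)).ofConv
      (((f ⊗ₜ h) ⊗ₜ (g ⊗ₜ m)) ⊗ₜ (p ⊗ₜ r)) =
    Coalgebra.counit (R := k) f * Coalgebra.counit (R := k) m * toDual k H g h *
      (Coalgebra.counit (R := k) p * Coalgebra.counit (R := k) r) := by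
  rw [← cocycle_tmul, mul_comm (Coalgebra.counit (R := k) p)]
  rfl

/-- The right side of the cocycle identity. -/
noncomputable def cocycleR (k H : Type*) [Field k] [Ring H] [HopfAlgebra k H]
    [Module.Finite k H] : WithConv ((DualCop k H ⊗[k] H) ⊗[k] ((DualCop k H ⊗[k] H) ⊗[k]
      (DualCop k H ⊗[k] H)) →ₗ[k] k) :=
  toConv ((cocycle k H).ofConv ∘ₗ TensorProduct.map
        (LinearMap.id : DualCop k H ⊗[k] H →ₗ[k] DualCop k H ⊗[k] H)
        (LinearMap.mul' k (DualCop k H ⊗[k] H)))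

theorem cocycleR_tmul {k H : Type*} [Field k] [Ring H] [HopfAlgebra k H]
    [Module.Finite k H] (f g p : DualCop k H) (h m r : H) :
    (cocycleR k H).ofConv ((f ⊗ₜ h) ⊗ₜ ((g ⊗ₜ m) ⊗ₜ (p ⊗ₜ r))) =
    Coalgebra.counit (R := k) f * (Coalgebra.counit (R := k) m * Coalgebra.counit (R := k) r) *
      toDual k H (g * p) h := by
  simp only [cocycleR, ofConv_toConv, LinearMap.comp_apply, TensorProduct.map_tmul,
    LinearMap.mul'_apply, Algebra.TensorProduct.tmul_mul_tmul, LinearMap.id_apply, cocycle_tmul,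
    Bialgebra.counit_mul]

theorem extR_cocycle_tmul {k H : Type*} [Field k] [Ring H] [HopfAlgebra k H]
    [Module.Finite k H] (f g p : DualCop k H) (h m r : H) :
    (extR (Y := DualCop k H ⊗[k] H) (cocycle k H)).ofConv
      ((f ⊗ₜ h) ⊗ₜ ((g ⊗ₜ m) ⊗ₜ (p ⊗ₜ r))) =
    (Coalgebra.counit (R := k) h * Coalgebra.counit (R := k) f) *
      (Coalgebra.counit (R := k) g * Coalgebra.counit (R := k) r * toDual k H p m) := by
  rw [← cocycle_tmul]
  rfl

theorem convMul_left {k K H : Type*} [Field k] [AddCommGroup K] [Module k K] [Coalgebra k K]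
    [AddCommGroup H] [Module k H] [Coalgebra k H]
    (u v : WithConv (((K ⊗[k] H) ⊗[k] (K ⊗[k] H)) ⊗[k] (K ⊗[k] H) →ₗ[k] k))
    (Ψ : K ⊗[k] K → H ⊗[k] H → K ⊗[k] K → H ⊗[k] H → K ⊗[k] K → H ⊗[k] H → k)
    (hΨ : SixAdd Ψ)
    (h : ∀ f f' h h' g g' m m' p p' r r',
      u.ofConv (((f ⊗ₜ h) ⊗ₜ (g ⊗ₜ m)) ⊗ₜ (p ⊗ₜ r)) *
        v.ofConv (((f' ⊗ₜ h') ⊗ₜ (g' ⊗ₜ m')) ⊗ₜ (p' ⊗ₜ r')) =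
        Ψ (f ⊗ₜ f') (h ⊗ₜ h') (g ⊗ₜ g') (m ⊗ₜ m') (p ⊗ₜ p') (r ⊗ₜ r'))
    (f g p : K) (h₀ m r : H) :
    (u * v).ofConv (((f ⊗ₜ h₀) ⊗ₜ (g ⊗ₜ m)) ⊗ₜ (p ⊗ₜ r)) =
      Ψ (Coalgebra.comul f) (Coalgebra.comul h₀) (Coalgebra.comul g) (Coalgebra.comul m)
        (Coalgebra.comul p) (Coalgebra.comul r) := by
  rw [LinearMap.convMul_apply, comul_reorderL]
  exact ext_six (LinearMap.mul' k k ∘ₗ TensorProduct.map u.ofConv v.ofConv ∘ₗ reorderL k K H)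
    Ψ hΨ h _ _ _ _ _ _

theorem convMul_right {k K H : Type*} [Field k] [AddCommGroup K] [Module k K] [Coalgebra k K]
    [AddCommGroup H] [Module k H] [Coalgebra k H]
    (u v : WithConv ((K ⊗[k] H) ⊗[k] ((K ⊗[k] H) ⊗[k] (K ⊗[k] H)) →ₗ[k] k))
    (Ψ : K ⊗[k] K → H ⊗[k] H → K ⊗[k] K → H ⊗[k] H → K ⊗[k] K → H ⊗[k] H → k)
    (hΨ : SixAdd Ψ)
    (h : ∀ f f' h h' g g' m m' p p' r r',
      u.ofConv ((f ⊗ₜ h) ⊗ₜ ((g ⊗ₜ m) ⊗ₜ (p ⊗ₜ r))) *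
        v.ofConv ((f' ⊗ₜ h') ⊗ₜ ((g' ⊗ₜ m') ⊗ₜ (p' ⊗ₜ r'))) =
        Ψ (f ⊗ₜ f') (h ⊗ₜ h') (g ⊗ₜ g') (m ⊗ₜ m') (p ⊗ₜ p') (r ⊗ₜ r'))
    (f g p : K) (h₀ m r : H) :
    (u * v).ofConv ((f ⊗ₜ h₀) ⊗ₜ ((g ⊗ₜ m) ⊗ₜ (p ⊗ₜ r))) =
      Ψ (Coalgebra.comul f) (Coalgebra.comul h₀) (Coalgebra.comul g) (Coalgebra.comul m)
        (Coalgebra.comul p) (Coalgebra.comul r) := by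
  rw [LinearMap.convMul_apply, comul_reorderR]
  exact ext_six (LinearMap.mul' k k ∘ₗ TensorProduct.map u.ofConv v.ofConv ∘ₗ reorderR k K H)
    Ψ hΨ h _ _ _ _ _ _

theorem conv_three {k K H : Type*} [Field k] [AddCommGroup K] [Module k K] [Coalgebra k K]
    [AddCommGroup H] [Module k H] [Coalgebra k H]
    (u v : WithConv (((K ⊗[k] H) ⊗[k] (K ⊗[k] H)) ⊗[k] (K ⊗[k] H) →ₗ[k] k))
    (u' v' : WithConv ((K ⊗[k] H) ⊗[k] ((K ⊗[k] H) ⊗[k] (K ⊗[k] H)) →ₗ[k] k))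
    (Ψ Ψ' : K ⊗[k] K → H ⊗[k] H → K ⊗[k] K → H ⊗[k] H → K ⊗[k] K → H ⊗[k] H → k)
    (hΨ : SixAdd Ψ) (hΨ' : SixAdd Ψ')
    (h : ∀ f f' h h' g g' m m' p p' r r',
      u.ofConv (((f ⊗ₜ h) ⊗ₜ (g ⊗ₜ m)) ⊗ₜ (p ⊗ₜ r)) *
        v.ofConv (((f' ⊗ₜ h') ⊗ₜ (g' ⊗ₜ m')) ⊗ₜ (p' ⊗ₜ r')) =
        Ψ (f ⊗ₜ f') (h ⊗ₜ h') (g ⊗ₜ g') (m ⊗ₜ m') (p ⊗ₜ p') (r ⊗ₜ r'))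
    (h' : ∀ f f' h h' g g' m m' p p' r r',
      u'.ofConv ((f ⊗ₜ h) ⊗ₜ ((g ⊗ₜ m) ⊗ₜ (p ⊗ₜ r))) *
        v'.ofConv ((f' ⊗ₜ h') ⊗ₜ ((g' ⊗ₜ m') ⊗ₜ (p' ⊗ₜ r'))) =
        Ψ' (f ⊗ₜ f') (h ⊗ₜ h') (g ⊗ₜ g') (m ⊗ₜ m') (p ⊗ₜ p') (r ⊗ₜ r'))
    (e : ∀ (f : K) (h : H) (g : K) (m : H) (p : K) (r : H),
      Ψ (Coalgebra.comul f) (Coalgebra.comul h) (Coalgebra.comul g) (Coalgebra.comul m)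
        (Coalgebra.comul p) (Coalgebra.comul r) =
      Ψ' (Coalgebra.comul f) (Coalgebra.comul h) (Coalgebra.comul g) (Coalgebra.comul m)
        (Coalgebra.comul p) (Coalgebra.comul r)) :
    u * v = toConv ((u' * v').ofConv ∘ₗ
        (TensorProduct.assoc k (K ⊗[k] H) (K ⊗[k] H) (K ⊗[k] H)).toLinearMap) := by
  apply ofConv_injective
  apply ext_three
  intro f h₀ g m p r
  exact (convMul_left u v Ψ hΨ h f g p h₀ m r).trans
    ((e f h₀ g m p r).trans (convMul_right u' v' Ψ' hΨ' h' f g p h₀ m r).symm)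

theorem cocycle_identity {k H : Type*} [Field k] [Ring H] [HopfAlgebra k H] [Module.Finite k H] :
    extL (cocycle k H) * cocycleL k H =
      toConv ((extR (cocycle k H) * cocycleR k H).ofConv ∘ₗ
        (TensorProduct.assoc k (DualCop k H ⊗[k] H) (DualCop k H ⊗[k] H)
          (DualCop k H ⊗[k] H)).toLinearMap) := by
  have mr : ∀ a b : H, LinearMap.mulRight k (a + b) =
      LinearMap.mulRight k a + LinearMap.mulRight k b := fun a b => by ext; simp [mul_add]
  refine conv_three _ _ _ _ (fun tf th tg tm tp tr =>
    Coalgebra.counit (R := k) (cL k tf) * Coalgebra.counit (R := k) (cL k tr) *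
      LinearMap.mul' k k (TensorProduct.map (toDual k H (cR k tg))
        (toDual k H (cL k tp) ∘ₗ LinearMap.mulRight k (cL k tm)) th))
    (fun tf th tg tm tp tr =>
    Coalgebra.counit (R := k) (cL k tf) * Coalgebra.counit (R := k) (cL k tr) *
      toDual k H (cL k tg * TensorProduct.lid k _
        (((toDual k H).toLinearMap.flip (cR k tm)).rTensor _ tp)) (cL k th)) ?_ ?_ ?_ ?_ ?_
  · constructor
    · intros; simp only [map_add]; ring
    · intros; simp only [map_add]; ring
    · intros; simp only [map_add, TensorProduct.map_add_left, LinearMap.add_apply]; ring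
    · intros; simp only [map_add, mr, LinearMap.comp_add, TensorProduct.map_add_right,
        LinearMap.add_apply]; ring
    · intros; simp only [map_add, LinearMap.add_comp, TensorProduct.map_add_right,
        LinearMap.add_apply]; ring
    · intros; simp only [map_add]; ring
  · constructor
    · intros; simp only [map_add]; ring
    · intros; simp only [map_add]; ring
    · intros; simp only [map_add, add_mul, LinearMap.add_apply]; ring
    · intros; simp only [map_add, LinearMap.rTensor_add, mul_add, LinearMap.add_apply]
    · intros; simp only [map_add, mul_add, LinearMap.add_apply]
    · intros; simp only [map_add]; ring
  · intro f f' h h' g g' m m' p p' r r'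
    rw [extL_cocycle_tmul f g p h m r, cocycleL_tmul f' g' p' h' m' r']
    simp only [cL_tmul, cR_tmul, map_smul, smul_eq_mul, TensorProduct.map_tmul,
      LinearMap.mul'_apply, LinearMap.smul_apply, LinearMap.comp_apply, LinearMap.mulRight_apply,
      mul_smul_comm]
    ring
  · intro f f' h h' g g' m m' p p' r r'
    rw [extR_cocycle_tmul f g p h m r, cocycleR_tmul f' g' p' h' m' r']
    simp only [cL_tmul, cR_tmul, map_smul, smul_eq_mul, LinearMap.rTensor_tmul,
      TensorProduct.lid_tmul, LinearMap.smul_apply, LinearMap.flip_apply, LinearEquiv.coe_coe,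
      mul_smul_comm, smul_mul_assoc, LinearMap.rTensor_smul]
    ring
  · intro f h g m p r
    simp only [cL_comul, cR_comul]
    rw [contract_left, DualCop.toDual_mul]
    rfl

end DrinfeldDouble

namespace DrinfeldDouble

open DualCop WithConv ConvTwist

theorem counit_antipodeInv {k H : Type*} [Field k] [Ring H] [HopfAlgebra k H]
    [HasBijectiveAntipode k H] (h : H) :
    Coalgebra.counit (R := k) (antipodeInv k h) = Coalgebra.counit h := by
  conv_rhs => rw [← antipode_antipodeInv (k := k) h]
  rw [HopfAlgebra.counit_antipode]

theorem exchange_one_left {k H : Type*} [Field k] [Ring H] [HopfAlgebra k H]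
    [HasBijectiveAntipode k H] (g : DualCop k H) :
    exchange k H (1 ⊗ₜ g) = g ⊗ₜ 1 := by
  have h1 : act k H 1 1 g = g := by
    apply DualCop.ext
    intro d
    rw [act_apply, antipodeInv_one, one_mul, mul_one]
  simp only [exchange, TensorProduct.lift.tmul, LinearMap.comp_apply, Bialgebra.comul_one,
    Algebra.TensorProduct.one_def, LinearMap.lTensor_tmul]
  rw [exchangeAux_tmul, h1]

theorem exchange_one_right {k H : Type*} [Field k] [Ring H] [HopfAlgebra k H]
    [HasBijectiveAntipode k H] (h : H) :
    exchange k H (h ⊗ₜ 1) = 1 ⊗ₜ h := by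
  have h1 : ∀ a c : H, act k H a c 1 =
      (Coalgebra.counit (R := k) a * Coalgebra.counit (R := k) c) • (1 : DualCop k H) := by
    intro a c
    apply DualCop.ext
    intro d
    rw [act_apply, map_smul, LinearMap.smul_apply, DualCop.toDual_one, Bialgebra.counit_mul,
      Bialgebra.counit_mul, counit_antipodeInv, smul_eq_mul]
    ring
  have e : ∀ t : H ⊗[k] H, exchangeAux k H (Coalgebra.comul.lTensor H t) 1 =
      1 ⊗ₜ (TensorProduct.lid k H (Coalgebra.counit.rTensor H t)) := by
    intro t
    induction t with
    | zero => simp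
    | add x y hx hy => simp only [map_add, LinearMap.add_apply, TensorProduct.tmul_add, hx, hy]
    | tmul a b =>
      have e2 : ∀ t : H ⊗[k] H, exchangeAux k H (a ⊗ₜ t) 1 =
          Coalgebra.counit (R := k) a •
            (1 ⊗ₜ (TensorProduct.rid k H (Coalgebra.counit.lTensor H t))) := by
        intro t
        induction t with
        | zero => simp
        | add x y hx hy => simp only [map_add, LinearMap.add_apply, TensorProduct.tmul_add, hx, hy,
            smul_add]
        | tmul b c =>
          rw [exchangeAux_tmul, h1, ← TensorProduct.smul_tmul', mul_smul]
          simp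
      rw [LinearMap.lTensor_tmul, e2]
      simp
  refine (e _).trans ?_
  simp

noncomputable instance {k H : Type*} [Field k] [Ring H] [HopfAlgebra k H] :
    AddCommGroup (DrinfeldDouble k H) :=
  inferInstanceAs (AddCommGroup (DualCop k H ⊗[k] H))

noncomputable instance {k H : Type*} [Field k] [Ring H] [HopfAlgebra k H] :
    Module k (DrinfeldDouble k H) :=
  inferInstanceAs (Module k (DualCop k H ⊗[k] H))

/-- The element `f ⊗ h` of the Drinfeld double. -/
noncomputable def tmul {k H : Type*} [Field k] [Ring H] [HopfAlgebra k H] (f : DualCop k H)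
    (h : H) : DrinfeldDouble k H :=
  f ⊗ₜ[k] h

theorem mulMap_assoc {k H : Type*} [Field k] [Ring H] [HopfAlgebra k H] [Module.Finite k H]
    [HasBijectiveAntipode k H] (x y z : DualCop k H ⊗[k] H) :
    mulMap k H (mulMap k H (x ⊗ₜ y) ⊗ₜ z) = mulMap k H (x ⊗ₜ mulMap k H (y ⊗ₜ z)) := by
  rw [← twist_eq_mulMap]
  exact twist_assoc (cocycle k H) (cocycleInv k H) cocycle_mul cocycleInv_mul cocycle_identity x y z

theorem mulMap_one_left {k H : Type*} [Field k] [Ring H] [HopfAlgebra k H]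
    [HasBijectiveAntipode k H] (x : DualCop k H ⊗[k] H) : mulMap k H ((1 ⊗ₜ 1) ⊗ₜ x) = x := by
  induction x with
  | zero => simp
  | add x y hx hy => simp only [map_add, TensorProduct.tmul_add, hx, hy]
  | tmul g m => rw [mulMap_tmul, exchange_one_left]; simp

theorem mulMap_one_right {k H : Type*} [Field k] [Ring H] [HopfAlgebra k H]
    [HasBijectiveAntipode k H] (x : DualCop k H ⊗[k] H) : mulMap k H (x ⊗ₜ (1 ⊗ₜ 1)) = x := by
  induction x with
  | zero => simp
  | add x y hx hy => simp only [map_add, TensorProduct.add_tmul, hx, hy]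
  | tmul g m => rw [mulMap_tmul, exchange_one_right]; simp

noncomputable instance {k H : Type*} [Field k] [Ring H] [HopfAlgebra k H] [Module.Finite k H]
    [HasBijectiveAntipode k H] : Ring (DrinfeldDouble k H) :=
  { (inferInstance : AddCommGroup (DrinfeldDouble k H)) with
    mul := fun x y => mulMap k H (x ⊗ₜ[k] y)
    one := tmul 1 1
    left_distrib := fun x y z =>
      (congrArg (mulMap k H) (TensorProduct.tmul_add _ _ _)).trans (map_add _ _ _)
    right_distrib := fun x y z =>
      (congrArg (mulMap k H) (TensorProduct.add_tmul _ _ _)).trans (map_add _ _ _)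
    zero_mul := fun x => (congrArg (mulMap k H) (TensorProduct.zero_tmul _ _)).trans (map_zero _)
    mul_zero := fun x => (congrArg (mulMap k H) (TensorProduct.tmul_zero _ _)).trans (map_zero _)
    mul_assoc := mulMap_assoc
    one_mul := mulMap_one_left
    mul_one := mulMap_one_right }

noncomputable instance {k H : Type*} [Field k] [Ring H] [HopfAlgebra k H] [Module.Finite k H]
    [HasBijectiveAntipode k H] : Algebra k (DrinfeldDouble k H) :=
  Algebra.ofModule
    (fun r x y => (congrArg (mulMap k H) (TensorProduct.smul_tmul' (R := k) (R' := k)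
      (M := DualCop k H ⊗[k] H) (N := DualCop k H ⊗[k] H) r x y).symm).trans
      (map_smul _ _ _))
    (fun r x y => (congrArg (mulMap k H) (TensorProduct.tmul_smul (R := k) (R' := k)
      (M := DualCop k H ⊗[k] H) (N := DualCop k H ⊗[k] H) r x y)).trans (map_smul _ _ _))

noncomputable instance {k H : Type*} [Field k] [Ring H] [HopfAlgebra k H] [Module.Finite k H] :
    Coalgebra k (DrinfeldDouble k H) :=
  inferInstanceAs (Coalgebra k (DualCop k H ⊗[k] H))

instance {k H : Type*} [Field k] [Ring H] [HopfAlgebra k H] [Module.Finite k H] :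
    Module.Finite k (DrinfeldDouble k H) :=
  inferInstanceAs (Module.Finite k (DualCop k H ⊗[k] H))

theorem mul_eq {k H : Type*} [Field k] [Ring H] [HopfAlgebra k H] [Module.Finite k H]
    [HasBijectiveAntipode k H] (x y : DrinfeldDouble k H) : x * y = mulMap k H (x ⊗ₜ[k] y) := rfl

theorem one_eq {k H : Type*} [Field k] [Ring H] [HopfAlgebra k H] [Module.Finite k H]
    [HasBijectiveAntipode k H] : (1 : DrinfeldDouble k H) = tmul 1 1 := rfl

end DrinfeldDouble

namespace DrinfeldDouble

open DualCop WithConv ConvTwist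

theorem map_mulMap {k H : Type*} [Field k] [Ring H] [HopfAlgebra k H] [Module.Finite k H]
    [HasBijectiveAntipode k H] (s t : DrinfeldDouble k H ⊗[k] DrinfeldDouble k H) :
    s * t = TensorProduct.map (LinearMap.mul' k (DrinfeldDouble k H))
      (LinearMap.mul' k (DrinfeldDouble k H))
      (TensorProduct.tensorTensorTensorComm k _ _ _ _ (s ⊗ₜ t)) := by
  induction s with
  | zero => simp
  | add x y hx hy => simp only [add_mul, TensorProduct.add_tmul, map_add, hx, hy]
  | tmul a b =>
    induction t with
    | zero => simp
    | add x y hx hy => simp only [mul_add, TensorProduct.tmul_add, map_add, hx, hy]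
    | tmul c d => simp

theorem counit_tmul {k H : Type*} [Field k] [Ring H] [HopfAlgebra k H] [Module.Finite k H]
    (f : DualCop k H) (h : H) : Coalgebra.counit (R := k) (tmul f h) =
      Coalgebra.counit (R := k) f * Coalgebra.counit (R := k) h := by
  refine (TensorProduct.counit_tmul (R := k) (S := k) f h).trans ?_
  rw [smul_eq_mul, mul_comm]

theorem comul_tmul_eq {k C : Type*} [Field k] [AddCommGroup C] [Module k C] [Coalgebra k C]
    (x y : C) : Coalgebra.comul (R := k) (x ⊗ₜ[k] y) =
      TensorProduct.tensorTensorTensorComm k C C C C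
        (Coalgebra.comul x ⊗ₜ Coalgebra.comul y) := by
  rw [TensorProduct.comul_tmul, TensorProduct.AlgebraTensorModule.tensorTensorTensorComm_eq]

theorem comul_mulMap {k H : Type*} [Field k] [Ring H] [HopfAlgebra k H] [Module.Finite k H]
    [HasBijectiveAntipode k H] (x y : DualCop k H ⊗[k] H) :
    Coalgebra.comul (R := k) (mulMap k H (x ⊗ₜ y)) = TensorProduct.map (mulMap k H) (mulMap k H)
      (TensorProduct.tensorTensorTensorComm k _ _ _ _
        (Coalgebra.comul x ⊗ₜ Coalgebra.comul y)) := by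
  have h := (twistCoalgHom (cocycle k H) (cocycleInv k H) cocycle_mul cocycleInv_mul).map_comp_comul
  have e : (twistCoalgHom (cocycle k H) (cocycleInv k H) cocycle_mul cocycleInv_mul).toLinearMap =
      mulMap k H := twist_eq_mulMap
  rw [e] at h
  rw [← comul_tmul_eq]
  exact (LinearMap.congr_fun h (x ⊗ₜ[k] y)).symm

theorem comul_mul {k H : Type*} [Field k] [Ring H] [HopfAlgebra k H] [Module.Finite k H]
    [HasBijectiveAntipode k H] (x y : DrinfeldDouble k H) :
    Coalgebra.comul (R := k) (x * y) = Coalgebra.comul x * Coalgebra.comul y := by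
  rw [map_mulMap]
  have e : LinearMap.mul' k (DrinfeldDouble k H) = mulMap k H :=
    TensorProduct.ext' fun a b => rfl
  rw [e]
  exact comul_mulMap x y

theorem counit_mul {k H : Type*} [Field k] [Ring H] [HopfAlgebra k H] [Module.Finite k H]
    [HasBijectiveAntipode k H] (x y : DrinfeldDouble k H) :
    Coalgebra.counit (R := k) (x * y) = Coalgebra.counit x * Coalgebra.counit y := by
  have h := (twistCoalgHom (cocycle k H) (cocycleInv k H) cocycle_mul cocycleInv_mul).counit_comp
  have e : (twistCoalgHom (cocycle k H) (cocycleInv k H) cocycle_mul cocycleInv_mul).toLinearMap =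
      mulMap k H := twist_eq_mulMap
  rw [e] at h
  have h2 := LinearMap.congr_fun h (x ⊗ₜ[k] y)
  refine h2.trans ?_
  refine (TensorProduct.counit_tmul (R := k) (S := k) (A := DualCop k H ⊗[k] H)
    (B := DualCop k H ⊗[k] H) x y).trans ?_
  rw [smul_eq_mul, mul_comm]
  rfl

noncomputable instance {k H : Type*} [Field k] [Ring H] [HopfAlgebra k H] [Module.Finite k H]
    [HasBijectiveAntipode k H] : Bialgebra k (DrinfeldDouble k H) :=
  Bialgebra.mk' k (DrinfeldDouble k H)
    (by rw [one_eq, counit_tmul, Bialgebra.counit_one, Bialgebra.counit_one, mul_one])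
    (fun {x y} => counit_mul x y)
    (by
      exact Bialgebra.comul_one (R := k) (A := DualCop k H ⊗[k] H))
    (fun {x y} => comul_mul x y)

/-- The embedding of `H` as a subalgebra. -/
noncomputable def inclH (k H : Type*) [Field k] [Ring H] [HopfAlgebra k H] [Module.Finite k H]
    [HasBijectiveAntipode k H] : H →ₐ[k] DrinfeldDouble k H :=
  AlgHom.ofLinearMap (TensorProduct.mk k (DualCop k H) H 1) rfl (by
    intro x y
    have : mulMap k H ((1 ⊗ₜ x) ⊗ₜ (1 ⊗ₜ y)) = 1 ⊗ₜ (x * y) := by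
      rw [mulMap_tmul, exchange_one_right]; simp
    exact this.symm)

/-- The embedding of the dual of `H` as a subalgebra. -/
noncomputable def inclDual (k H : Type*) [Field k] [Ring H] [HopfAlgebra k H] [Module.Finite k H]
    [HasBijectiveAntipode k H] : DualCop k H →ₐ[k] DrinfeldDouble k H :=
  AlgHom.ofLinearMap ((TensorProduct.mk k (DualCop k H) H).flip 1) rfl (by
    intro x y
    have : mulMap k H ((x ⊗ₜ 1) ⊗ₜ (y ⊗ₜ 1)) = (x * y) ⊗ₜ 1 := by
      rw [mulMap_tmul, exchange_one_left]; simp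
    exact this.symm)

theorem inclH_apply {k H : Type*} [Field k] [Ring H] [HopfAlgebra k H] [Module.Finite k H]
    [HasBijectiveAntipode k H] (h : H) : inclH k H h = tmul 1 h := rfl

theorem inclDual_apply {k H : Type*} [Field k] [Ring H] [HopfAlgebra k H] [Module.Finite k H]
    [HasBijectiveAntipode k H] (f : DualCop k H) : inclDual k H f = tmul f 1 := rfl

theorem inclDual_mul_inclH {k H : Type*} [Field k] [Ring H] [HopfAlgebra k H] [Module.Finite k H]
    [HasBijectiveAntipode k H] (f : DualCop k H) (h : H) :
    inclDual k H f * inclH k H h = tmul f h := by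
  have : mulMap k H ((f ⊗ₜ 1) ⊗ₜ (1 ⊗ₜ h)) = f ⊗ₜ h := by
    rw [mulMap_tmul, exchange_one_left]; simp
  exact this

end DrinfeldDouble

namespace DrinfeldDouble

open DualCop WithConv ConvTwist

/-- The coalgebra map `f ⊗ h ↦ ε(h) f`. -/
noncomputable def projDual (k H : Type*) [Field k] [Ring H] [HopfAlgebra k H] [Module.Finite k H] :
    DrinfeldDouble k H →ₗc[k] DualCop k H :=
  ((Coalgebra.TensorProduct.rid k k (DualCop k H)).toCoalgHom.comp
      (Coalgebra.TensorProduct.map (CoalgHom.id k (DualCop k H)) (Coalgebra.counitCoalgHom k H)) :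
    DualCop k H ⊗[k] H →ₗc[k] DualCop k H)

/-- The coalgebra map `f ⊗ h ↦ ε(f) h`. -/
noncomputable def projH (k H : Type*) [Field k] [Ring H] [HopfAlgebra k H] [Module.Finite k H] :
    DrinfeldDouble k H →ₗc[k] H :=
  ((Coalgebra.TensorProduct.lid k H).toCoalgHom.comp
      (Coalgebra.TensorProduct.map (Coalgebra.counitCoalgHom k (DualCop k H)) (CoalgHom.id k H)) :
    DualCop k H ⊗[k] H →ₗc[k] H)

/-- The composite of an algebra map, an endomorphism, and a coalgebra map. -/
noncomputable def sandwich {k C X D : Type*} [Field k] [Ring X] [Bialgebra k X] [AddCommGroup C]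
    [Module k C] [Coalgebra k C] [Ring D] [Algebra k D] (i : X →ₐ[k] D) (p : C →ₗc[k] X)
    (u : WithConv (X →ₗ[k] X)) : WithConv (C →ₗ[k] D) :=
  toConv (i.toLinearMap ∘ₗ u.ofConv ∘ₗ p.toLinearMap)

theorem sandwich_mul {k C X D : Type*} [Field k] [Ring X] [Bialgebra k X] [AddCommGroup C]
    [Module k C] [Coalgebra k C] [Ring D] [Algebra k D] (i : X →ₐ[k] D) (p : C →ₗc[k] X)
    (u v : WithConv (X →ₗ[k] X)) : sandwich i p (u * v) = sandwich i p u * sandwich i p v := by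
  have h1 := comp_coalgHom_mul u v p
  have h2 := congrArg toConv (LinearMap.algHom_comp_convMul_distrib i
    (toConv (u.ofConv ∘ₗ p.toLinearMap)) (toConv (v.ofConv ∘ₗ p.toLinearMap)))
  rw [← h1] at h2
  exact h2

theorem sandwich_one {k C X D : Type*} [Field k] [Ring X] [Bialgebra k X] [AddCommGroup C]
    [Module k C] [Coalgebra k C] [Ring D] [Algebra k D] (i : X →ₐ[k] D) (p : C →ₗc[k] X) :
    sandwich i p 1 = 1 := by
  ext x
  simp [sandwich]

theorem sandwich_id_mul {k H : Type*} [Field k] [Ring H] [HopfAlgebra k H] [Module.Finite k H]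
    [HasBijectiveAntipode k H] :
    sandwich (inclDual k H) (projDual k H) (toConv LinearMap.id) *
      sandwich (inclH k H) (projH k H) (toConv LinearMap.id) = toConv LinearMap.id := by
  apply ofConv_injective
  rw [LinearMap.convMul_def]
  apply TensorProduct.ext'
  intro f h
  obtain ⟨Φ, hΦ⟩ : ∃ Φ : (DualCop k H ⊗[k] H) ⊗[k] (DualCop k H ⊗[k] H) →ₗ[k]
      DrinfeldDouble k H, Φ = LinearMap.mul' k (DrinfeldDouble k H) ∘ₗ TensorProduct.map
        (sandwich (inclDual k H) (projDual k H) (toConv LinearMap.id)).ofConv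
        (sandwich (inclH k H) (projH k H) (toConv LinearMap.id)).ofConv := ⟨_, rfl⟩
  have e : ∀ (s : DualCop k H ⊗[k] DualCop k H) (t : H ⊗[k] H),
      Φ (TensorProduct.tensorTensorTensorComm k _ _ _ _ (s ⊗ₜ t)) =
      inclDual k H (cR k s) * inclH k H (cL k t) := by
    intro s t
    induction s with
    | zero => simp
    | add x y hx hy => simp only [map_add, TensorProduct.add_tmul, hx, hy, add_mul]
    | tmul f f' =>
      induction t with
      | zero => simp
      | add x y hx hy => simp only [map_add, TensorProduct.tmul_add, hx, hy, mul_add]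
      | tmul h h' =>
        have e1 : projDual k H (tmul f h) = Coalgebra.counit (R := k) h • f := rfl
        have e2 : projH k H (tmul f' h') = Coalgebra.counit (R := k) f' • h' := rfl
        rw [hΦ]
        refine (congrArg₂ (fun a b => inclDual k H a * inclH k H b) e1 e2).trans ?_
        simp only [cR_tmul, cL_tmul, map_smul, smul_mul_assoc, mul_smul_comm]
        rw [smul_comm]
  rw [hΦ] at e
  refine (e (Coalgebra.comul f) (Coalgebra.comul h)).trans ?_
  rw [cR_comul, cL_comul, inclDual_mul_inclH]
  rfl

noncomputable instance {k H : Type*} [Field k] [Ring H] [HopfAlgebra k H] [Module.Finite k H]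
    [HasBijectiveAntipode k H] : HopfAlgebra k (DrinfeldDouble k H) :=
  HopfAlgebra.ofConvInverse
    (sandwich (inclH k H) (projH k H) (toConv (HopfAlgebra.antipode k)) *
      sandwich (inclDual k H) (projDual k H) (toConv (HopfAlgebra.antipode k))).ofConv
    (by
      rw [toConv_ofConv, ← sandwich_id_mul, mul_assoc,
        ← mul_assoc (sandwich (inclDual k H) (projDual k H) (toConv (HopfAlgebra.antipode k))),
        ← sandwich_mul, LinearMap.antipode_mul_id, sandwich_one, one_mul, ← sandwich_mul, LinearMap.antipode_mul_id,
        sandwich_one])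
    (by
      rw [toConv_ofConv, ← sandwich_id_mul, mul_assoc,
        ← mul_assoc (sandwich (inclH k H) (projH k H) (toConv LinearMap.id)),
        ← sandwich_mul, LinearMap.id_mul_antipode, sandwich_one, one_mul, ← sandwich_mul, LinearMap.id_mul_antipode,
        sandwich_one])

end DrinfeldDouble

/-! ### The small quantum group of `sl₂` -/

/-- The generators `E`, `F`, `K`. -/
inductive QuantumGen : Type
  | E : QuantumGen
  | F : QuantumGen
  | K : QuantumGen

/-- The defining relations of the small quantum group; `K ^ (l - 1)` is the inverse of `K`. -/
inductive QuantumRel {k : Type*} [Field k] (p : k) (l : ℕ) :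
    FreeAlgebra k QuantumGen → FreeAlgebra k QuantumGen → Prop
  | K_pow : QuantumRel p l (FreeAlgebra.ι k QuantumGen.K ^ l) 1
  | E_pow : QuantumRel p l (FreeAlgebra.ι k QuantumGen.E ^ l) 0
  | F_pow : QuantumRel p l (FreeAlgebra.ι k QuantumGen.F ^ l) 0
  | KE : QuantumRel p l (FreeAlgebra.ι k QuantumGen.K * FreeAlgebra.ι k QuantumGen.E)
      (p ^ 2 • (FreeAlgebra.ι k QuantumGen.E * FreeAlgebra.ι k QuantumGen.K))
  | KF : QuantumRel p l (FreeAlgebra.ι k QuantumGen.K * FreeAlgebra.ι k QuantumGen.F)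
      ((p ^ 2)⁻¹ • (FreeAlgebra.ι k QuantumGen.F * FreeAlgebra.ι k QuantumGen.K))
  | EF : QuantumRel p l
      (FreeAlgebra.ι k QuantumGen.E * FreeAlgebra.ι k QuantumGen.F -
        FreeAlgebra.ι k QuantumGen.F * FreeAlgebra.ι k QuantumGen.E)
      ((p - p⁻¹)⁻¹ • (FreeAlgebra.ι k QuantumGen.K - FreeAlgebra.ι k QuantumGen.K ^ (l - 1)))

/-- The small quantum group `u_p(sl₂)` at a root of unity `p` of order `l`, as an algebra given by
generators and relations. -/
def SmallQuantumGroup (k : Type*) [Field k] (p : k) (l : ℕ) : Type _ := RingQuot (QuantumRel p l)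

namespace SmallQuantumGroup

noncomputable instance {k : Type*} [Field k] (p : k) (l : ℕ) : Ring (SmallQuantumGroup k p l) :=
  inferInstanceAs (Ring (RingQuot (QuantumRel p l)))

noncomputable instance {k : Type*} [Field k] (p : k) (l : ℕ) :
    Algebra k (SmallQuantumGroup k p l) :=
  inferInstanceAs (Algebra k (RingQuot (QuantumRel p l)))

/-- The projection from the free algebra. -/
noncomputable def mk {k : Type*} [Field k] (p : k) (l : ℕ) :
    FreeAlgebra k QuantumGen →ₐ[k] SmallQuantumGroup k p l := RingQuot.mkAlgHom k (QuantumRel p l)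

/-- The generators. -/
noncomputable def gen {k : Type*} [Field k] (p : k) (l : ℕ) (a : QuantumGen) :
    SmallQuantumGroup k p l := mk p l (FreeAlgebra.ι k a)

/-- The generator `E`. -/
noncomputable def E {k : Type*} [Field k] (p : k) (l : ℕ) : SmallQuantumGroup k p l :=
  gen p l QuantumGen.E

/-- The generator `F`. -/
noncomputable def F {k : Type*} [Field k] (p : k) (l : ℕ) : SmallQuantumGroup k p l :=
  gen p l QuantumGen.F

/-- The generator `K`. -/
noncomputable def K {k : Type*} [Field k] (p : k) (l : ℕ) : SmallQuantumGroup k p l :=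
  gen p l QuantumGen.K

/-- The inverse `K ^ (l - 1)` of `K`. -/
noncomputable def KInv {k : Type*} [Field k] (p : k) (l : ℕ) : SmallQuantumGroup k p l :=
  K p l ^ (l - 1)

theorem mk_rel {k : Type*} [Field k] {p : k} {l : ℕ} {a b : FreeAlgebra k QuantumGen}
    (h : QuantumRel p l a b) : mk p l a = mk p l b := RingQuot.mkAlgHom_rel k h

theorem K_pow {k : Type*} [Field k] (p : k) (l : ℕ) : K p l ^ l = 1 := by
  simpa only [map_pow, map_one, K, gen] using mk_rel (QuantumRel.K_pow (p := p) (l := l))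

theorem E_pow {k : Type*} [Field k] (p : k) (l : ℕ) : E p l ^ l = 0 := by
  simpa only [map_pow, map_zero, E, gen] using mk_rel (QuantumRel.E_pow (p := p) (l := l))

theorem F_pow {k : Type*} [Field k] (p : k) (l : ℕ) : F p l ^ l = 0 := by
  simpa only [map_pow, map_zero, F, gen] using mk_rel (QuantumRel.F_pow (p := p) (l := l))

theorem K_mul_E {k : Type*} [Field k] (p : k) (l : ℕ) :
    K p l * E p l = p ^ 2 • (E p l * K p l) := by
  simpa only [map_mul, map_smul, K, E, gen] using mk_rel (QuantumRel.KE (p := p) (l := l))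

theorem K_mul_F {k : Type*} [Field k] (p : k) (l : ℕ) :
    K p l * F p l = (p ^ 2)⁻¹ • (F p l * K p l) := by
  simpa only [map_mul, map_smul, K, F, gen] using mk_rel (QuantumRel.KF (p := p) (l := l))

theorem E_mul_F {k : Type*} [Field k] (p : k) (l : ℕ) :
    E p l * F p l - F p l * E p l = (p - p⁻¹)⁻¹ • (K p l - KInv p l) := by
  simpa only [map_mul, map_smul, map_sub, map_pow, K, E, F, KInv, gen] using
    mk_rel (QuantumRel.EF (p := p) (l := l))

/-- The defining relations, for elements `X`, `Y` and `G` of an algebra `B`. -/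
structure Rels {k B : Type*} [Field k] [Ring B] [Algebra k B] (p : k) (l : ℕ)
    (X Y G : B) : Prop where
  gp : G ^ l = 1
  xp : X ^ l = 0
  yp : Y ^ l = 0
  gx : G * X = p ^ 2 • (X * G)
  gy : G * Y = (p ^ 2)⁻¹ • (Y * G)
  xy : X * Y - Y * X = (p - p⁻¹)⁻¹ • (G - G ^ (l - 1))

/-- The algebra map given by images of the generators that satisfy the relations. -/
noncomputable def lift {k B : Type*} [Field k] [Ring B] [Algebra k B] {p : k} {l : ℕ}
    {X Y G : B} (h : Rels p l X Y G) : SmallQuantumGroup k p l →ₐ[k] B :=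
  RingQuot.liftAlgHom k (s := QuantumRel p l)
    ⟨FreeAlgebra.lift k (QuantumGen.rec X Y G), by
      intro a b hab
      induction hab <;> simp only [map_mul, map_smul, map_pow, map_one, map_zero, map_sub,
        FreeAlgebra.lift_ι_apply]
      · exact h.gp
      · exact h.xp
      · exact h.yp
      · exact h.gx
      · exact h.gy
      · exact h.xy⟩

theorem lift_E {k B : Type*} [Field k] [Ring B] [Algebra k B] {p : k} {l : ℕ}
    {X Y G : B} (h : Rels p l X Y G) : lift h (E p l) = X :=
  (RingQuot.liftAlgHom_mkAlgHom_apply ..).trans (FreeAlgebra.lift_ι_apply ..)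

theorem lift_F {k B : Type*} [Field k] [Ring B] [Algebra k B] {p : k} {l : ℕ}
    {X Y G : B} (h : Rels p l X Y G) : lift h (F p l) = Y :=
  (RingQuot.liftAlgHom_mkAlgHom_apply ..).trans (FreeAlgebra.lift_ι_apply ..)

theorem lift_K {k B : Type*} [Field k] [Ring B] [Algebra k B] {p : k} {l : ℕ}
    {X Y G : B} (h : Rels p l X Y G) : lift h (K p l) = G :=
  (RingQuot.liftAlgHom_mkAlgHom_apply ..).trans (FreeAlgebra.lift_ι_apply ..)

theorem hom_ext {k B : Type*} [Field k] [Ring B] [Algebra k B] {p : k} {l : ℕ}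
    {f f' : SmallQuantumGroup k p l →ₐ[k] B} (hE : f (E p l) = f' (E p l))
    (hF : f (F p l) = f' (F p l)) (hK : f (K p l) = f' (K p l)) : f = f' := by
  refine RingQuot.ringQuot_ext' k f f' (FreeAlgebra.hom_ext ?_)
  funext a
  cases a with
  | E => exact hE
  | F => exact hF
  | K => exact hK

/-- The set of generators. -/
def gens {k : Type*} [Field k] (p : k) (l : ℕ) : Set (SmallQuantumGroup k p l) :=
  {E p l, F p l, K p l}

theorem adjoin_gens {k : Type*} [Field k] (p : k) (l : ℕ) :
    Algebra.adjoin k (gens p l) = ⊤ := by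
  rw [eq_top_iff]
  intro a _
  obtain ⟨b, rfl⟩ : ∃ b, mk p l b = a := RingQuot.mkAlgHom_surjective k (QuantumRel p l) a
  induction b using FreeAlgebra.induction with
  | grade0 r => rw [AlgHom.commutes]; exact Subalgebra.algebraMap_mem _ r
  | grade1 y =>
    apply Algebra.subset_adjoin
    cases y with
    | E => exact Or.inl rfl
    | F => exact Or.inr (Or.inl rfl)
    | K => exact Or.inr (Or.inr rfl)
  | mul a b ha hb => rw [map_mul]; exact mul_mem (ha trivial) (hb trivial)
  | add a b ha hb => rw [map_add]; exact add_mem (ha trivial) (hb trivial)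

theorem K_mul_KInv {k : Type*} [Field k] (p : k) {l : ℕ} (hl : l ≠ 0) :
    K p l * KInv p l = 1 := by
  rw [KInv, ← pow_succ', Nat.sub_add_cancel (Nat.pos_of_ne_zero hl), K_pow]

theorem KInv_mul_K {k : Type*} [Field k] (p : k) {l : ℕ} (hl : l ≠ 0) :
    KInv p l * K p l = 1 := by
  rw [KInv, ← pow_succ, Nat.sub_add_cancel (Nat.pos_of_ne_zero hl), K_pow]

theorem E_mul_KInv {k : Type*} [Field k] (p : k) {l : ℕ} (hl : l ≠ 0) :
    E p l * KInv p l = p ^ 2 • (KInv p l * E p l) := by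
  have h : E p l * KInv p l = KInv p l * (K p l * E p l) * KInv p l := by
    rw [← mul_assoc, KInv_mul_K p hl, one_mul]
  rw [h, K_mul_E, mul_smul_comm, smul_mul_assoc, mul_assoc, mul_assoc, K_mul_KInv p hl, mul_one]

theorem F_mul_KInv {k : Type*} [Field k] (p : k) {l : ℕ} (hl : l ≠ 0) :
    F p l * KInv p l = (p ^ 2)⁻¹ • (KInv p l * F p l) := by
  have h : F p l * KInv p l = KInv p l * (K p l * F p l) * KInv p l := by
    rw [← mul_assoc, KInv_mul_K p hl, one_mul]
  rw [h, K_mul_F, mul_smul_comm, smul_mul_assoc, mul_assoc, mul_assoc, K_mul_KInv p hl, mul_one]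

theorem KInv_pow {k : Type*} [Field k] (p : k) {l : ℕ} (hl : l ≠ 0) :
    KInv p l ^ (l - 1) = K p l := by
  have h1 : KInv p l ^ (l - 1) * (KInv p l * K p l) = K p l := by
    rw [← mul_assoc, ← pow_succ, Nat.sub_add_cancel (Nat.pos_of_ne_zero hl), KInv, ← pow_mul,
      mul_comm (l - 1), pow_mul, K_pow, one_pow, one_mul]
  rw [KInv_mul_K p hl, mul_one] at h1
  exact h1

theorem sq_isPrimitiveRoot {k : Type*} [Field k] {p : k} {l : ℕ} (hp : IsPrimitiveRoot p l)
    (hl : Odd l) : IsPrimitiveRoot (p ^ 2) l :=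
  hp.pow_of_coprime 2 (Nat.coprime_two_left.2 hl)

theorem comul_rels {k : Type*} [Field k] {p : k} {l : ℕ} (hp : IsPrimitiveRoot p l)
    (hl : Odd l) :
    Rels (k := k) (B := SmallQuantumGroup k p l ⊗[k] SmallQuantumGroup k p l) p l
      (1 ⊗ₜ E p l + E p l ⊗ₜ K p l) (KInv p l ⊗ₜ F p l + F p l ⊗ₜ 1) (K p l ⊗ₜ K p l) where
  gp := by simp [K_pow, Algebra.TensorProduct.one_def]
  xp := by
    have h0 := hl.pos.ne'
    rw [QBinom.add_pow_root (sq_isPrimitiveRoot hp hl) h0]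
    · simp [E_pow]
    · simp [K_mul_E]
  yp := by
    have h0 := hl.pos.ne'
    have hp2 : p ^ 2 ≠ 0 := pow_ne_zero _ (hp.ne_zero h0)
    rw [add_comm, QBinom.add_pow_root (sq_isPrimitiveRoot hp hl) h0]
    · simp [F_pow]
    · simp [F_mul_KInv p h0, ← TensorProduct.smul_tmul', smul_smul, hp2]
  gx := by
    simp [mul_add, add_mul, K_mul_E, ← TensorProduct.smul_tmul']
  gy := by
    have h0 := hl.pos.ne'
    simp [mul_add, add_mul, K_mul_F, ← TensorProduct.smul_tmul', K_mul_KInv p h0,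
      KInv_mul_K p h0]
  xy := by
    have h0 := hl.pos.ne'
    have hp2 : p ^ 2 ≠ 0 := pow_ne_zero _ (hp.ne_zero h0)
    have e1 : E p l * F p l = F p l * E p l + (p - p⁻¹)⁻¹ • (K p l - KInv p l) := by
      rw [← E_mul_F]; abel
    have e2 : K p l ^ (l - 1) = KInv p l := rfl
    simp only [mul_add, add_mul, Algebra.TensorProduct.tmul_mul_tmul, one_mul, mul_one, e1,
      Algebra.TensorProduct.tmul_pow, e2, E_mul_KInv p h0, K_mul_F, TensorProduct.tmul_add,
      TensorProduct.add_tmul, ← TensorProduct.smul_tmul', TensorProduct.tmul_smul, smul_smul,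
      TensorProduct.tmul_sub, TensorProduct.sub_tmul, smul_sub,
      inv_mul_cancel₀ hp2, one_smul]
    abel

/-- The comultiplication, as an algebra map: `E ↦ 1 ⊗ E + E ⊗ K`, `F ↦ K⁻¹ ⊗ F + F ⊗ 1` and
`K ↦ K ⊗ K`. -/
noncomputable def comulHom {k : Type*} [Field k] {p : k} {l : ℕ} (hp : IsPrimitiveRoot p l)
    (hl : Odd l) :
    SmallQuantumGroup k p l →ₐ[k] SmallQuantumGroup k p l ⊗[k] SmallQuantumGroup k p l :=
  lift (comul_rels hp hl)

theorem counit_rels {k : Type*} [Field k] (p : k) {l : ℕ} (hl : l ≠ 0) :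
    Rels p l (0 : k) 0 1 where
  gp := one_pow l
  xp := zero_pow hl
  yp := zero_pow hl
  gx := by simp
  gy := by simp
  xy := by simp

/-- The counit, as an algebra map: `E ↦ 0`, `F ↦ 0` and `K ↦ 1`. -/
noncomputable def counitHom {k : Type*} [Field k] (p : k) {l : ℕ} (hl : l ≠ 0) :
    SmallQuantumGroup k p l →ₐ[k] k :=
  lift (counit_rels p hl)

theorem comulHom_E {k : Type*} [Field k] {p : k} {l : ℕ} (hp : IsPrimitiveRoot p l)
    (hl : Odd l) : comulHom hp hl (E p l) = 1 ⊗ₜ E p l + E p l ⊗ₜ K p l := lift_E _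

theorem comulHom_F {k : Type*} [Field k] {p : k} {l : ℕ} (hp : IsPrimitiveRoot p l)
    (hl : Odd l) : comulHom hp hl (F p l) = KInv p l ⊗ₜ F p l + F p l ⊗ₜ 1 := lift_F _

theorem comulHom_K {k : Type*} [Field k] {p : k} {l : ℕ} (hp : IsPrimitiveRoot p l)
    (hl : Odd l) : comulHom hp hl (K p l) = K p l ⊗ₜ K p l := lift_K _

theorem comulHom_KInv {k : Type*} [Field k] {p : k} {l : ℕ} (hp : IsPrimitiveRoot p l)
    (hl : Odd l) : comulHom hp hl (KInv p l) = KInv p l ⊗ₜ KInv p l := by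
  rw [KInv, map_pow, comulHom_K, Algebra.TensorProduct.tmul_pow]

theorem counitHom_E {k : Type*} [Field k] (p : k) {l : ℕ} (hl : l ≠ 0) :
    counitHom p hl (E p l) = 0 := lift_E _

theorem counitHom_F {k : Type*} [Field k] (p : k) {l : ℕ} (hl : l ≠ 0) :
    counitHom p hl (F p l) = 0 := lift_F _

theorem counitHom_K {k : Type*} [Field k] (p : k) {l : ℕ} (hl : l ≠ 0) :
    counitHom p hl (K p l) = 1 := lift_K _

theorem counitHom_KInv {k : Type*} [Field k] (p : k) {l : ℕ} (hl : l ≠ 0) :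
    counitHom p hl (KInv p l) = 1 := by rw [KInv, map_pow, counitHom_K, one_pow]

noncomputable instance instBialgebra {k : Type*} [Field k] (p : k) (l : ℕ)
    [hp : Fact (IsPrimitiveRoot p l)] [hl : Fact (Odd l)] :
    Bialgebra k (SmallQuantumGroup k p l) :=
  Bialgebra.ofAlgHom (comulHom hp.out hl.out) (counitHom p hl.out.pos.ne')
    (by
      apply hom_ext <;>
        simp [comulHom_E, comulHom_F, comulHom_K, comulHom_KInv, TensorProduct.add_tmul,
          TensorProduct.tmul_add, Algebra.TensorProduct.one_def, add_assoc])
    (by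
      apply hom_ext <;>
        simp [comulHom_E, comulHom_F, comulHom_K, counitHom_E, counitHom_F, counitHom_K,
          counitHom_KInv])
    (by
      apply hom_ext <;>
        simp [comulHom_E, comulHom_F, comulHom_K, counitHom_E, counitHom_F, counitHom_K])

theorem comul_E {k : Type*} [Field k] (p : k) (l : ℕ) [Fact (IsPrimitiveRoot p l)]
    [Fact (Odd l)] :
    Coalgebra.comul (R := k) (E p l) = 1 ⊗ₜ[k] E p l + E p l ⊗ₜ[k] K p l :=
  comulHom_E Fact.out Fact.out

theorem comul_F {k : Type*} [Field k] (p : k) (l : ℕ) [Fact (IsPrimitiveRoot p l)]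
    [Fact (Odd l)] :
    Coalgebra.comul (R := k) (F p l) = KInv p l ⊗ₜ[k] F p l + F p l ⊗ₜ[k] 1 :=
  comulHom_F Fact.out Fact.out

theorem comul_K {k : Type*} [Field k] (p : k) (l : ℕ) [Fact (IsPrimitiveRoot p l)]
    [Fact (Odd l)] : Coalgebra.comul (R := k) (K p l) = K p l ⊗ₜ[k] K p l :=
  comulHom_K Fact.out Fact.out

theorem counit_E {k : Type*} [Field k] (p : k) (l : ℕ) [Fact (IsPrimitiveRoot p l)]
    [hl : Fact (Odd l)] : Coalgebra.counit (R := k) (E p l) = 0 := counitHom_E p hl.out.pos.ne'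

theorem counit_F {k : Type*} [Field k] (p : k) (l : ℕ) [Fact (IsPrimitiveRoot p l)]
    [hl : Fact (Odd l)] : Coalgebra.counit (R := k) (F p l) = 0 := counitHom_F p hl.out.pos.ne'

theorem counit_K {k : Type*} [Field k] (p : k) (l : ℕ) [Fact (IsPrimitiveRoot p l)]
    [hl : Fact (Odd l)] : Coalgebra.counit (R := k) (K p l) = 1 := counitHom_K p hl.out.pos.ne'

/-- The `m`-th power of a product of two elements that commute up to a scalar. -/
theorem exists_mul_pow {k A : Type*} [Field k] [Ring A] [Algebra k A] {c : k} {a b : A}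
    (h : b * a = c • (a * b)) (m : ℕ) : ∃ d : k, (a * b) ^ m = d • (a ^ m * b ^ m) := by
  induction m with
  | zero => exact ⟨1, by simp⟩
  | succ m ih =>
    obtain ⟨d, hd⟩ := ih
    have h2 := QBinom.pow_mul_of_mul h m
    refine ⟨c ^ m * d, ?_⟩
    rw [pow_succ', hd, mul_smul_comm, mul_assoc, ← mul_assoc b, h2, smul_mul_assoc,
      mul_smul_comm, smul_smul, mul_assoc, ← pow_succ', ← mul_assoc, ← pow_succ', mul_comm d]

theorem antipode_rels {k : Type*} [Field k] {p : k} {l : ℕ} (hp : p ≠ 0) (hl : l ≠ 0) :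
    Rels (k := k) (B := (SmallQuantumGroup k p l)ᵐᵒᵖ) p l
      (MulOpposite.op (-(E p l * KInv p l))) (MulOpposite.op (-(K p l * F p l)))
      (MulOpposite.op (KInv p l)) where
  gp := by
    rw [← MulOpposite.op_pow, KInv, ← pow_mul, mul_comm, pow_mul, K_pow, one_pow,
      MulOpposite.op_one]
  xp := by
    have h : KInv p l * E p l = (p ^ 2)⁻¹ • (E p l * KInv p l) := by
      rw [E_mul_KInv p hl, smul_smul, inv_mul_cancel₀ (pow_ne_zero _ hp), one_smul]
    obtain ⟨d, hd⟩ := exists_mul_pow h l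
    rw [← MulOpposite.op_pow, neg_pow, hd, E_pow]
    simp
  yp := by
    have h : F p l * K p l = p ^ 2 • (K p l * F p l) := by
      rw [K_mul_F, smul_smul, mul_inv_cancel₀ (pow_ne_zero _ hp), one_smul]
    obtain ⟨d, hd⟩ := exists_mul_pow h l
    rw [← MulOpposite.op_pow, neg_pow, hd, F_pow]
    simp
  gx := by
    rw [← MulOpposite.op_mul, ← MulOpposite.op_mul, ← MulOpposite.op_smul, neg_mul, mul_neg,
      smul_neg, ← mul_assoc, E_mul_KInv p hl, smul_mul_assoc]
  gy := by
    rw [← MulOpposite.op_mul, ← MulOpposite.op_mul, ← MulOpposite.op_smul, neg_mul, mul_neg,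
      smul_neg, ← mul_assoc, KInv_mul_K p hl, one_mul, mul_assoc, F_mul_KInv p hl, mul_smul_comm,
      ← mul_assoc, K_mul_KInv p hl, one_mul]
  xy := by
    rw [← MulOpposite.op_pow, KInv_pow p hl, ← MulOpposite.op_mul, ← MulOpposite.op_mul,
      ← MulOpposite.op_sub, ← MulOpposite.op_sub, ← MulOpposite.op_smul]
    congr 1
    have h1 : E p l * KInv p l * (K p l * F p l) = E p l * F p l := by
      rw [mul_assoc, ← mul_assoc (KInv p l), KInv_mul_K p hl, one_mul]
    have h2 : K p l * F p l * (E p l * KInv p l) = F p l * E p l := by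
      rw [E_mul_KInv p hl, K_mul_F, mul_smul_comm, smul_mul_assoc, smul_smul,
        mul_inv_cancel₀ (pow_ne_zero _ hp), one_smul, mul_assoc, ← mul_assoc (K p l),
        K_mul_KInv p hl, one_mul]
    rw [neg_mul_neg, neg_mul_neg, h1, h2, ← neg_sub, E_mul_F, ← smul_neg, neg_sub]

/-- The antipode, as an algebra map to the opposite algebra: `E ↦ -E K⁻¹`, `F ↦ -K F` and
`K ↦ K⁻¹`. -/
noncomputable def antipodeHom {k : Type*} [Field k] {p : k} {l : ℕ} (hp : p ≠ 0) (hl : l ≠ 0) :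
    SmallQuantumGroup k p l →ₐ[k] (SmallQuantumGroup k p l)ᵐᵒᵖ :=
  lift (antipode_rels hp hl)

theorem antipodeHom_E {k : Type*} [Field k] {p : k} {l : ℕ} (hp : p ≠ 0) (hl : l ≠ 0) :
    antipodeHom hp hl (E p l) = MulOpposite.op (-(E p l * KInv p l)) := lift_E _

theorem antipodeHom_F {k : Type*} [Field k] {p : k} {l : ℕ} (hp : p ≠ 0) (hl : l ≠ 0) :
    antipodeHom hp hl (F p l) = MulOpposite.op (-(K p l * F p l)) := lift_F _

theorem antipodeHom_K {k : Type*} [Field k] {p : k} {l : ℕ} (hp : p ≠ 0) (hl : l ≠ 0) :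
    antipodeHom hp hl (K p l) = MulOpposite.op (KInv p l) := lift_K _

theorem antipodeHom_KInv {k : Type*} [Field k] {p : k} {l : ℕ} (hp : p ≠ 0) (hl : l ≠ 0) :
    antipodeHom hp hl (KInv p l) = MulOpposite.op (K p l) := by
  conv_lhs => rw [KInv, map_pow, antipodeHom_K, ← MulOpposite.op_pow, KInv_pow p hl]

noncomputable instance instHopfAlgebra {k : Type*} [Field k] (p : k) (l : ℕ)
    [hp : Fact (IsPrimitiveRoot p l)] [hl : Fact (Odd l)] :
    HopfAlgebra k (SmallQuantumGroup k p l) :=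
  HopfAlgebra.ofGenerators (antipodeHom (hp.out.ne_zero hl.out.pos.ne') hl.out.pos.ne')
    (gens p l) (adjoin_gens p l)
    (by
      have h0 := hl.out.pos.ne'
      rintro _ (rfl | rfl | rfl)
      · simp [comul_E, counit_E, antipodeHom_E, antipodeHom_K, mul_assoc, KInv_mul_K p h0]
      · simp [comul_F, counit_F, antipodeHom_F, antipodeHom_KInv]
      · simp [comul_K, counit_K, antipodeHom_K, KInv_mul_K p h0])
    (by
      have h0 := hl.out.pos.ne'
      rintro _ (rfl | rfl | rfl)
      · simp [comul_E, counit_E, antipodeHom_E, antipodeHom_K]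
      · simp [comul_F, counit_F, antipodeHom_F, ← mul_assoc, KInv_mul_K p h0]
      · simp [comul_K, counit_K, antipodeHom_K, K_mul_KInv p h0])

end SmallQuantumGroup

/-! ### Quasitriangular, factorizable and pointed Hopf algebras -/

/-- `R₁₂ = R ⊗ 1`. -/
noncomputable def leg₁₂ (k : Type*) {H : Type*} [Field k] [Ring H] [Algebra k H] (R : H ⊗[k] H) :
    H ⊗[k] (H ⊗[k] H) :=
  Algebra.TensorProduct.map (AlgHom.id k H)
    (Algebra.TensorProduct.includeLeft : H →ₐ[k] H ⊗[k] H) R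

/-- `R₁₃`, with `1` in the middle factor. -/
noncomputable def leg₁₃ (k : Type*) {H : Type*} [Field k] [Ring H] [Algebra k H] (R : H ⊗[k] H) :
    H ⊗[k] (H ⊗[k] H) :=
  Algebra.TensorProduct.map (AlgHom.id k H)
    (Algebra.TensorProduct.includeRight : H →ₐ[k] H ⊗[k] H) R

/-- `R₂₃ = 1 ⊗ R`. -/
noncomputable def leg₂₃ (k : Type*) {H : Type*} [Field k] [Ring H] [Algebra k H] (R : H ⊗[k] H) :
    H ⊗[k] (H ⊗[k] H) :=
  (1 : H) ⊗ₜ[k] R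

/-- `(H, R)` is a quasitriangular Hopf algebra. -/
structure IsQuasitriangular (k H : Type*) [Field k] [Ring H] [HopfAlgebra k H]
    (R : H ⊗[k] H) : Prop where
  isUnit : IsUnit R
  comul_left : TensorProduct.assoc k H H H (Coalgebra.comul.rTensor H R) =
    leg₁₃ k R * leg₂₃ k R
  comul_right : Coalgebra.comul.lTensor H R = leg₁₃ k R * leg₁₂ k R
  comul_op : ∀ h : H, TensorProduct.comm k H H (Coalgebra.comul h) * R = R * Coalgebra.comul h

/-- The map `H^* → H`, `a ↦ (a ⊗ id) T`. -/
noncomputable def contractFst (k : Type*) {H : Type*} [Field k] [AddCommGroup H] [Module k H]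
    (T : H ⊗[k] H) : Module.Dual k H →ₗ[k] H where
  toFun a := TensorProduct.lid k H (a.rTensor H T)
  map_add' a b := by rw [LinearMap.rTensor_add, LinearMap.add_apply, map_add]
  map_smul' r a := by rw [LinearMap.rTensor_smul, LinearMap.smul_apply, map_smul]; rfl

/-- `(H, R)` is a factorizable Hopf algebra: it is quasitriangular, and the map
`H^* → H`, `a ↦ (a ⊗ id)(R₂₁ R)`, is bijective. -/
structure IsFactorizable (k H : Type*) [Field k] [Ring H] [HopfAlgebra k H]
    (R : H ⊗[k] H) : Prop extends IsQuasitriangular k H R where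
  bijective : Function.Bijective (contractFst k (TensorProduct.comm k H H R * R))

/-- `N` is a subcoalgebra of `C`, that is, `Δ(N) ⊆ N ⊗ N`. -/
def IsSubcoalgebra {k C : Type*} [Field k] [AddCommGroup C] [Module k C] [Coalgebra k C]
    (N : Submodule k C) : Prop :=
  ∀ x ∈ N, Coalgebra.comul (R := k) x ∈ LinearMap.range (TensorProduct.map N.subtype N.subtype)

/-- `C` is pointed: every simple subcoalgebra of `C` is one-dimensional. -/
def IsPointedCoalgebra (k C : Type*) [Field k] [AddCommGroup C] [Module k C] [Coalgebra k C] :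
    Prop :=
  ∀ N : Submodule k C, IsSubcoalgebra N → N ≠ ⊥ →
    (∀ M : Submodule k C, IsSubcoalgebra M → M ≤ N → M = ⊥ ∨ M = N) → Module.finrank k N = 1

/-- The left ideal `H K⁺`, where `K` is the subalgebra generated by `z` (the group algebra of the
cyclic group generated by `z` if `z` is grouplike of finite order) and `K⁺` is the kernel of the
counit on `K`. -/
def augmentationIdeal (k : Type*) {H : Type*} [Field k] [Ring H] [HopfAlgebra k H] (z : H) :
    Ideal H :=
  Ideal.span {y | y ∈ Algebra.adjoin k {z} ∧ Coalgebra.counit (R := k) y = 0}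

namespace DrinfeldDouble

/-- The standard universal `R`-matrix `∑ (ε ⊗ eᵢ) ⊗ (eⁱ ⊗ 1)` of the Drinfeld double, for a basis
`eᵢ` of `H` with dual basis `eⁱ`. -/
noncomputable def universalR (k H : Type*) [Field k] [Ring H] [HopfAlgebra k H]
    [Module.Finite k H] [HasBijectiveAntipode k H] :
    DrinfeldDouble k H ⊗[k] DrinfeldDouble k H :=
  TensorProduct.map (inclH k H).toLinearMap
    ((inclDual k H).toLinearMap ∘ₗ (DualCop.toDual k H).symm.toLinearMap) (coevaluation k H 1)

end DrinfeldDouble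

instance instNeZeroOfOdd (l : ℕ) [hl : Fact (Odd l)] : NeZero l := ⟨hl.out.pos.ne'⟩

namespace TaftAlgebra

/-- The algebra map `χ` with `χ(x i) = 0` and `χ(g i) = q`, as an element of the dual. -/
noncomputable def chi {k : Type*} [Field k] (q : k) (l n : ℕ) [hq : Fact (IsPrimitiveRoot q l)]
    [hl : NeZero l] : DualCop k (TaftAlgebra k q l n) :=
  (DualCop.toDual k (TaftAlgebra k q l n)).symm
    (character q hl.out n q hq.out.pow_eq_one).toLinearMap

/-- The element `χ gₙ = χ ⊗ gₙ` of the Drinfeld double. -/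
noncomputable def chiG {k : Type*} [Field k] (q : k) (l n : ℕ) (hn : 0 < n)
    [Fact (IsPrimitiveRoot q l)] [NeZero l] : DrinfeldDouble k (TaftAlgebra k q l n) :=
  DrinfeldDouble.tmul (chi q l n) (g q l ⟨n - 1, Nat.sub_lt hn Nat.one_pos⟩)

/-- The left ideal `I = D(A) ⟨χ gₙ⟩⁺`, where `A` is the `n`-rank Taft algebra. -/
noncomputable def idealI {k : Type*} [Field k] (q : k) (l n : ℕ) (hn : 0 < n)
    [Fact (IsPrimitiveRoot q l)] [NeZero l] : Ideal (DrinfeldDouble k (TaftAlgebra k q l n)) :=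
  augmentationIdeal k (chiG q l n hn)

end TaftAlgebra

/-!
Write `A` for the Taft algebra, `D(A)` for its double, and `z = χ gₙ`.

The commutation rule of a double is symmetric: `∑ h₁ (f ↼ h₂) = ∑ (h₁ ⇀ f) h₂`
(`DrinfeldDouble.crossR_comul`). Almost everything about doubles is read off from it. The axioms of
an `R`-matrix for `R = ∑ eᵢ ⊗ eⁱ` reduce to it when elements of `B ⊗ H^*` are regarded as maps
`H → B`; such axioms pass to quotients.

The element `z` is a central grouplike of order `l`, because `gₙ xᵢ = q xᵢ gₙ` for *all* `i`; this
is condition `comm` of `DrinfeldDouble.IsCentralPair`. Hence `D(A)⟨z⟩⁺` is the annihilator of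
`1 + z + ⋯ + z ^ (l - 1)`, which makes it a two-sided Hopf ideal. The linear automorphism
`τ : h f ↦ (∑ h₁ χ(h₂)) (f ↼ gₙ)` of `D(A)` satisfies `τ(d z) = χ(gₙ)² τ(d) z`, and
`χ(gₙ)² = q²` is a primitive `l`-th root of unity since `l` is odd. This has two consequences.

* All `z ^ i` with `0 < i < l` act on `D(A)` with trace zero, so that the quotient has dimension
  `dim D(A) / l`.
* The Drinfeld map `a ↦ (a ⊗ id)(R₂₁ R)` of the double is injective, and it sends functionals that
  factor through the quotient to `τ`-invariant elements. The ideal contains no nonzero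
  `τ`-invariant element, so the Drinfeld map of the quotient is injective as well.

To compute `dim A = l ^ (2 n)` and to find generators of `A^*`, consider for each `i` the
skew-primitive functional `ξᵢ` dual to `xᵢ`. It gives a `q`-derivative `∂ᵢ` of `A`, and the
characters give translations of `A`. The monomials `x^a g^b` are joint eigenvectors of the
translations, with distinct eigenvalues, and iterated `q`-derivatives reduce them to grouplike
elements. Therefore they are linearly independent modulo every subspace of `ker ε` that is stable
under these operators (`TaftAlgebra.coeff_eq_zero_of_sum_mem`). For the zero subspace this gives the
dimension; for the annihilator of the subalgebra generated by the `ξᵢ` and the characters it shows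
that this subalgebra is `A^*`. So `D(A)` and its quotients are generated by grouplike and
skew-primitive elements, and such bialgebras are pointed
(`PointedCoalgebra.isPointedCoalgebra_of_adjoin`).

For `n = 1` the quotient is generated by `x`, `ξ` and `χ = g⁻¹`, and the commutation rule reads
`x ξ + g = χ + ξ x`. So `E ↦ -(p - p⁻¹)⁻¹ ξ`, `F ↦ x`, `K ↦ χ` defines a surjection from `u_p(sl₂)`,
which is spanned by `l ^ 3` monomials; as the quotient has dimension `l ^ 3`, it is bijective.
-/

/-! ### The commutation rule of the Drinfeld double -/

namespace DrinfeldDouble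

open DualCop WithConv ConvTwist

variable {k H : Type*} [Field k] [Ring H] [HopfAlgebra k H] [Module.Finite k H]
    [HasBijectiveAntipode k H]

/-- The identification of the double with the tensor product that underlies it. -/
noncomputable def ofTensor (k H : Type*) [Field k] [Ring H] [HopfAlgebra k H] :
    DualCop k H ⊗[k] H ≃ₗ[k] DrinfeldDouble k H :=
  LinearEquiv.refl k (DualCop k H ⊗[k] H)

theorem ofTensor_tmul (f : DualCop k H) (h : H) :
    ofTensor k H (f ⊗ₜ h) = inclDual k H f * inclH k H h :=
  (inclDual_mul_inclH f h).symm

theorem inclH_mul_inclDual (h : H) (f : DualCop k H) :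
    inclH k H h * inclDual k H f = ofTensor k H (exchange k H (h ⊗ₜ f)) := by
  have : mulMap k H ((1 ⊗ₜ h) ⊗ₜ (f ⊗ₜ 1)) = exchange k H (h ⊗ₜ f) := by
    rw [mulMap_tmul]
    change 1 * (exchange k H (h ⊗ₜ f) * 1) = _
    rw [one_mul, mul_one]
  exact this

/-- For `f` fixed, the map `a ⊗ b ↦ a (f ↼ b)` to the double. -/
noncomputable def crossR (f : DualCop k H) : H ⊗[k] H →ₗ[k] DrinfeldDouble k H :=
  LinearMap.mul' k _ ∘ₗ TensorProduct.map (inclH k H).toLinearMap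
    ((inclDual k H).toLinearMap ∘ₗ (hitR k H).flip f)

/-- For `f` fixed, the map `a ⊗ b ↦ (a ⇀ f) b` to the double. -/
noncomputable def crossL (f : DualCop k H) : H ⊗[k] H →ₗ[k] DrinfeldDouble k H :=
  LinearMap.mul' k _ ∘ₗ TensorProduct.map ((inclDual k H).toLinearMap ∘ₗ (hitL k H).flip f)
    (inclH k H).toLinearMap

theorem crossR_tmul (f : DualCop k H) (a b : H) :
    crossR f (a ⊗ₜ b) = inclH k H a * inclDual k H (hitR k H b f) := rfl

theorem crossL_tmul (f : DualCop k H) (a b : H) :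
    crossL f (a ⊗ₜ b) = inclDual k H (hitL k H a f) * inclH k H b := rfl

/-- The commutation relation `∑ h₁ (f ↼ h₂) = ∑ (h₁ ⇀ f) h₂` between the two halves of the double.
It is the defining exchange rule, with the antipode moved to the other side. -/
theorem crossR_comul (f : DualCop k H) (h : H) :
    crossR f (Coalgebra.comul h) = crossL f (Coalgebra.comul h) := by
  have key : eta (DualCop k H ⊗[k] H) (ev k H) *
      toConv (TensorProduct.comm k H (DualCop k H)).toLinearMap =
      toConv (exchange k H) * eta (DualCop k H ⊗[k] H) (ev k H) := by
    rw [← exchange_eq, mul_assoc _ _ (eta _ (ev k H)), ← eta_mul, evInv_mul_ev, eta_one, mul_one]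
  have key2 := congrArg ofConv key
  rw [eta_mul_apply, mul_eta_apply] at key2
  have key3 := LinearMap.congr_fun key2 (h ⊗ₜ[k] f)
  simp only [LinearMap.comp_apply, LinearEquiv.coe_coe, TensorProduct.comul_tmul] at key3
  have e1 : ∀ t : H ⊗[k] H, ofTensor k H (TensorProduct.lid k _ (TensorProduct.map
      (ev k H).ofConv (TensorProduct.comm k H (DualCop k H)).toLinearMap
      (TensorProduct.tensorTensorTensorComm k H H (DualCop k H) (DualCop k H)
        (t ⊗ₜ Coalgebra.comul f)))) = crossL f t := by
    intro t
    induction t with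
    | zero => rw [TensorProduct.zero_tmul]; simp only [map_zero]
    | add x y hx hy => rw [TensorProduct.add_tmul]; simp only [map_add, hx, hy]
    | tmul a b =>
      rw [crossL_tmul, ← ofTensor_tmul]
      exact congrArg (ofTensor k H) (contract_left_map LinearMap.id _ a b f)
  have e2 : ∀ t : H ⊗[k] H, ofTensor k H (TensorProduct.rid k _ (TensorProduct.map
      (exchange k H) (ev k H).ofConv
      (TensorProduct.tensorTensorTensorComm k H H (DualCop k H) (DualCop k H)
        (t ⊗ₜ Coalgebra.comul f)))) = crossR f t := by
    intro t
    induction t with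
    | zero => rw [TensorProduct.zero_tmul]; simp only [map_zero]
    | add x y hx hy => rw [TensorProduct.add_tmul]; simp only [map_add, hx, hy]
    | tmul a b =>
      rw [crossR_tmul, inclH_mul_inclDual]
      exact congrArg (ofTensor k H) (contract_right_map LinearMap.id _ a b f)
  exact (e2 _).symm.trans ((congrArg (ofTensor k H) key3.symm).trans (e1 _))

theorem comul_inclH (h : H) : Coalgebra.comul (R := k) (inclH k H h) =
    TensorProduct.map (inclH k H).toLinearMap (inclH k H).toLinearMap (Coalgebra.comul h) := by
  have : Coalgebra.comul (R := k) ((1 : DualCop k H) ⊗ₜ[k] h) =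
      TensorProduct.map (TensorProduct.mk k (DualCop k H) H 1)
        (TensorProduct.mk k (DualCop k H) H 1) (Coalgebra.comul h) := by
    rw [TensorProduct.comul_tmul, Bialgebra.comul_one, Algebra.TensorProduct.one_def]
    generalize (Coalgebra.comul h : H ⊗[k] H) = t
    induction t with
    | zero => simp
    | add x y hx hy => simp only [map_add, TensorProduct.tmul_add, hx, hy]
    | tmul a b => simp
  exact this

theorem comul_inclDual (f : DualCop k H) : Coalgebra.comul (R := k) (inclDual k H f) =
    TensorProduct.map (inclDual k H).toLinearMap (inclDual k H).toLinearMap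
      (Coalgebra.comul f) := by
  have : Coalgebra.comul (R := k) (f ⊗ₜ[k] (1 : H)) =
      TensorProduct.map ((TensorProduct.mk k (DualCop k H) H).flip 1)
        ((TensorProduct.mk k (DualCop k H) H).flip 1) (Coalgebra.comul f) := by
    rw [TensorProduct.comul_tmul, Bialgebra.comul_one, Algebra.TensorProduct.one_def]
    generalize (Coalgebra.comul f : DualCop k H ⊗[k] DualCop k H) = t
    induction t with
    | zero => simp
    | add x y hx hy => simp only [map_add, TensorProduct.add_tmul, hx, hy]
    | tmul a b => simp
  exact this

theorem counit_inclH (h : H) :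
    Coalgebra.counit (R := k) (inclH k H h) = Coalgebra.counit (R := k) h := by
  rw [inclH_apply, counit_tmul, Bialgebra.counit_one, one_mul]

theorem counit_inclDual (f : DualCop k H) :
    Coalgebra.counit (R := k) (inclDual k H f) = Coalgebra.counit (R := k) f := by
  rw [inclDual_apply, counit_tmul, Bialgebra.counit_one, mul_one]

/-- The double is spanned by the products `f h`. -/
theorem induction_mul {p : DrinfeldDouble k H → Prop} (h0 : p 0)
    (hadd : ∀ x y, p x → p y → p (x + y))
    (hmul : ∀ f h, p (inclDual k H f * inclH k H h)) (d : DrinfeldDouble k H) : p d := by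
  have : ∀ d : DualCop k H ⊗[k] H, p d := by
    intro d
    induction d with
    | zero => exact h0
    | add x y hx hy => exact hadd x y hx hy
    | tmul f h => have := hmul f h; rw [inclDual_mul_inclH] at this; exact this
  exact this d

/-- Evaluation of the second factor, `b ⊗ f ↦ (h ↦ f(h) b)`. -/
noncomputable def evalR (k H B : Type*) [Field k] [Ring H] [HopfAlgebra k H] [AddCommGroup B]
    [Module k B] : B ⊗[k] DualCop k H →ₗ[k] H →ₗ[k] B :=
  dualTensorHom k H B ∘ₗ (TensorProduct.congr (toDual k H) (LinearEquiv.refl k B)).toLinearMap ∘ₗ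
    (TensorProduct.comm k B (DualCop k H)).toLinearMap

section evalR

variable {B : Type*} [AddCommGroup B] [Module k B]

omit [Module.Finite k H] [HasBijectiveAntipode k H] in
theorem evalR_tmul (b : B) (f : DualCop k H) (h : H) :
    evalR k H B (b ⊗ₜ f) h = toDual k H f h • b := by
  simp [evalR]

omit [HasBijectiveAntipode k H] in
theorem evalR_injective : Function.Injective (evalR k H B) := by
  have h : Function.Injective (dualTensorHom k H B) :=
    (dualTensorHomEquiv k H B).injective
  exact h.comp (((TensorProduct.congr (toDual k H) (LinearEquiv.refl k B)).injective).comp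
    (TensorProduct.comm k B (DualCop k H)).injective)

omit [Module.Finite k H] [HasBijectiveAntipode k H] in
theorem evalR_map {B' : Type*} [AddCommGroup B'] [Module k B'] (φ : B →ₗ[k] B')
    (t : B ⊗[k] DualCop k H) (h : H) :
    evalR k H B' (φ.rTensor _ t) h = φ (evalR k H B t h) := by
  induction t with
  | zero => simp
  | add x y hx hy => simp only [map_add, LinearMap.add_apply, hx, hy]
  | tmul b f => simp [evalR_tmul]

end evalR

/-- The canonical element `∑ eᵢ ⊗ eⁱ` of `H ⊗ H^*`. -/
noncomputable def coev (k H : Type*) [Field k] [Ring H] [HopfAlgebra k H] [Module.Finite k H] :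
    H ⊗[k] DualCop k H :=
  (toDual k H).symm.toLinearMap.lTensor H (coevaluation k H 1)

omit [HasBijectiveAntipode k H] in
theorem evalR_coev (h : H) : evalR k H H (coev k H) h = h := by
  rw [coev, coevaluation_apply_one]
  simp only [map_sum, LinearMap.lTensor_tmul, LinearMap.sum_apply]
  conv_rhs => rw [← (Module.Basis.ofVectorSpace k H).sum_repr h]
  exact Finset.sum_congr rfl fun i _ => evalR_tmul _ _ _

theorem universalR_eq : universalR k H =
    TensorProduct.map (inclH k H).toLinearMap (inclDual k H).toLinearMap (coev k H) := by
  rw [universalR, coev, LinearMap.lTensor, TensorProduct.map_map, LinearMap.comp_id]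

end DrinfeldDouble

/-! ### The universal `R`-matrix -/

namespace DrinfeldDouble

open DualCop WithConv ConvTwist

variable {k H : Type*} [Field k] [Ring H] [HopfAlgebra k H] [Module.Finite k H]
    [HasBijectiveAntipode k H]

section evalR

variable {B : Type*} [Ring B] [Algebra k B]

omit [Module.Finite k H] [HasBijectiveAntipode k H] in
theorem evalR_mul (s t : B ⊗[k] DualCop k H) (h : H) : evalR k H B (s * t) h =
    LinearMap.mul' k B (TensorProduct.map (evalR k H B s) (evalR k H B t)
      (Coalgebra.comul h)) := by
  induction s with
  | zero => simp
  | add x y hx hy =>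
    simp only [add_mul, map_add, LinearMap.add_apply, hx, hy, TensorProduct.map_add_left]
  | tmul b f =>
    induction t with
    | zero => simp
    | add x y hx hy =>
      simp only [mul_add, map_add, LinearMap.add_apply, hx, hy, TensorProduct.map_add_right]
    | tmul b' f' =>
      rw [Algebra.TensorProduct.tmul_mul_tmul, evalR_tmul, DualCop.toDual_mul]
      generalize (Coalgebra.comul h : H ⊗[k] H) = u
      induction u with
      | zero => simp
      | add x y hx hy => simp only [map_add, add_smul, hx, hy]
      | tmul a a' => simp only [TensorProduct.map_tmul, LinearMap.mul'_apply, evalR_tmul,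
          smul_mul_smul_comm]

omit [Module.Finite k H] [HasBijectiveAntipode k H] in
theorem evalR_one (h : H) :
    evalR k H B 1 h = algebraMap k B (Coalgebra.counit h) := by
  rw [Algebra.TensorProduct.one_def, evalR_tmul, DualCop.toDual_one, Algebra.algebraMap_eq_smul_one]

end evalR

/-- The `R`-matrix with its second factor still in the dual. -/
noncomputable def halfR (k H : Type*) [Field k] [Ring H] [HopfAlgebra k H] [Module.Finite k H]
    [HasBijectiveAntipode k H] : DrinfeldDouble k H ⊗[k] DualCop k H :=
  (inclH k H).toLinearMap.rTensor _ (coev k H)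

theorem evalR_halfR (h : H) : evalR k H _ (halfR k H) h = inclH k H h := by
  rw [halfR, evalR_map, evalR_coev]; rfl

/-- The embedding of the second factor. -/
noncomputable def inclSnd (k H B : Type*) [Field k] [Ring H] [HopfAlgebra k H] [Module.Finite k H]
    [HasBijectiveAntipode k H] [Ring B] [Algebra k B] :
    B ⊗[k] DualCop k H →ₐ[k] B ⊗[k] DrinfeldDouble k H :=
  Algebra.TensorProduct.map (AlgHom.id k B) (inclDual k H)

theorem inclSnd_tmul {B : Type*} [Ring B] [Algebra k B] (b : B) (f : DualCop k H) :
    inclSnd k H B (b ⊗ₜ f) = b ⊗ₜ inclDual k H f := rfl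

theorem inclSnd_halfR : inclSnd k H _ (halfR k H) = universalR k H := by
  rw [universalR_eq, halfR]
  generalize coev k H = t
  induction t with
  | zero => simp
  | add x y hx hy => simp only [map_add, hx, hy]
  | tmul a f => simp [inclSnd_tmul]

/-- The inverse of `R` is `∑ S(eᵢ) ⊗ eⁱ`: as maps `H → D`, the two are convolution inverse. -/
theorem isUnit_universalR : IsUnit (universalR k H) := by
  have h1 : ∀ s : H →ₗ[k] H, ∀ h, evalR k H (DrinfeldDouble k H)
      (((inclH k H).toLinearMap ∘ₗ s).rTensor _ (coev k H)) h = inclH k H (s h) := fun s h => by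
    rw [evalR_map, evalR_coev]; rfl
  have h2 : ∀ t : H ⊗[k] H, LinearMap.mul' k (DrinfeldDouble k H)
      (TensorProduct.map (inclH k H).toLinearMap (inclH k H).toLinearMap t) =
      inclH k H (LinearMap.mul' k H t) := fun t => by
    induction t with
    | zero => simp
    | add x y hx hy => simp only [map_add, hx, hy]
    | tmul a b => simp
  have h3 : ∀ (s s' : H →ₗ[k] H) (t : H ⊗[k] H), LinearMap.mul' k (DrinfeldDouble k H)
      (TensorProduct.map ((inclH k H).toLinearMap ∘ₗ s) ((inclH k H).toLinearMap ∘ₗ s') t) =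
      inclH k H (LinearMap.mul' k H (TensorProduct.map s s' t)) := fun s s' t => by
    rw [TensorProduct.map_comp, LinearMap.comp_apply, h2]
  have e0 : evalR k H _ (halfR k H) = (inclH k H).toLinearMap ∘ₗ LinearMap.id :=
    LinearMap.ext evalR_halfR
  have e1 : evalR k H _ (((inclH k H).toLinearMap ∘ₗ HopfAlgebra.antipode k).rTensor _
      (coev k H)) = (inclH k H).toLinearMap ∘ₗ HopfAlgebra.antipode k := LinearMap.ext (h1 _)
  rw [← inclSnd_halfR]
  refine IsUnit.map (inclSnd k H _) ⟨⟨halfR k H, ((inclH k H).toLinearMap ∘ₗ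
    HopfAlgebra.antipode k).rTensor _ (coev k H), ?_, ?_⟩, rfl⟩
  · apply evalR_injective
    ext h
    rw [evalR_mul, e0, e1, evalR_one, h3]
    rw [← AlgHom.commutes (inclH k H)]
    exact congrArg (inclH k H) (HopfAlgebra.mul_antipode_lTensor_comul_apply h)
  · apply evalR_injective
    ext h
    rw [evalR_mul, e0, e1, evalR_one, h3]
    rw [← AlgHom.commutes (inclH k H)]
    exact congrArg (inclH k H) (HopfAlgebra.mul_antipode_rTensor_comul_apply h)

/-- The identity `(Δ ⊗ id)(R) = R₁₃ R₂₃`, before reassociation of the tensor factors. -/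
theorem comul_rTensor_universalR : Coalgebra.comul.rTensor _ (universalR k H) =
    Algebra.TensorProduct.map (Algebra.TensorProduct.includeLeft :
      DrinfeldDouble k H →ₐ[k] DrinfeldDouble k H ⊗[k] DrinfeldDouble k H)
      (AlgHom.id k (DrinfeldDouble k H)) (universalR k H) *
    Algebra.TensorProduct.map (Algebra.TensorProduct.includeRight :
      DrinfeldDouble k H →ₐ[k] DrinfeldDouble k H ⊗[k] DrinfeldDouble k H)
      (AlgHom.id k (DrinfeldDouble k H)) (universalR k H) := by
  have e : ∀ (φ : DrinfeldDouble k H →ₗ[k] DrinfeldDouble k H ⊗[k] DrinfeldDouble k H) t,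
      φ.rTensor _ (inclSnd k H _ t) = inclSnd k H _ (φ.rTensor _ t) := by
    intro φ t
    induction t with
    | zero => simp
    | add x y hx hy => simp only [map_add, hx, hy]
    | tmul a b => simp [inclSnd_tmul]
  rw [← inclSnd_halfR, e]
  refine (congrArg _ ?_).trans ((map_mul (inclSnd k H _) _ _).trans (congrArg₂ _
    (e (Algebra.TensorProduct.includeLeft : DrinfeldDouble k H →ₐ[k] DrinfeldDouble k H ⊗[k]
      DrinfeldDouble k H).toLinearMap _).symm
    (e (Algebra.TensorProduct.includeRight : DrinfeldDouble k H →ₐ[k] DrinfeldDouble k H ⊗[k]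
      DrinfeldDouble k H).toLinearMap _).symm))
  apply evalR_injective
  ext h
  rw [evalR_mul, evalR_map, evalR_halfR, comul_inclH]
  generalize (Coalgebra.comul h : H ⊗[k] H) = t
  induction t with
  | zero => simp
  | add x y hx hy => simp only [map_add, hx, hy]
  | tmul a b => simp [evalR_map, evalR_halfR]

theorem leg₁₃_eq {D : Type*} [Ring D] [Algebra k D] (R : D ⊗[k] D) : leg₁₃ k R =
    TensorProduct.assoc k D D D (Algebra.TensorProduct.map
      (Algebra.TensorProduct.includeLeft : D →ₐ[k] D ⊗[k] D) (AlgHom.id k D) R) := by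
  induction R with
  | zero => simp [leg₁₃]
  | add x y hx hy => simp only [leg₁₃, map_add] at *; rw [hx, hy]
  | tmul a b => simp [leg₁₃]

theorem leg₂₃_eq {D : Type*} [Ring D] [Algebra k D] (R : D ⊗[k] D) : leg₂₃ k R =
    TensorProduct.assoc k D D D (Algebra.TensorProduct.map
      (Algebra.TensorProduct.includeRight : D →ₐ[k] D ⊗[k] D) (AlgHom.id k D) R) := by
  induction R with
  | zero => simp [leg₂₃]
  | add x y hx hy => simp only [leg₂₃, map_add, TensorProduct.tmul_add] at *; rw [hx, hy]
  | tmul a b => simp [leg₂₃]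

theorem comul_left_universalR :
    TensorProduct.assoc k _ _ _ (Coalgebra.comul.rTensor _ (universalR k H)) =
      leg₁₃ k (universalR k H) * leg₂₃ k (universalR k H) := by
  rw [leg₁₃_eq, leg₂₃_eq, comul_rTensor_universalR]
  exact map_mul (Algebra.TensorProduct.assoc k k k (DrinfeldDouble k H) (DrinfeldDouble k H)
    (DrinfeldDouble k H)) _ _

/-- Evaluation `b ⊗ s ↦ s(a ⊗ c) b` of two factors. -/
noncomputable def evalPair (k H B : Type*) [Field k] [Ring H] [HopfAlgebra k H]
    [Module.Finite k H] [AddCommGroup B] [Module k B] :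
    B ⊗[k] (DualCop k H ⊗[k] DualCop k H) →ₗ[k] H ⊗[k] H →ₗ[k] B :=
  dualTensorHom k (H ⊗[k] H) B ∘ₗ
    (TensorProduct.congr (pair k H) (LinearEquiv.refl k B)).toLinearMap ∘ₗ
    (TensorProduct.comm k B (DualCop k H ⊗[k] DualCop k H)).toLinearMap

omit [HasBijectiveAntipode k H] in
theorem evalPair_tmul {B : Type*} [AddCommGroup B] [Module k B] (b : B)
    (s : DualCop k H ⊗[k] DualCop k H) (t : H ⊗[k] H) :
    evalPair k H B (b ⊗ₜ s) t = pair k H s t • b := by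
  simp [evalPair]

omit [HasBijectiveAntipode k H] in
theorem evalPair_injective {B : Type*} [AddCommGroup B] [Module k B] :
    Function.Injective (evalPair k H B) := by
  have h : Function.Injective (dualTensorHom k (H ⊗[k] H) B) :=
    (dualTensorHomEquiv k (H ⊗[k] H) B).injective
  exact h.comp (((TensorProduct.congr (pair k H) (LinearEquiv.refl k B)).injective).comp
    (TensorProduct.comm k B (DualCop k H ⊗[k] DualCop k H)).injective)

theorem comul_right_universalR :
    Coalgebra.comul.lTensor _ (universalR k H) =
      leg₁₃ k (universalR k H) * leg₁₂ k (universalR k H) := by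
  set D := DrinfeldDouble k H
  set j : D ⊗[k] (DualCop k H ⊗[k] DualCop k H) →ₐ[k] D ⊗[k] (D ⊗[k] D) :=
    Algebra.TensorProduct.map (AlgHom.id k D)
      (Algebra.TensorProduct.map (inclDual k H) (inclDual k H)) with hj
  set l3 : D ⊗[k] DualCop k H →ₐ[k] D ⊗[k] (DualCop k H ⊗[k] DualCop k H) :=
    Algebra.TensorProduct.map (AlgHom.id k D) Algebra.TensorProduct.includeRight with hl3
  set l2 : D ⊗[k] DualCop k H →ₐ[k] D ⊗[k] (DualCop k H ⊗[k] DualCop k H) :=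
    Algebra.TensorProduct.map (AlgHom.id k D) Algebra.TensorProduct.includeLeft with hl2
  have e1 : ∀ t : D ⊗[k] DualCop k H, Coalgebra.comul.lTensor _ (inclSnd k H _ t) =
      j (Coalgebra.comul.lTensor _ t) := by
    intro t
    induction t with
    | zero => simp
    | add x y hx hy => simp only [map_add, hx, hy]
    | tmul d f =>
      rw [inclSnd_tmul, LinearMap.lTensor_tmul, LinearMap.lTensor_tmul, comul_inclDual]
      rfl
  have e3 : ∀ t : D ⊗[k] DualCop k H, leg₁₃ k (inclSnd k H _ t) = j (l3 t) := by
    intro t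
    induction t with
    | zero => simp [leg₁₃]
    | add x y hx hy => simp only [leg₁₃, map_add] at *; rw [hx, hy]
    | tmul d f => simp [leg₁₃, inclSnd_tmul, hj, hl3]
  have e2 : ∀ t : D ⊗[k] DualCop k H, leg₁₂ k (inclSnd k H _ t) = j (l2 t) := by
    intro t
    induction t with
    | zero => simp [leg₁₂]
    | add x y hx hy => simp only [leg₁₂, map_add] at *; rw [hx, hy]
    | tmul d f => simp [leg₁₂, inclSnd_tmul, hj, hl2]
  rw [← inclSnd_halfR, e1, e3, e2, ← map_mul]
  congr 1
  apply evalPair_injective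
  apply TensorProduct.ext'
  intro a b
  have f1 : ∀ t : D ⊗[k] DualCop k H, evalPair k H D (Coalgebra.comul.lTensor _ t) (a ⊗ₜ b) =
      evalR k H D t (b * a) := by
    intro t
    induction t with
    | zero => simp
    | add x y hx hy => simp only [map_add, LinearMap.add_apply, hx, hy]
    | tmul d f =>
      rw [LinearMap.lTensor_tmul, evalPair_tmul, evalR_tmul, pair_comul_tmul]
  have f2 : ∀ s t : D ⊗[k] DualCop k H, evalPair k H D (l3 s * l2 t) (a ⊗ₜ b) =
      evalR k H D s b * evalR k H D t a := by
    intro s t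
    induction s with
    | zero => simp
    | add x y hx hy => simp only [map_add, add_mul, LinearMap.add_apply, hx, hy]
    | tmul d f =>
      induction t with
      | zero => simp
      | add x y hx hy => simp only [map_add, mul_add, LinearMap.add_apply, hx, hy]
      | tmul d' f' =>
        simp [hl3, hl2, evalPair_tmul, evalR_tmul, pair_tmul, smul_smul]
  rw [f1, f2, evalR_halfR, evalR_halfR, evalR_halfR, map_mul]

omit [HasBijectiveAntipode k H] in
theorem coev_mul_left (a : H) :
    (LinearMap.mulLeft k a).rTensor _ (coev k H) = (hitR k H a).lTensor _ (coev k H) := by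
  apply evalR_injective
  ext c
  rw [evalR_map, evalR_coev]
  have : ∀ t : H ⊗[k] DualCop k H, evalR k H H ((hitR k H a).lTensor _ t) c =
      evalR k H H t (a * c) := by
    intro t
    induction t with
    | zero => simp
    | add x y hx hy => simp only [map_add, LinearMap.add_apply, hx, hy]
    | tmul b f => rw [LinearMap.lTensor_tmul, evalR_tmul, evalR_tmul, hitR_apply]
  rw [this, evalR_coev]; rfl

omit [HasBijectiveAntipode k H] in
theorem coev_mul_right (a : H) :
    (LinearMap.mulRight k a).rTensor _ (coev k H) = (hitL k H a).lTensor _ (coev k H) := by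
  apply evalR_injective
  ext c
  rw [evalR_map, evalR_coev]
  have : ∀ t : H ⊗[k] DualCop k H, evalR k H H ((hitL k H a).lTensor _ t) c =
      evalR k H H t (c * a) := by
    intro t
    induction t with
    | zero => simp
    | add x y hx hy => simp only [map_add, LinearMap.add_apply, hx, hy]
    | tmul b f => rw [LinearMap.lTensor_tmul, evalR_tmul, evalR_tmul, hitL_apply]
  rw [this, evalR_coev]; rfl

/-- The map `a ⊗ b ↦ (f ↦ a (f ↼ b))`. -/
noncomputable def crossRMap (k H : Type*) [Field k] [Ring H] [HopfAlgebra k H] [Module.Finite k H]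
    [HasBijectiveAntipode k H] : H ⊗[k] H →ₗ[k] DualCop k H →ₗ[k] DrinfeldDouble k H :=
  TensorProduct.lift (LinearMap.mk₂ k
    (fun a b => LinearMap.mulLeft k (inclH k H a) ∘ₗ (inclDual k H).toLinearMap ∘ₗ hitR k H b)
    (fun a b c => by ext; simp [add_mul]) (fun r a b => by ext; simp)
    (fun a b c => by ext; simp [mul_add]) (fun r a b => by ext; simp))

/-- The map `a ⊗ b ↦ (f ↦ (a ⇀ f) b)`. -/
noncomputable def crossLMap (k H : Type*) [Field k] [Ring H] [HopfAlgebra k H] [Module.Finite k H]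
    [HasBijectiveAntipode k H] : H ⊗[k] H →ₗ[k] DualCop k H →ₗ[k] DrinfeldDouble k H :=
  TensorProduct.lift (LinearMap.mk₂ k
    (fun a b => LinearMap.mulRight k (inclH k H b) ∘ₗ (inclDual k H).toLinearMap ∘ₗ hitL k H a)
    (fun a b c => by ext; simp [add_mul]) (fun r a b => by ext; simp)
    (fun a b c => by ext; simp [mul_add]) (fun r a b => by ext; simp))

theorem crossRMap_apply (t : H ⊗[k] H) (f : DualCop k H) : crossRMap k H t f = crossR f t := by
  induction t with
  | zero => simp
  | add x y hx hy => simp only [map_add, LinearMap.add_apply, hx, hy]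
  | tmul a b => rfl

theorem crossLMap_apply (t : H ⊗[k] H) (f : DualCop k H) : crossLMap k H t f = crossL f t := by
  induction t with
  | zero => simp
  | add x y hx hy => simp only [map_add, LinearMap.add_apply, hx, hy]
  | tmul a b => rfl

theorem comul_op_universalR_inclH (h : H) :
    TensorProduct.comm k _ _ (Coalgebra.comul (inclH k H h)) * universalR k H =
      universalR k H * Coalgebra.comul (inclH k H h) := by
  have h1 : ∀ t : H ⊗[k] H, TensorProduct.comm k _ _ (TensorProduct.map (inclH k H).toLinearMap
      (inclH k H).toLinearMap t) * universalR k H =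
      TensorProduct.map (inclH k H).toLinearMap (crossRMap k H t) (coev k H) := by
    intro t
    induction t with
    | zero => simp
    | add x y hx hy => simp only [map_add, add_mul, hx, hy, TensorProduct.map_add_right,
        LinearMap.add_apply]
    | tmul a b =>
      have e : ∀ s, (inclH k H b ⊗ₜ inclH k H a) *
          TensorProduct.map (inclH k H).toLinearMap (inclDual k H).toLinearMap s =
          TensorProduct.map (inclH k H).toLinearMap
            (LinearMap.mulLeft k (inclH k H a) ∘ₗ (inclDual k H).toLinearMap)
            ((LinearMap.mulLeft k b).rTensor _ s) := by
        intro s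
        induction s with
        | zero => simp
        | add x y hx hy => simp only [map_add, mul_add, hx, hy]
        | tmul c f => simp
      rw [universalR_eq, TensorProduct.map_tmul, TensorProduct.comm_tmul]
      refine (e _).trans ?_
      rw [coev_mul_left, LinearMap.lTensor, TensorProduct.map_map]
      rfl
  have h2 : ∀ t : H ⊗[k] H, universalR k H * TensorProduct.map (inclH k H).toLinearMap
      (inclH k H).toLinearMap t =
      TensorProduct.map (inclH k H).toLinearMap (crossLMap k H t) (coev k H) := by
    intro t
    induction t with
    | zero => simp
    | add x y hx hy => simp only [map_add, mul_add, hx, hy, TensorProduct.map_add_right,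
        LinearMap.add_apply]
    | tmul a b =>
      have e : ∀ s, TensorProduct.map (inclH k H).toLinearMap (inclDual k H).toLinearMap s *
          (inclH k H a ⊗ₜ inclH k H b) =
          TensorProduct.map (inclH k H).toLinearMap
            (LinearMap.mulRight k (inclH k H b) ∘ₗ (inclDual k H).toLinearMap)
            ((LinearMap.mulRight k a).rTensor _ s) := by
        intro s
        induction s with
        | zero => simp
        | add x y hx hy => simp only [map_add, add_mul, hx, hy]
        | tmul c f => simp
      rw [universalR_eq, TensorProduct.map_tmul]
      refine (e _).trans ?_
      rw [coev_mul_right, LinearMap.lTensor, TensorProduct.map_map]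
      rfl
  rw [comul_inclH, h1, h2]
  congr 2
  ext f
  rw [crossRMap_apply, crossLMap_apply, crossR_comul]

theorem comul_op_universalR_inclDual (f : DualCop k H) :
    TensorProduct.comm k _ _ (Coalgebra.comul (inclDual k H f)) * universalR k H =
      universalR k H * Coalgebra.comul (inclDual k H f) := by
  set D := DrinfeldDouble k H
  set j : DualCop k H ⊗[k] DualCop k H →ₐ[k] D ⊗[k] DualCop k H :=
    Algebra.TensorProduct.map (inclDual k H) (AlgHom.id k _) with hj
  have e1 : ∀ s : DualCop k H ⊗[k] DualCop k H, TensorProduct.map (inclDual k H).toLinearMap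
      (inclDual k H).toLinearMap s = inclSnd k H _ (j s) := by
    intro s
    induction s with
    | zero => simp
    | add x y hx hy => simp only [map_add, hx, hy]
    | tmul f g => rfl
  have e2 : ∀ (s : DualCop k H ⊗[k] DualCop k H), TensorProduct.comm k _ _
      (TensorProduct.map (inclDual k H).toLinearMap (inclDual k H).toLinearMap s) =
      inclSnd k H _ (j (TensorProduct.comm k _ _ s)) := by
    intro s
    rw [← e1]
    induction s with
    | zero => simp
    | add x y hx hy => simp only [map_add, hx, hy]
    | tmul f g => rfl
  rw [comul_inclDual, e2, e1, ← inclSnd_halfR, ← map_mul, ← map_mul]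
  congr 1
  apply evalR_injective
  ext c
  have h0 : evalR k H _ (halfR k H) = (inclH k H).toLinearMap := LinearMap.ext evalR_halfR
  have h1 : ∀ a, evalR k H D (j (TensorProduct.comm k _ _ (Coalgebra.comul f))) a =
      inclDual k H (hitL k H a f) := by
    intro a
    rw [← contract_left]
    generalize (Coalgebra.comul f : DualCop k H ⊗[k] DualCop k H) = s
    induction s with
    | zero => simp
    | add x y hx hy => simp only [map_add, LinearMap.add_apply, hx, hy]
    | tmul f g => simp [hj, evalR_tmul]
  have h2 : ∀ a, evalR k H D (j (Coalgebra.comul f)) a = inclDual k H (hitR k H a f) := by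
    intro a
    rw [← contract_right]
    generalize (Coalgebra.comul f : DualCop k H ⊗[k] DualCop k H) = s
    induction s with
    | zero => simp
    | add x y hx hy => simp only [map_add, LinearMap.add_apply, hx, hy]
    | tmul f g => simp [hj, evalR_tmul]
  rw [evalR_mul, evalR_mul, h0]
  have h3 := crossR_comul f c
  rw [show evalR k H D (j (TensorProduct.comm k _ _ (Coalgebra.comul f))) =
    (inclDual k H).toLinearMap ∘ₗ (hitL k H).flip f from LinearMap.ext h1,
    show evalR k H D (j (Coalgebra.comul f)) =
    (inclDual k H).toLinearMap ∘ₗ (hitR k H).flip f from LinearMap.ext h2]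
  exact h3.symm

theorem isQuasitriangular_universalR :
    IsQuasitriangular k (DrinfeldDouble k H) (universalR k H) where
  isUnit := isUnit_universalR
  comul_left := comul_left_universalR
  comul_right := comul_right_universalR
  comul_op d := by
    induction d using induction_mul with
    | h0 => simp
    | hadd x y hx hy => simp only [map_add, add_mul, mul_add, hx, hy]
    | hmul f h =>
      have e : ∀ s t : DrinfeldDouble k H ⊗[k] DrinfeldDouble k H,
          TensorProduct.comm k _ _ (s * t) =
            TensorProduct.comm k _ _ s * TensorProduct.comm k _ _ t :=
        map_mul (Algebra.TensorProduct.comm k (DrinfeldDouble k H) (DrinfeldDouble k H))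
      rw [Bialgebra.comul_mul, e, mul_assoc, comul_op_universalR_inclH, ← mul_assoc,
        comul_op_universalR_inclDual, mul_assoc]

end DrinfeldDouble

/-- The image of an `R`-matrix under a surjective map of Hopf algebras is an `R`-matrix. -/
theorem IsQuasitriangular.map {k H Q : Type*} [Field k] [Ring H] [HopfAlgebra k H] [Ring Q]
    [HopfAlgebra k Q] {R : H ⊗[k] H} (hR : IsQuasitriangular k H R) (π : H →ₐc[k] Q)
    (hπ : Function.Surjective π) :
    IsQuasitriangular k Q
      (TensorProduct.map (π : H →ₗ[k] Q) (π : H →ₗ[k] Q) R) := by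
  set P : H ⊗[k] H →ₐ[k] Q ⊗[k] Q :=
    Algebra.TensorProduct.map (π : H →ₐ[k] Q) (π : H →ₐ[k] Q) with hP
  set P3 : H ⊗[k] (H ⊗[k] H) →ₐ[k] Q ⊗[k] (Q ⊗[k] Q) :=
    Algebra.TensorProduct.map (π : H →ₐ[k] Q) P with hP3
  have hPR : TensorProduct.map (π : H →ₗ[k] Q) (π : H →ₗ[k] Q) R = P R := rfl
  have hcom : ∀ h, Coalgebra.comul (R := k) (π h) = P (Coalgebra.comul h) := fun h =>
    (CoalgHomClass.map_comp_comul_apply π h).symm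
  have l3 : ∀ S, leg₁₃ k (P S) = P3 (leg₁₃ k S) := by
    intro S
    induction S with
    | zero => simp [leg₁₃]
    | add x y hx hy => simp only [leg₁₃, map_add] at *; rw [hx, hy]
    | tmul a b => simp [leg₁₃, hP, hP3]
  have l2 : ∀ S, leg₁₂ k (P S) = P3 (leg₁₂ k S) := by
    intro S
    induction S with
    | zero => simp [leg₁₂]
    | add x y hx hy => simp only [leg₁₂, map_add] at *; rw [hx, hy]
    | tmul a b => simp [leg₁₂, hP, hP3]
  have l1 : ∀ S, leg₂₃ k (P S) = P3 (leg₂₃ k S) := by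
    intro S
    simp [leg₂₃, hP3]
  have ha : ∀ s : (H ⊗[k] H) ⊗[k] H, TensorProduct.assoc k Q Q Q
      (TensorProduct.map P.toLinearMap (π : H →ₗ[k] Q) s) =
      P3 (TensorProduct.assoc k H H H s) := by
    intro s
    induction s with
    | zero => simp
    | add x y hx hy => simp only [map_add, hx, hy]
    | tmul a b =>
      induction a with
      | zero => simp
      | add x y hx hy => simp only [map_add, TensorProduct.add_tmul, hx, hy]
      | tmul a c => simp [hP, hP3]
  have hc1 : ∀ S, Coalgebra.comul.rTensor Q (P S) =
      TensorProduct.map P.toLinearMap (π : H →ₗ[k] Q) (Coalgebra.comul.rTensor H S) := by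
    intro S
    induction S with
    | zero => simp
    | add x y hx hy => simp only [map_add, hx, hy]
    | tmul a b => exact congrArg (· ⊗ₜ[k] π b) (hcom a)
  have hc2 : ∀ S, Coalgebra.comul.lTensor Q (P S) = P3 (Coalgebra.comul.lTensor H S) := by
    intro S
    induction S with
    | zero => simp
    | add x y hx hy => simp only [map_add, hx, hy]
    | tmul a b => simp [hP, hP3, hcom]
  have hcm : ∀ S, TensorProduct.comm k Q Q (P S) = P (TensorProduct.comm k H H S) := by
    intro S
    induction S with
    | zero => simp
    | add x y hx hy => simp only [map_add, hx, hy]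
    | tmul a b => simp [hP]
  rw [hPR]
  refine ⟨hR.isUnit.map P, ?_, ?_, ?_⟩
  · rw [hc1, ha, hR.comul_left, l3, l1, map_mul]
  · rw [hc2, hR.comul_right, l3, l2, map_mul]
  · intro h
    obtain ⟨h, rfl⟩ := hπ h
    rw [hcom, hcm, ← map_mul, hR.comul_op, map_mul]

/-! ### Quotients by central grouplike elements -/

/-- A central grouplike element `z` with `z ^ l = 1`, where `l` is invertible in `k`. -/
structure IsCentralGroupLike (k : Type*) {D : Type*} [Field k] [Ring D] [HopfAlgebra k D] (z : D)
    (l : ℕ) : Prop where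
  groupLike : IsGroupLikeElem k z
  comm : ∀ d, d * z = z * d
  pow_eq_one : z ^ l = 1
  ne_zero : (l : k) ≠ 0

namespace IsCentralGroupLike

open HopfAlgebra

variable {k D : Type*} [Field k] [Ring D] [HopfAlgebra k D] {z : D} {l : ℕ}

/-- The sum of the powers of `z`. -/
def powSum (z : D) (l : ℕ) : D := ∑ i ∈ Finset.range l, z ^ i

theorem powSum_comm (hz : IsCentralGroupLike k z l) (d : D) :
    d * powSum z l = powSum z l * d := by
  have h : Commute d z := hz.comm d
  exact Commute.sum_right _ _ _ fun i _ => h.pow_right i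

theorem mul_powSum (hz : IsCentralGroupLike k z l) : z * powSum z l = powSum z l := by
  have h1 : (z - 1) * powSum z l = 0 := by
    rw [powSum, mul_geom_sum, hz.pow_eq_one, sub_self]
  rwa [sub_mul, one_mul, sub_eq_zero] at h1

theorem pow_mul_powSum (hz : IsCentralGroupLike k z l) (i : ℕ) :
    z ^ i * powSum z l = powSum z l := by
  induction i with
  | zero => simp
  | succ i ih => rw [pow_succ, mul_assoc, hz.mul_powSum, ih]

theorem counit_pow (hz : IsCentralGroupLike k z l) (i : ℕ) :
    Coalgebra.counit (R := k) (z ^ i) = 1 := (hz.groupLike.pow).counit_eq_one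

theorem powSum_mul_powSum (hz : IsCentralGroupLike k z l) :
    powSum z l * powSum z l = (l : k) • powSum z l := by
  conv_lhs => enter [1]; rw [powSum]
  rw [Finset.sum_mul, Finset.sum_congr rfl fun i _ => hz.pow_mul_powSum i]
  simp [Nat.cast_smul_eq_nsmul]

theorem smul_eq (z : D) (l : ℕ) (d : D) :
    (l : k) • d = d * powSum z l + ∑ i ∈ Finset.range l, d * (1 - z ^ i) := by
  simp only [mul_sub, mul_one, Finset.sum_sub_distrib, powSum, Finset.mul_sum]
  simp [Nat.cast_smul_eq_nsmul]

theorem sub_pow_mem_augmentationIdeal (hz : IsCentralGroupLike k z l) (i : ℕ) :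
    1 - z ^ i ∈ augmentationIdeal k z := by
  refine Ideal.subset_span ⟨sub_mem (one_mem _) (pow_mem (Algebra.self_mem_adjoin_singleton k z) i),
    ?_⟩
  rw [map_sub, Bialgebra.counit_one, hz.counit_pow, sub_self]

/-- The augmentation ideal is the annihilator of the sum of the powers of `z`. -/
theorem mem_augmentationIdeal_iff (hz : IsCentralGroupLike k z l) (d : D) :
    d ∈ augmentationIdeal k z ↔ d * powSum z l = 0 := by
  constructor
  · intro h
    induction h using Submodule.span_induction with
    | zero => simp
    | add x y _ _ hx hy => rw [add_mul, hx, hy, add_zero]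
    | smul a x _ hx => rw [smul_eq_mul, mul_assoc, hx, mul_zero]
    | mem y hy =>
      have key : ∀ y ∈ Algebra.adjoin k {z}, y * powSum z l =
          Coalgebra.counit (R := k) y • powSum z l := by
        intro y hy
        induction hy using Algebra.adjoin_induction with
        | mem x hx =>
          rw [Set.mem_singleton_iff.1 hx, hz.mul_powSum, hz.groupLike.counit_eq_one, one_smul]
        | algebraMap r => rw [Bialgebra.counit_algebraMap, Algebra.smul_def]
        | add x y _ _ hx hy => rw [add_mul, hx, hy, map_add, add_smul]
        | mul x y _ _ hx hy =>
          rw [mul_assoc, hy, mul_smul_comm, hx, Bialgebra.counit_mul, smul_smul, mul_comm]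
      rw [key y hy.1, hy.2, zero_smul]
  · intro h
    have h1 := smul_eq (k := k) z l d
    rw [h, zero_add] at h1
    have h2 : d = algebraMap k D (l : k)⁻¹ * ∑ i ∈ Finset.range l, d * (1 - z ^ i) := by
      rw [← h1, ← Algebra.smul_def, smul_smul, inv_mul_cancel₀ hz.ne_zero, one_smul]
    rw [h2]
    exact Ideal.mul_mem_left _ _ (sum_mem fun i _ => Ideal.mul_mem_left _ _
      (hz.sub_pow_mem_augmentationIdeal i))

theorem isTwoSided (hz : IsCentralGroupLike k z l) : (augmentationIdeal k z).IsTwoSided where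
  mul_mem_of_left {a} b ha := by
    rw [hz.mem_augmentationIdeal_iff] at ha ⊢
    rw [mul_assoc, hz.powSum_comm, ← mul_assoc, ha, zero_mul]

theorem isHopfIdeal (hz : IsCentralGroupLike k z l) : (augmentationIdeal k z).IsHopfIdeal k where
  counit_eq_zero d hd := by
    have h := (hz.mem_augmentationIdeal_iff d).1 hd
    have h2 := congrArg (Coalgebra.counit (R := k)) h
    rw [Bialgebra.counit_mul, powSum, map_sum, map_zero,
      Finset.sum_congr rfl fun i _ => hz.counit_pow i] at h2
    simpa [hz.ne_zero] using h2
  map_mkQ_comul_eq_zero d hd := by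
    have := hz.isTwoSided
    set I := augmentationIdeal k z
    set π := Ideal.Quotient.mkₐ k I
    have hπ : ∀ i, π (z ^ i) = 1 := fun i => by
      have : π (1 - z ^ i) = 0 :=
        Ideal.Quotient.eq_zero_iff_mem.2 (hz.sub_pow_mem_augmentationIdeal i)
      rw [map_sub, map_one, sub_eq_zero] at this
      exact this.symm
    set P : D ⊗[k] D →ₐ[k] (D ⧸ I) ⊗[k] (D ⧸ I) := Algebra.TensorProduct.map π π with hP
    have h0 : ∀ i d, P (Coalgebra.comul (d * (1 - z ^ i))) = 0 := by
      intro i d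
      rw [Bialgebra.comul_mul, map_mul, map_sub, Bialgebra.comul_one,
        (hz.groupLike.pow).comul_eq_tmul_self, map_sub, map_one, hP, Algebra.TensorProduct.map_tmul,
        hπ, ← Algebra.TensorProduct.one_def, sub_self, mul_zero]
    have h1 := smul_eq (k := k) z l d
    rw [(hz.mem_augmentationIdeal_iff d).1 hd, zero_add] at h1
    have h2 : (l : k) • P (Coalgebra.comul d) = 0 := by
      rw [← map_smul, ← map_smul, h1, map_sum, map_sum, Finset.sum_eq_zero fun i _ => h0 i d]
    exact (smul_eq_zero.1 h2).resolve_left hz.ne_zero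
  antipode_mem d hd := by
    rw [hz.mem_augmentationIdeal_iff] at hd ⊢
    have h1 : antipode k z * powSum z l = powSum z l := by
      conv_lhs => rw [← hz.mul_powSum]
      rw [← mul_assoc, hz.groupLike.antipode_mul_cancel, one_mul]
    have h2 : ∀ i, antipode k (z ^ i) * powSum z l = powSum z l := by
      intro i
      induction i with
      | zero => rw [pow_zero, antipode_one, one_mul]
      | succ i ih => rw [pow_succ, antipode_mul_antidistrib, mul_assoc, ih, h1]
    have h3 : antipode k (powSum z l) * powSum z l = (l : k) • powSum z l := by
      conv_lhs => enter [1]; rw [powSum]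
      rw [map_sum, Finset.sum_mul, Finset.sum_congr rfl fun i _ => h2 i]
      simp [Nat.cast_smul_eq_nsmul]
    have h4 : (l : k) • (antipode k d * powSum z l) = 0 := by
      rw [← mul_smul_comm, ← h3, ← mul_assoc, ← antipode_mul_antidistrib, ← hz.powSum_comm, hd,
        map_zero, zero_mul]
    exact (smul_eq_zero.1 h4).resolve_left hz.ne_zero

/-- If a linear automorphism `τ` satisfies `τ(d z) = c τ(d) z` for a primitive `l`-th root of unity
`c`, then the quotient has `l` times smaller dimension: the projection onto the `z`-invariants has
trace `dim D / l`, since `τ` conjugates multiplication by `z ^ i` to `c ^ i` times itself, which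
forces its trace to vanish for `0 < i < l`. -/
theorem finrank_quotient [CharZero k] [Module.Finite k D] (hz : IsCentralGroupLike k z l)
    {c : k} (hc : IsPrimitiveRoot c l) (τ : D ≃ₗ[k] D) (hτ : ∀ d, τ (d * z) = c • (τ d * z)) :
    Module.finrank k (D ⧸ augmentationIdeal k z) * l = Module.finrank k D := by
  have hτi : ∀ i d, τ (d * z ^ i) = c ^ i • (τ d * z ^ i) := by
    intro i
    induction i with
    | zero => simp
    | succ i ih =>
      intro d
      rw [pow_succ, ← mul_assoc, hτ, ih, smul_mul_assoc, smul_smul, mul_assoc, pow_succ, mul_comm c]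
  have htr : ∀ i ∈ Finset.range l, i ≠ 0 →
      LinearMap.trace k D (LinearMap.mulRight k (z ^ i)) = 0 := by
    intro i hi h0
    have h1 : τ.conj (LinearMap.mulRight k (z ^ i)) = c ^ i • LinearMap.mulRight k (z ^ i) := by
      ext d
      simp [LinearEquiv.conj_apply, hτi]
    have h2 := LinearMap.trace_conj' (LinearMap.mulRight k (z ^ i)) τ
    rw [h1, map_smul, smul_eq_mul] at h2
    by_contra h
    exact hc.pow_ne_one_of_pos_of_lt h0 (Finset.mem_range.1 hi) (mul_right_cancel₀ h
      (h2.trans (one_mul _).symm))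
  set P : D →ₗ[k] D := (l : k)⁻¹ • LinearMap.mulRight k (powSum z l) with hP
  have hPd : ∀ d, P d = (l : k)⁻¹ • (d * powSum z l) := fun d => rfl
  have hidem : IsIdempotentElem P := by
    refine LinearMap.ext fun d => ?_
    rw [Module.End.mul_apply, hPd, hPd, smul_mul_assoc, mul_assoc, hz.powSum_mul_powSum,
      mul_smul_comm, smul_smul (l : k)⁻¹ (l : k), inv_mul_cancel₀ hz.ne_zero, one_smul]
  have hker : LinearMap.ker P = (augmentationIdeal k z).restrictScalars k := by
    ext d
    rw [LinearMap.mem_ker, hPd, Submodule.restrictScalars_mem, hz.mem_augmentationIdeal_iff,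
      smul_eq_zero, or_iff_right (inv_ne_zero hz.ne_zero)]
  have e1 : Module.finrank k (D ⧸ augmentationIdeal k z) =
      Module.finrank k (LinearMap.range P) := by
    rw [← (LinearMap.quotKerEquivRange P).finrank_eq, hker]
    exact ((Submodule.Quotient.restrictScalarsEquiv k (augmentationIdeal k z)).finrank_eq).symm
  have e2 : LinearMap.trace k D P = (Module.finrank k (LinearMap.range P) : k) :=
    LinearMap.IsProj.trace (LinearMap.IsIdempotentElem.isProj_range P hidem)
  have e3 : LinearMap.trace k D P = (l : k)⁻¹ * Module.finrank k D := by
    have : LinearMap.mulRight k (powSum z l) =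
        ∑ i ∈ Finset.range l, LinearMap.mulRight k (z ^ i) := by
      ext d
      simp [powSum, Finset.mul_sum]
    have hl : 0 ∈ Finset.range l := by
      rw [Finset.mem_range]
      exact Nat.pos_of_ne_zero fun h => hz.ne_zero (by rw [h, Nat.cast_zero])
    rw [hP, map_smul, this, map_sum, Finset.sum_eq_single_of_mem 0 hl htr, smul_eq_mul, pow_zero,
      LinearMap.mulRight_one, LinearMap.trace_id]
  rw [e1]
  rw [e2] at e3
  have : ((Module.finrank k (LinearMap.range P) * l : ℕ) : k) = Module.finrank k D := by
    rw [Nat.cast_mul, e3]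
    field_simp [hz.ne_zero]
  exact_mod_cast this

/-- An element `d` of the augmentation ideal that is fixed by a map `τ` with `τ(d z) = c τ(d) z`
vanishes: the elements `d z ^ i` have sum zero, and they are eigenvectors of `τ` with distinct
eigenvalues `c ^ i`. -/
theorem eq_zero_of_fixed (hz : IsCentralGroupLike k z l) {c : k}
    (hc : IsPrimitiveRoot c l) (τ : D →ₗ[k] D) (hτ : ∀ d, τ (d * z) = c • (τ d * z)) {d : D}
    (hd : d ∈ augmentationIdeal k z) (hfix : τ d = d) : d = 0 := by
  have hτi : ∀ i, τ (d * z ^ i) = c ^ i • (d * z ^ i) := by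
    intro i
    induction i with
    | zero => simp [hfix]
    | succ i ih =>
      rw [pow_succ, ← mul_assoc, hτ, ih, smul_mul_assoc, smul_smul, mul_assoc, pow_succ, mul_comm c]
  have h : ∀ j : ℕ, ∑ i ∈ Finset.range l, (c ^ i) ^ j • (d * z ^ i) = 0 := by
    intro j
    induction j with
    | zero =>
      have := (hz.mem_augmentationIdeal_iff d).1 hd
      simpa [powSum, Finset.mul_sum] using this
    | succ j ih =>
      have := congrArg τ ih
      rw [map_zero, map_sum] at this
      rw [← this]
      refine Finset.sum_congr rfl fun i _ => ?_
      rw [map_smul, hτi, smul_smul, pow_succ]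
  have hl : 0 ∈ Finset.range l := by
    rw [Finset.mem_range]
    exact Nat.pos_of_ne_zero fun h => hz.ne_zero (by rw [h, Nat.cast_zero])
  have h2 : ∑ j ∈ Finset.range l, ∑ i ∈ Finset.range l, (c ^ i) ^ j • (d * z ^ i) = (l : k) • d := by
    rw [Finset.sum_comm, Finset.sum_eq_single_of_mem 0 hl]
    · simp [Nat.cast_smul_eq_nsmul]
    · intro i hi h0
      rw [← Finset.sum_smul]
      have h3 := mul_neg_geom_sum (c ^ i) l
      have h4 : c ^ i ≠ 1 := hc.pow_ne_one_of_pos_of_lt h0 (Finset.mem_range.1 hi)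
      rw [← pow_mul, mul_comm i, pow_mul, hc.pow_eq_one, one_pow, sub_self] at h3
      rw [(mul_eq_zero.1 h3).resolve_left (sub_ne_zero.2 h4.symm), zero_smul]
  rw [Finset.sum_eq_zero fun j _ => h j] at h2
  exact (smul_eq_zero.1 h2.symm).resolve_left hz.ne_zero

end IsCentralGroupLike

/-! ### Factorizable quotients of the double -/

namespace DrinfeldDouble

open DualCop WithConv ConvTwist

variable {k H : Type*} [Field k] [Ring H] [HopfAlgebra k H]

/-- The algebra map `h ↦ ∑ χ(h₁) h₂`. -/
noncomputable def translateL (χ : H →ₐ[k] k) : H →ₐ[k] H :=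
  (Algebra.TensorProduct.lid k H).toAlgHom.comp
    ((Algebra.TensorProduct.map χ (AlgHom.id k H)).comp (Bialgebra.comulAlgHom k H))

/-- The algebra map `h ↦ ∑ h₁ χ(h₂)`. -/
noncomputable def translateR (χ : H →ₐ[k] k) : H →ₐ[k] H :=
  (Algebra.TensorProduct.rid k k H).toAlgHom.comp
    ((Algebra.TensorProduct.map (AlgHom.id k H) χ).comp (Bialgebra.comulAlgHom k H))

/-- A character, as an element of the dual. -/
noncomputable def ofChar (χ : H →ₐ[k] k) : DualCop k H := (toDual k H).symm χ.toLinearMap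

theorem toDual_ofChar (χ : H →ₐ[k] k) (h : H) : toDual k H (ofChar χ) h = χ h := rfl

theorem toDual_ofChar_mul (χ : H →ₐ[k] k) (f : DualCop k H) (h : H) :
    toDual k H (ofChar χ * f) h = toDual k H f (translateL χ h) := by
  rw [DualCop.toDual_mul]
  simp only [translateL, AlgHom.comp_apply, Bialgebra.comulAlgHom_apply]
  generalize (Coalgebra.comul h : H ⊗[k] H) = t
  induction t with
  | zero => simp
  | add x y hx hy => simp only [map_add, hx, hy]
  | tmul a b => simp [toDual_ofChar]

theorem toDual_mul_ofChar (χ : H →ₐ[k] k) (f : DualCop k H) (h : H) :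
    toDual k H (f * ofChar χ) h = toDual k H f (translateR χ h) := by
  rw [DualCop.toDual_mul]
  simp only [translateR, AlgHom.comp_apply, Bialgebra.comulAlgHom_apply]
  generalize (Coalgebra.comul h : H ⊗[k] H) = t
  induction t with
  | zero => simp
  | add x y hx hy => simp only [map_add, hx, hy]
  | tmul a b => simp [toDual_ofChar, mul_comm]

theorem hitL_ofChar (χ : H →ₐ[k] k) (a : H) : hitL k H a (ofChar χ) = χ a • ofChar χ := by
  apply DualCop.ext
  intro c
  rw [hitL_apply, map_smul, LinearMap.smul_apply, toDual_ofChar, toDual_ofChar, map_mul,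
    smul_eq_mul, mul_comm]

theorem hitR_ofChar (χ : H →ₐ[k] k) (a : H) : hitR k H a (ofChar χ) = χ a • ofChar χ := by
  apply DualCop.ext
  intro c
  rw [hitR_apply, map_smul, LinearMap.smul_apply, toDual_ofChar, toDual_ofChar, map_mul,
    smul_eq_mul]

/-- Translation by a grouplike element is multiplicative on the dual. -/
theorem hitR_mul {g : H} (hg : IsGroupLikeElem k g) (f f' : DualCop k H) :
    hitR k H g (f * f') = hitR k H g f * hitR k H g f' := by
  apply DualCop.ext
  intro c
  rw [hitR_apply, DualCop.toDual_mul, DualCop.toDual_mul, Bialgebra.comul_mul,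
    hg.comul_eq_tmul_self]
  generalize (Coalgebra.comul c : H ⊗[k] H) = t
  induction t with
  | zero => simp
  | add x y hx hy => simp only [map_add, mul_add, hx, hy]
  | tmul a b => simp [hitR_apply]

/-- The conditions on a character `χ` and a grouplike element `g` that make `χ g` a central
grouplike element of the double, on which translation by `χ` and `g` acts by `χ(g)²`. -/
structure IsCentralPair (χ : H →ₐ[k] k) (g : H) (l : ℕ) : Prop where
  groupLike : IsGroupLikeElem k g
  char_pow : ofChar χ ^ l = 1
  pow_eq_one : g ^ l = 1
  comm : ∀ h, translateL χ h * g = g * translateR χ h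
  ne_zero : (l : k) ≠ 0

/-- The element `χ g` of the double. -/
noncomputable def pairElem [Module.Finite k H] [HasBijectiveAntipode k H] (χ : H →ₐ[k] k) (g : H) :
    DrinfeldDouble k H :=
  inclDual k H (ofChar χ) * inclH k H g

namespace IsCentralPair

variable {χ : H →ₐ[k] k} {g : H} {l : ℕ}

theorem pos (hp : IsCentralPair χ g l) : 0 < l :=
  Nat.pos_of_ne_zero fun h => hp.ne_zero (by rw [h, Nat.cast_zero])

theorem pow_pred_mul (hp : IsCentralPair χ g l) : g ^ (l - 1) * g = 1 := by
  rw [← pow_succ, Nat.sub_add_cancel hp.pos, hp.pow_eq_one]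

theorem mul_pow_pred (hp : IsCentralPair χ g l) : g * g ^ (l - 1) = 1 := by
  rw [← pow_succ', Nat.sub_add_cancel hp.pos, hp.pow_eq_one]

variable [Module.Finite k H] [HasBijectiveAntipode k H]

omit [HasBijectiveAntipode k H] in
theorem translateR_surjective (hp : IsCentralPair χ g l) :
    Function.Surjective (translateR χ) := by
  have hinj : Function.Injective (translateR χ).toLinearMap := by
    rw [← LinearMap.ker_eq_bot, LinearMap.ker_eq_bot']
    intro h hh
    rw [← Module.forall_dual_apply_eq_zero_iff k]
    intro φ
    obtain ⟨f, rfl⟩ := (toDual k H).surjective φ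
    have h1 := toDual_mul_ofChar χ (f * ofChar χ ^ (l - 1)) h
    rw [mul_assoc, ← pow_succ, Nat.sub_add_cancel hp.pos, hp.char_pow, mul_one] at h1
    rw [h1]
    exact (congrArg _ hh).trans (map_zero _)
  exact LinearMap.injective_iff_surjective.1 hinj

theorem inclH_comm (hp : IsCentralPair χ g l) (h : H) :
    inclH k H h * pairElem χ g = pairElem χ g * inclH k H h := by
  obtain ⟨h, rfl⟩ := hp.translateR_surjective h
  have h1 := crossR_comul (ofChar χ) h
  have e1 : ∀ t : H ⊗[k] H, crossR (ofChar χ) t = inclH k H (Algebra.TensorProduct.rid k k H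
      (Algebra.TensorProduct.map (AlgHom.id k H) χ t)) * inclDual k H (ofChar χ) := by
    intro t
    induction t with
    | zero => simp
    | add x y hx hy => simp only [map_add, add_mul, hx, hy]
    | tmul a b => rw [crossR_tmul, hitR_ofChar]; simp
  have e2 : ∀ t : H ⊗[k] H, crossL (ofChar χ) t = inclDual k H (ofChar χ) *
      inclH k H (Algebra.TensorProduct.lid k H
      (Algebra.TensorProduct.map χ (AlgHom.id k H) t)) := by
    intro t
    induction t with
    | zero => simp
    | add x y hx hy => simp only [map_add, mul_add, hx, hy]
    | tmul a b => rw [crossL_tmul, hitL_ofChar]; simp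
  rw [e1, e2] at h1
  have h2 : inclH k H (translateR χ h) * inclDual k H (ofChar χ) =
    inclDual k H (ofChar χ) * inclH k H (translateL χ h) := h1
  rw [pairElem, ← mul_assoc, h2, mul_assoc, mul_assoc, ← map_mul, ← map_mul, hp.comm]

theorem inclDual_comm (hp : IsCentralPair χ g l) (f : DualCop k H) :
    inclDual k H f * pairElem χ g = pairElem χ g * inclDual k H f := by
  have h1 : inclH k H g * inclDual k H f =
      inclDual k H (hitL k H g (hitR k H (g ^ (l - 1)) f)) * inclH k H g := by
    have h := crossR_comul (hitR k H (g ^ (l - 1)) f) g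
    rw [hp.groupLike.comul_eq_tmul_self, crossR_tmul, crossL_tmul] at h
    rw [← h]
    congr 2
    apply DualCop.ext
    intro c
    rw [hitR_apply, hitR_apply, ← mul_assoc, hp.pow_pred_mul, one_mul]
  have h2 : ofChar χ * hitL k H g (hitR k H (g ^ (l - 1)) f) = f * ofChar χ := by
    apply DualCop.ext
    intro c
    rw [toDual_ofChar_mul, toDual_mul_ofChar, hitL_apply, hitR_apply, hp.comm, ← mul_assoc,
      hp.pow_pred_mul, one_mul]
  rw [pairElem, mul_assoc, h1, ← mul_assoc, ← mul_assoc, ← map_mul, ← map_mul, h2]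

theorem comm_pairElem (hp : IsCentralPair χ g l) (d : DrinfeldDouble k H) :
    d * pairElem χ g = pairElem χ g * d := by
  induction d using induction_mul with
  | h0 => simp
  | hadd x y hx hy => rw [add_mul, mul_add, hx, hy]
  | hmul f h => rw [mul_assoc, hp.inclH_comm, ← mul_assoc, hp.inclDual_comm, mul_assoc]

theorem inclH_mul_inclDual_ofChar (hp : IsCentralPair χ g l) :
    inclH k H g * inclDual k H (ofChar χ) = inclDual k H (ofChar χ) * inclH k H g := by
  have h := crossR_comul (ofChar χ) g
  rw [hp.groupLike.comul_eq_tmul_self, crossR_tmul, crossL_tmul, hitL_ofChar, hitR_ofChar,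
    map_smul, mul_smul_comm, smul_mul_assoc] at h
  have h0 : χ g ≠ 0 := by
    intro h0
    have := congrArg χ hp.mul_pow_pred
    rw [map_mul, h0, zero_mul, map_one] at this
    exact zero_ne_one this
  have := congrArg (fun d => (χ g)⁻¹ • d) h
  simpa only [smul_smul, inv_mul_cancel₀ h0, one_smul] using this

theorem isCentralGroupLike (hp : IsCentralPair χ g l) :
    IsCentralGroupLike k (pairElem χ g : DrinfeldDouble k H) l where
  groupLike := by
    refine ⟨?_, ?_⟩
    · rw [pairElem, Bialgebra.counit_mul, counit_inclDual, counit_inclH,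
        hp.groupLike.counit_eq_one, mul_one, DualCop.counit_apply, toDual_ofChar, map_one]
    · have : Coalgebra.comul (R := k) (ofChar χ) = ofChar χ ⊗ₜ[k] ofChar χ := by
        apply pair_ext
        intro a b
        rw [pair_comul_tmul, pair_tmul, toDual_ofChar, toDual_ofChar, toDual_ofChar, map_mul,
          mul_comm]
      rw [pairElem, Bialgebra.comul_mul, comul_inclDual, comul_inclH, this,
        hp.groupLike.comul_eq_tmul_self]
      simp
  comm := hp.comm_pairElem
  pow_eq_one := by
    have h : Commute (inclDual k H (ofChar χ)) (inclH k H g) :=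
      hp.inclH_mul_inclDual_ofChar.symm
    rw [pairElem, h.mul_pow, ← map_pow, ← map_pow, hp.char_pow, hp.pow_eq_one, map_one, map_one,
      mul_one]
  ne_zero := hp.ne_zero

end IsCentralPair

section reversed

variable [Module.Finite k H] [HasBijectiveAntipode k H]

/-- The products `h f` span the double: convolving the exchange map on both sides with evaluation
maps gives the flip, which is surjective. -/
theorem exchange_surjective : Function.Surjective (exchange k H) := by
  have h1 : eta (DualCop k H ⊗[k] H) (evInv k H) * toConv (exchange k H) *
      eta (DualCop k H ⊗[k] H) (ev k H) =
      toConv (TensorProduct.comm k H (DualCop k H)).toLinearMap := by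
    rw [← exchange_eq, mul_assoc, mul_assoc _ _ (eta _ (ev k H)), ← eta_mul, evInv_mul_ev, eta_one,
      mul_one, ← mul_assoc, ← eta_mul, evInv_mul_ev, eta_one, one_mul]
  have h2 := comp_eta_mul (exchange k H) (evInv k H) (ev k H)
    (toConv (LinearMap.id : H ⊗[k] DualCop k H →ₗ[k] H ⊗[k] DualCop k H))
  have h3 := congrArg ofConv (h2.trans h1)
  intro d
  obtain ⟨t, rfl⟩ := (TensorProduct.comm k H (DualCop k H)).surjective d
  exact ⟨_, LinearMap.congr_fun h3 t⟩

/-- The linear isomorphism `h ⊗ f ↦ h f` onto the double. -/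
noncomputable def reversed (k H : Type*) [Field k] [Ring H] [HopfAlgebra k H] [Module.Finite k H]
    [HasBijectiveAntipode k H] : H ⊗[k] DualCop k H ≃ₗ[k] DrinfeldDouble k H :=
  (LinearEquiv.ofBijective (exchange k H) ⟨(LinearMap.injective_iff_surjective_of_finrank_eq_finrank
    (TensorProduct.comm k H (DualCop k H)).finrank_eq).2 exchange_surjective,
    exchange_surjective⟩).trans (ofTensor k H)

theorem reversed_tmul (h : H) (f : DualCop k H) :
    reversed k H (h ⊗ₜ f) = inclH k H h * inclDual k H f := (inclH_mul_inclDual h f).symm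

/-- For `s = u ⊗ f` and a functional `b` on the double, the operator `v ↦ b(f v) u`. -/
noncomputable def contractMap (b : Module.Dual k (DrinfeldDouble k H)) (s : H ⊗[k] DualCop k H) :
    H →ₗ[k] H where
  toFun v := TensorProduct.rid k H
    ((b ∘ₗ LinearMap.mulRight k (inclH k H v) ∘ₗ (inclDual k H).toLinearMap).lTensor H s)
  map_add' v w := by
    induction s with
    | zero => simp
    | add x y hx hy => simp only [map_add] at hx hy ⊢; rw [hx, hy]; abel
    | tmul u f => simp [mul_add, add_smul]
  map_smul' r v := by
    induction s with
    | zero => simp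
    | add x y hx hy => simp only [map_add, hx, hy, smul_add]
    | tmul u f => simp [mul_smul]

theorem contractMap_tmul (b : Module.Dual k (DrinfeldDouble k H)) (u v : H) (f : DualCop k H) :
    contractMap b (u ⊗ₜ f) v = b (inclDual k H f * inclH k H v) • u := rfl

theorem contractMap_add (b : Module.Dual k (DrinfeldDouble k H)) (s t : H ⊗[k] DualCop k H) :
    contractMap b (s + t) = contractMap b s + contractMap b t := by
  ext v; simp [contractMap]

theorem contractMap_zero (b : Module.Dual k (DrinfeldDouble k H)) :
    contractMap b (0 : H ⊗[k] DualCop k H) = 0 := by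
  ext v; simp [contractMap]

theorem toDual_contractMap_coev (b : Module.Dual k (DrinfeldDouble k H)) (f : DualCop k H)
    (v : H) : toDual k H f (contractMap b (coev k H) v) =
      b (inclDual k H f * inclH k H v) := by
  have e : ∀ s : H ⊗[k] DualCop k H, toDual k H f (contractMap b s v) =
      b (inclDual k H (TensorProduct.lid k _ ((toDual k H f).rTensor _ s)) * inclH k H v) := by
    intro s
    induction s with
    | zero => simp [contractMap_zero]
    | add x y hx hy =>
      simp only [contractMap_add, LinearMap.add_apply, map_add, add_mul, hx, hy]
    | tmul u f' => simp [contractMap_tmul, mul_comm]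
  rw [e]
  congr 3
  apply DualCop.ext
  intro h
  have e2 : ∀ s : H ⊗[k] DualCop k H,
      toDual k H (TensorProduct.lid k _ ((toDual k H f).rTensor _ s)) h =
      toDual k H f (evalR k H H s h) := by
    intro s
    induction s with
    | zero => simp
    | add x y hx hy => simp only [map_add, LinearMap.add_apply, hx, hy]
    | tmul u f' => simp [evalR_tmul, mul_comm]
  rw [e2, evalR_coev]

/-- The Drinfeld map of the double, in terms of the canonical element. -/
theorem contractFst_universalR (b : Module.Dual k (DrinfeldDouble k H)) :
    contractFst k (TensorProduct.comm k _ _ (universalR k H) * universalR k H) b =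
      reversed k H ((contractMap b (coev k H)).rTensor _ (coev k H)) := by
  have e : ∀ s t : H ⊗[k] DualCop k H, contractFst k (TensorProduct.comm k _ _
      (TensorProduct.map (inclH k H).toLinearMap (inclDual k H).toLinearMap s) *
      TensorProduct.map (inclH k H).toLinearMap (inclDual k H).toLinearMap t) b =
      reversed k H ((contractMap b s).rTensor _ t) := by
    have h0 : ∀ T : DrinfeldDouble k H ⊗[k] DrinfeldDouble k H,
        contractFst k T b = TensorProduct.lid k _ (b.rTensor _ T) := fun _ => rfl
    intro s t
    rw [h0]
    induction s with
    | zero => simp [contractMap_zero]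
    | add x y hx hy =>
      simp only [contractMap_add, LinearMap.rTensor_add, LinearMap.add_apply, map_add, add_mul,
        hx, hy]
    | tmul u f =>
      induction t with
      | zero => simp
      | add x y hx hy => simp only [map_add, mul_add, hx, hy]
      | tmul v f' => simp [contractMap_tmul, reversed_tmul]
  rw [universalR_eq, e]

theorem contractMap_injective {b : Module.Dual k (DrinfeldDouble k H)}
    (h : contractMap b (coev k H) = 0) : b = 0 := by
  ext d
  rw [LinearMap.zero_apply]
  induction d using induction_mul with
  | h0 => simp
  | hadd x y hx hy => rw [map_add, hx, hy, add_zero]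
  | hmul f v => rw [← toDual_contractMap_coev, h, LinearMap.zero_apply, map_zero]

/-- The Drinfeld map of the double is injective. -/
theorem eq_zero_of_contractFst_universalR {b : Module.Dual k (DrinfeldDouble k H)}
    (hb : contractFst k (TensorProduct.comm k _ _ (universalR k H) * universalR k H) b = 0) :
    b = 0 := by
  rw [contractFst_universalR, LinearEquiv.map_eq_zero_iff] at hb
  refine contractMap_injective (LinearMap.ext fun h => ?_)
  have := evalR_map (contractMap b (coev k H)) (coev k H) h
  rw [hb, evalR_coev] at this
  rw [← this]; simp

end reversed

namespace IsCentralPair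

variable [Module.Finite k H] [HasBijectiveAntipode k H] {χ : H →ₐ[k] k} {g : H} {l : ℕ}

/-- The linear automorphism `h f ↦ (∑ h₁ χ(h₂)) (f ↼ g)` of the double. -/
noncomputable def twist (hp : IsCentralPair χ g l) :
    DrinfeldDouble k H ≃ₗ[k] DrinfeldDouble k H :=
  (reversed k H).symm.trans ((TensorProduct.congr
    (LinearEquiv.ofBijective (translateR χ).toLinearMap
      ⟨LinearMap.injective_iff_surjective.2 hp.translateR_surjective, hp.translateR_surjective⟩)
    (LinearEquiv.ofLinearMap (hitR k H g) (hitR k H (g ^ (l - 1)))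
      (LinearMap.ext fun f => DualCop.ext fun c => by
        rw [LinearMap.comp_apply, hitR_apply, hitR_apply, ← mul_assoc, hp.pow_pred_mul, one_mul]
        rfl)
      (LinearMap.ext fun f => DualCop.ext fun c => by
        rw [LinearMap.comp_apply, hitR_apply, hitR_apply, ← mul_assoc, hp.mul_pow_pred, one_mul]
        rfl))).trans
    (reversed k H))

theorem twist_reversed (hp : IsCentralPair χ g l) (t : H ⊗[k] DualCop k H) :
    hp.twist (reversed k H t) =
      reversed k H (TensorProduct.map (translateR χ).toLinearMap (hitR k H g) t) := by
  simp only [twist, LinearEquiv.trans_apply, LinearEquiv.symm_apply_apply]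
  rfl

omit [Module.Finite k H] [HasBijectiveAntipode k H] in
theorem translateR_self (hp : IsCentralPair χ g l) : translateR χ g = χ g • g := by
  simp [translateR, hp.groupLike.comul_eq_tmul_self]

theorem twist_mul (hp : IsCentralPair χ g l) (d : DrinfeldDouble k H) :
    hp.twist (d * pairElem χ g) = (χ g) ^ 2 • (hp.twist d * pairElem χ g) := by
  obtain ⟨t, rfl⟩ := (reversed k H).surjective d
  have e : ∀ (h : H) (f : DualCop k H), inclH k H h * inclDual k H f * pairElem χ g =
      inclH k H (h * g) * inclDual k H (ofChar χ * f) := by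
    intro h f
    rw [mul_assoc, hp.inclDual_comm, pairElem, ← hp.inclH_mul_inclDual_ofChar, map_mul, map_mul]
    simp only [mul_assoc]
  induction t with
  | zero => simp
  | add x y hx hy => simp only [map_add, add_mul, hx, hy, smul_add]
  | tmul h f =>
    rw [twist_reversed, TensorProduct.map_tmul, reversed_tmul, reversed_tmul, e, e,
      ← reversed_tmul, twist_reversed, TensorProduct.map_tmul, reversed_tmul, hitR_mul hp.groupLike,
      hitR_ofChar, AlgHom.toLinearMap_apply, AlgHom.toLinearMap_apply, map_mul,
      hp.translateR_self, mul_smul_comm, smul_mul_assoc, map_smul, map_smul, smul_mul_assoc,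
      mul_smul_comm, smul_smul, sq]

/-- The image under the Drinfeld map of a functional that is invariant under `χ g` is invariant
under the twist. -/
theorem twist_contractFst (hp : IsCentralPair χ g l) (b : Module.Dual k (DrinfeldDouble k H))
    (hb : ∀ d, b (d * pairElem χ g) = b d) :
    hp.twist (contractFst k (TensorProduct.comm k _ _ (universalR k H) * universalR k H) b) =
      contractFst k (TensorProduct.comm k _ _ (universalR k H) * universalR k H) b := by
  rw [contractFst_universalR, twist_reversed]
  congr 1
  have h1 : TensorProduct.map (translateR χ).toLinearMap (hitR k H g)
      ((contractMap b (coev k H)).rTensor _ (coev k H)) =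
      ((translateR χ).toLinearMap ∘ₗ contractMap b (coev k H)).rTensor _
        ((hitR k H g).lTensor _ (coev k H)) := by
    rw [LinearMap.rTensor, LinearMap.rTensor, LinearMap.lTensor, TensorProduct.map_map,
      TensorProduct.map_map, LinearMap.id_comp, LinearMap.comp_id, LinearMap.comp_id]
  rw [h1, ← coev_mul_left, ← LinearMap.rTensor_comp_apply]
  congr 2
  ext v
  rw [← sub_eq_zero, ← Module.forall_dual_apply_eq_zero_iff k]
  intro φ
  obtain ⟨f, rfl⟩ := (toDual k H).surjective φ
  rw [map_sub, sub_eq_zero, toDual_contractMap_coev]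
  simp only [LinearMap.comp_apply, LinearMap.mulLeft_apply, AlgHom.toLinearMap_apply]
  rw [← toDual_mul_ofChar, toDual_contractMap_coev, ← hb (inclDual k H f * inclH k H v),
    map_mul (inclDual k H), map_mul (inclH k H), mul_assoc _ (inclH k H v), hp.inclH_comm, pairElem]
  simp only [mul_assoc]

/-- The quotient of the double by a central grouplike `χ g` is factorizable if `χ(g)²` is a primitive
`l`-th root of unity. -/
theorem isFactorizable (hp : IsCentralPair χ g l) (hc : IsPrimitiveRoot (χ g ^ 2) l)
    [(augmentationIdeal k (pairElem χ g : DrinfeldDouble k H)).IsTwoSided]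
    [(augmentationIdeal k (pairElem χ g : DrinfeldDouble k H)).IsHopfIdeal k] :
    IsFactorizable k
      (DrinfeldDouble k H ⧸ augmentationIdeal k (pairElem χ g : DrinfeldDouble k H))
      (TensorProduct.map
        (Ideal.Quotient.mkₐ k (augmentationIdeal k (pairElem χ g))).toLinearMap
        (Ideal.Quotient.mkₐ k (augmentationIdeal k (pairElem χ g))).toLinearMap
        (universalR k H)) := by
  set I := augmentationIdeal k (pairElem χ g : DrinfeldDouble k H) with hI
  set π := Ideal.Quotient.mkₐ k I with hπ
  have hz := hp.isCentralGroupLike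
  have hq : IsQuasitriangular k (DrinfeldDouble k H ⧸ I)
      (TensorProduct.map π.toLinearMap π.toLinearMap (universalR k H)) :=
    isQuasitriangular_universalR.map (Bialgebra.Quotient.mkBialgHom (R := k) I)
      Ideal.Quotient.mk_surjective
  refine ⟨hq, ?_⟩
  set P : DrinfeldDouble k H ⊗[k] DrinfeldDouble k H →ₐ[k] _ := Algebra.TensorProduct.map π π
  have hcm : ∀ S, TensorProduct.comm k _ _ (P S) = P (TensorProduct.comm k _ _ S) := by
    intro S
    induction S with
    | zero => simp
    | add x y hx hy => simp only [map_add, hx, hy]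
    | tmul a b => rfl
  have hct : ∀ T (a : Module.Dual k (DrinfeldDouble k H ⧸ I)), contractFst k (P T) a =
      π (contractFst k T (a ∘ₗ π.toLinearMap)) := by
    intro T a
    have h0 : ∀ T : DrinfeldDouble k H ⊗[k] DrinfeldDouble k H, ∀ b,
        contractFst k T b = TensorProduct.lid k _ (b.rTensor _ T) := fun _ _ => rfl
    have h0' : ∀ T, contractFst k T a = TensorProduct.lid k _ (a.rTensor _ T) := fun _ => rfl
    rw [h0, h0']
    induction T with
    | zero => simp
    | add x y hx hy => simp only [map_add, hx, hy]
    | tmul u v => simp [P]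
  have hinj : Function.Injective (contractFst k (TensorProduct.comm k _ _
      (P (universalR k H)) * P (universalR k H))) := by
    rw [← LinearMap.ker_eq_bot, LinearMap.ker_eq_bot']
    intro a ha
    rw [hcm, ← map_mul, hct] at ha
    have hmem := Ideal.Quotient.eq_zero_iff_mem.1 ha
    -- the image of `a ∘ π` under the Drinfeld map of the double is twist-invariant and lies in `I`
    have hfix := hp.twist_contractFst (a ∘ₗ π.toLinearMap) fun d => by
      have : π (pairElem χ g) = 1 := by
        have h1 : π (1 - pairElem χ g ^ 1) = 0 :=
          Ideal.Quotient.eq_zero_iff_mem.2 (hz.sub_pow_mem_augmentationIdeal 1)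
        rw [pow_one, map_sub, map_one, sub_eq_zero] at h1
        exact h1.symm
      simp only [LinearMap.comp_apply, AlgHom.toLinearMap_apply, map_mul, this, mul_one]
    have h0 := eq_zero_of_contractFst_universalR
      (hz.eq_zero_of_fixed hc hp.twist.toLinearMap hp.twist_mul hmem hfix)
    refine LinearMap.ext fun d => ?_
    obtain ⟨d, rfl⟩ := Ideal.Quotient.mk_surjective d
    exact LinearMap.congr_fun h0 d
  have := Module.Finite.of_surjective π.toLinearMap Ideal.Quotient.mk_surjective
  exact ⟨hinj, (LinearMap.injective_iff_surjective_of_finrank_eq_finrank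
    Subspace.dual_finrank_eq).1 hinj⟩

theorem finrank_quotient [CharZero k] (hp : IsCentralPair χ g l)
    (hc : IsPrimitiveRoot (χ g ^ 2) l) :
    Module.finrank k
      (DrinfeldDouble k H ⧸ augmentationIdeal k (pairElem χ g : DrinfeldDouble k H)) * l =
      Module.finrank k H ^ 2 := by
  rw [hp.isCentralGroupLike.finrank_quotient hc hp.twist hp.twist_mul,
    ← (reversed k H).finrank_eq, Module.finrank_tensorProduct, (toDual k H).finrank_eq,
    Subspace.dual_finrank_eq, sq]

end IsCentralPair

end DrinfeldDouble

/-! ### Pointedness of bialgebras with skew-primitive generators -/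

namespace PointedCoalgebra

section Coalgebra

variable {k C : Type*} [Field k] [AddCommGroup C] [Module k C]

/-- The image of `M ⊗ N` in `C ⊗ C`. -/
def tensor (M N : Submodule k C) : Submodule k (C ⊗[k] C) :=
  LinearMap.range (TensorProduct.map M.subtype N.subtype)

theorem tmul_mem {M N : Submodule k C} {x y : C} (hx : x ∈ M) (hy : y ∈ N) :
    x ⊗ₜ[k] y ∈ tensor M N := ⟨(⟨x, hx⟩ : M) ⊗ₜ (⟨y, hy⟩ : N), rfl⟩

theorem tensor_le {M N : Submodule k C} {P : Submodule k (C ⊗[k] C)} :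
    tensor M N ≤ P ↔ ∀ x ∈ M, ∀ y ∈ N, x ⊗ₜ[k] y ∈ P := by
  refine ⟨fun h x hx y hy => h (tmul_mem hx hy), fun h => ?_⟩
  rintro _ ⟨t, rfl⟩
  induction t with
  | zero => simp
  | add x y hx hy => rw [map_add]; exact P.add_mem hx hy
  | tmul a b => exact h _ a.2 _ b.2

theorem tensor_mono {M M' N N' : Submodule k C} (h : M ≤ M') (h' : N ≤ N') :
    tensor M N ≤ tensor M' N' :=
  tensor_le.2 fun _ hx _ hy => tmul_mem (h hx) (h' hy)

/-- A linear endomorphism that is the identity on `N` and vanishes on `F`. -/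
theorem exists_proj {N F : Submodule k C} (h : N ⊓ F = ⊥) :
    ∃ p : C →ₗ[k] C, (∀ x ∈ N, p x = x) ∧ ∀ x ∈ F, p x = 0 := by
  obtain ⟨r, hr⟩ := LinearMap.exists_leftInverse_of_injective (F.mkQ ∘ₗ N.subtype) (by
    rw [LinearMap.ker_eq_bot']
    rintro ⟨x, hx⟩ h0
    have hF : x ∈ F := by simpa using h0
    have : x ∈ N ⊓ F := ⟨hx, hF⟩
    rw [h, Submodule.mem_bot] at this
    exact Subtype.ext this)
  refine ⟨N.subtype ∘ₗ r ∘ₗ F.mkQ, fun x hx => ?_, fun x hx => ?_⟩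
  · exact congrArg Subtype.val (LinearMap.congr_fun hr ⟨x, hx⟩)
  · simp [(Submodule.Quotient.mk_eq_zero F).2 hx]

/-- If `F` and `F₀` meet `N` trivially, then `C ⊗ F₀ + F ⊗ C` and `N ⊗ N` meet trivially. -/
theorem eq_zero_of_mem_tensor {N F F₀ : Submodule k C} (h : N ⊓ F = ⊥) (h₀ : N ⊓ F₀ = ⊥)
    {t : C ⊗[k] C} (ht : t ∈ tensor N N) (ht' : t ∈ tensor ⊤ F₀ ⊔ tensor F ⊤) : t = 0 := by
  obtain ⟨p, hpN, hpF⟩ := exists_proj h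
  obtain ⟨p₀, hp₀N, hp₀F⟩ := exists_proj h₀
  have h1 : tensor N N ≤ LinearMap.ker (TensorProduct.map p p₀ - LinearMap.id) :=
    tensor_le.2 fun x hx y hy => by simp [hpN x hx, hp₀N y hy]
  have h2 : tensor ⊤ F₀ ⊔ tensor F ⊤ ≤ LinearMap.ker (TensorProduct.map p p₀) :=
    sup_le (tensor_le.2 fun x _ y hy => by simp [hp₀F y hy])
      (tensor_le.2 fun x hx y _ => by simp [hpF x hx])
  have e1 := LinearMap.mem_ker.1 (h1 ht)
  have e2 := LinearMap.mem_ker.1 (h2 ht')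
  rw [LinearMap.sub_apply, e2, zero_sub, neg_eq_zero] at e1
  exact e1

variable [Coalgebra k C]

theorem eq_zero_of_comul_eq_zero {x : C} (h : Coalgebra.comul (R := k) x = 0) : x = 0 := by
  have := Coalgebra.rTensor_counit_comul (R := k) x
  rw [h, map_zero] at this
  have h2 := congrArg (TensorProduct.lid k C) this
  simpa using h2.symm

variable (k C) in
/-- The span of the grouplike elements. -/
def groupLikeSpan : Submodule k C := Submodule.span k {x | IsGroupLikeElem k x}

/-- A subcoalgebra that meets the span of the grouplike elements contains one of them. -/
theorem exists_groupLike_mem {N : Submodule k C} (hN : IsSubcoalgebra N)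
    (h : N ⊓ groupLikeSpan k C ≠ ⊥) : ∃ g ∈ N, IsGroupLikeElem k g := by
  obtain ⟨x, ⟨hxN, hx⟩, hx0⟩ := Submodule.exists_mem_ne_zero_of_ne_bot h
  have hrange : Set.range (GroupLike.val (R := k) (A := C)) = {x | IsGroupLikeElem k x} := by
    ext y
    exact ⟨fun ⟨g, hg⟩ => hg ▸ g.isGroupLikeElem_val, fun hy => ⟨⟨y, hy⟩, rfl⟩⟩
  have hx' : x ∈ groupLikeSpan k C := hx
  rw [groupLikeSpan, ← hrange, Finsupp.mem_span_range_iff_exists_finsupp] at hx'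
  obtain ⟨c, rfl⟩ := hx'
  have hc : c ≠ 0 := by rintro rfl; simp at hx0
  obtain ⟨g, hg⟩ := Finsupp.ne_iff.1 hc
  obtain ⟨r, hr⟩ := LinearMap.exists_leftInverse_of_injective
    (Finsupp.linearCombination k (GroupLike.val (R := k) (A := C)))
    (LinearMap.ker_eq_bot.2 linearIndep_groupLikeVal)
  have hrg : ∀ a : GroupLike k C, r a.val = Finsupp.single a 1 := fun a => by
    have := LinearMap.congr_fun hr (Finsupp.single a 1)
    simpa using this
  set φ : C →ₗ[k] k := Finsupp.lapply g ∘ₗ r with hφ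
  have h1 : tensor N N ≤ N.comap ((TensorProduct.rid k C).toLinearMap ∘ₗ φ.lTensor C) :=
    tensor_le.2 fun x hx y _ => by simpa using N.smul_mem _ hx
  have h2 := h1 (hN _ hxN)
  refine ⟨g.val, ?_, g.isGroupLikeElem_val⟩
  have h3 : TensorProduct.rid k C (φ.lTensor C (Coalgebra.comul (R := k)
      (c.sum fun a r => r • a.val))) = c g • g.val := by
    rw [Finsupp.sum, map_sum, map_sum, map_sum, Finset.sum_eq_single g]
    · rw [map_smul, g.isGroupLikeElem_val.comul_eq_tmul_self]
      simp [hφ, hrg]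
    · intro a _ hag
      rw [map_smul, a.isGroupLikeElem_val.comul_eq_tmul_self]
      simp [hφ, hrg, hag]
    · intro h
      simp [Finsupp.notMem_support_iff.1 h]
  have h4 : c g • g.val ∈ N := by rw [← h3]; exact h2
  have h5 := N.smul_mem (c g)⁻¹ h4
  rwa [smul_smul, inv_mul_cancel₀ hg, one_smul] at h5

/-- A simple subcoalgebra that contains a grouplike element is spanned by it. -/
theorem finrank_eq_one_of_groupLike_mem {N : Submodule k C}
    (hmin : ∀ M : Submodule k C, IsSubcoalgebra M → M ≤ N → M = ⊥ ∨ M = N) {g : C} (hgN : g ∈ N)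
    (hg : IsGroupLikeElem k g) : Module.finrank k N = 1 := by
  have h1 : IsSubcoalgebra (Submodule.span k {g}) := by
    intro x hx
    obtain ⟨r, rfl⟩ := Submodule.mem_span_singleton.1 hx
    rw [map_smul, hg.comul_eq_tmul_self]
    exact Submodule.smul_mem _ _ (tmul_mem (Submodule.mem_span_singleton_self g)
      (Submodule.mem_span_singleton_self g))
  have h2 := hmin _ h1 ((Submodule.span_singleton_le_iff_mem g N).2 hgN)
  have h3 : Submodule.span k {g} = N := h2.resolve_left fun h =>
    hg.ne_zero (Submodule.span_singleton_eq_bot.1 h)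
  rw [← h3, finrank_span_singleton hg.ne_zero]

end Coalgebra

section Bialgebra

variable {k C : Type*} [Field k] [Ring C] [Bialgebra k C]

theorem tensor_mul_tensor (M N M' N' : Submodule k C) :
    tensor M N * tensor M' N' ≤ tensor (M * M') (N * N') := by
  rw [Submodule.mul_le]
  intro s hs t ht
  have h1 : tensor M N ≤ (tensor (M * M') (N * N')).comap (LinearMap.mulRight k t) := by
    refine tensor_le.2 fun x hx y hy => ?_
    have h2 : tensor M' N' ≤ (tensor (M * M') (N * N')).comap (LinearMap.mulLeft k (x ⊗ₜ y)) :=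
      tensor_le.2 fun x' hx' y' hy' => by
        rw [Submodule.mem_comap, LinearMap.mulLeft_apply, Algebra.TensorProduct.tmul_mul_tmul]
        exact tmul_mem (Submodule.mul_mem_mul hx hx') (Submodule.mul_mem_mul hy hy')
    exact h2 ht
  exact h1 hs

variable (k) in
/-- A skew-primitive element: `Δ(x) = x ⊗ h + g ⊗ x` with `g` and `h` grouplike. -/
def IsSkewPrimitive (x : C) : Prop :=
  ∃ g h : C, IsGroupLikeElem k g ∧ IsGroupLikeElem k h ∧
    Coalgebra.comul (R := k) x = x ⊗ₜ h + g ⊗ₜ x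

variable (k C) in
/-- The span of the grouplike and the skew-primitive elements. -/
def skewSpan : Submodule k C :=
  Submodule.span k {x | IsGroupLikeElem k x ∨ IsSkewPrimitive k x}

variable (k C) in
/-- The coalgebra filtration given by the number of skew-primitive factors. -/
def filtration : ℕ → Submodule k C
  | 0 => groupLikeSpan k C
  | m + 1 => skewSpan k C * filtration m

variable (k C) in
/-- The preceding step of the filtration, with `⊥` before the step `0`. -/
def filtrationPred : ℕ → Submodule k C
  | 0 => ⊥
  | m + 1 => filtration k C m

theorem groupLikeSpan_le_skewSpan : groupLikeSpan k C ≤ skewSpan k C :=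
  Submodule.span_mono fun _ h => Or.inl h

theorem one_mem_groupLikeSpan : (1 : C) ∈ groupLikeSpan k C := Submodule.subset_span .one

theorem groupLikeSpan_mul_self : groupLikeSpan k C * groupLikeSpan k C ≤ groupLikeSpan k C := by
  rw [groupLikeSpan, Submodule.span_mul_span, Submodule.span_le]
  rintro _ ⟨a, ha, b, hb, rfl⟩
  exact Submodule.subset_span (IsGroupLikeElem.mul ha hb)

theorem groupLikeSpan_mul_skewSpan : groupLikeSpan k C * skewSpan k C ≤ skewSpan k C := by
  rw [groupLikeSpan, skewSpan, Submodule.span_mul_span, Submodule.span_le]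
  rintro _ ⟨a, ha, b, hb, rfl⟩
  refine Submodule.subset_span ?_
  rcases hb with hb | ⟨g, h, hg, hh, hb⟩
  · exact Or.inl (IsGroupLikeElem.mul ha hb)
  · refine Or.inr ⟨a * g, a * h, ha.mul hg, ha.mul hh, ?_⟩
    show Coalgebra.comul (a * b) = _
    rw [Bialgebra.comul_mul, hb, IsGroupLikeElem.comul_eq_tmul_self ha, mul_add]
    simp

theorem filtration_le_succ (m : ℕ) : filtration k C m ≤ filtration k C (m + 1) := by
  intro x hx
  rw [filtration, ← one_mul x]
  exact Submodule.mul_mem_mul (groupLikeSpan_le_skewSpan one_mem_groupLikeSpan) hx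

theorem filtrationPred_le (m : ℕ) : filtrationPred k C m ≤ filtration k C m := by
  cases m with
  | zero => exact bot_le
  | succ m => exact filtration_le_succ m

theorem groupLikeSpan_mul_filtration (m : ℕ) :
    groupLikeSpan k C * filtration k C m ≤ filtration k C m := by
  cases m with
  | zero => exact groupLikeSpan_mul_self
  | succ m =>
    rw [filtration, ← mul_assoc]
    exact mul_le_mul' groupLikeSpan_mul_skewSpan le_rfl

theorem skewSpan_mul_filtrationPred (m : ℕ) :
    skewSpan k C * filtrationPred k C m ≤ filtration k C m := by
  cases m with
  | zero => rw [filtrationPred, Submodule.mul_bot]; exact bot_le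
  | succ m => exact le_rfl

theorem map_comul_skewSpan : (skewSpan k C).map (Coalgebra.comul (R := k)) ≤
    tensor (skewSpan k C) (groupLikeSpan k C) ⊔ tensor (groupLikeSpan k C) ⊤ := by
  rw [skewSpan, Submodule.map_span_le]
  rintro x (hx | hx)
  · rw [hx.comul_eq_tmul_self]
    exact Submodule.mem_sup_right (tmul_mem (Submodule.subset_span hx) trivial)
  · have hx' := hx
    obtain ⟨g, h, hg, hh, hΔ⟩ := hx'
    rw [hΔ]
    exact Submodule.add_mem_sup
      (tmul_mem (Submodule.subset_span (Or.inr hx)) (Submodule.subset_span hh))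
      (tmul_mem (Submodule.subset_span hg) trivial)

theorem map_comul_filtration (m : ℕ) : (filtration k C m).map (Coalgebra.comul (R := k)) ≤
    tensor (filtration k C m) (groupLikeSpan k C) ⊔ tensor (filtrationPred k C m) ⊤ := by
  induction m with
  | zero =>
    refine le_sup_of_le_left ?_
    rw [filtration, groupLikeSpan, Submodule.map_span_le]
    intro x hx
    rw [IsGroupLikeElem.comul_eq_tmul_self hx]
    exact tmul_mem (Submodule.subset_span hx) (Submodule.subset_span hx)
  | succ m ih =>
    have h1 : (filtration k C (m + 1)).map (Coalgebra.comul (R := k)) =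
        (skewSpan k C).map (Coalgebra.comul (R := k)) *
          (filtration k C m).map (Coalgebra.comul (R := k)) :=
      Submodule.map_mul _ _ (Bialgebra.comulAlgHom k C)
    have h2 : ∀ {M M' : Submodule k C}, M * M' ≤ filtration k C m → ∀ N N',
        tensor M N * tensor M' N' ≤ tensor (filtration k C m) ⊤ := fun h N N' =>
      (tensor_mul_tensor _ _ _ _).trans (tensor_mono h le_top)
    rw [h1]
    refine (mul_le_mul' map_comul_skewSpan ih).trans ?_
    rw [Submodule.sup_mul, Submodule.mul_sup, Submodule.mul_sup]
    refine sup_le (sup_le (le_sup_of_le_left ?_) (le_sup_of_le_right ?_))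
      (sup_le (le_sup_of_le_right ?_) (le_sup_of_le_right ?_))
    · exact (tensor_mul_tensor _ _ _ _).trans (tensor_mono le_rfl groupLikeSpan_mul_self)
    · exact h2 (skewSpan_mul_filtrationPred m) _ _
    · exact h2 (groupLikeSpan_mul_filtration m) _ _
    · exact h2 ((mul_le_mul' le_rfl (filtrationPred_le m)).trans
        (groupLikeSpan_mul_filtration m)) _ _

theorem exists_mem_filtration {s : Set C} (hs : Algebra.adjoin k s = ⊤)
    (h : ∀ x ∈ s, IsGroupLikeElem k x ∨ IsSkewPrimitive k x) (x : C) :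
    ∃ m, x ∈ filtration k C m := by
  have hmono : Monotone (filtration k C) := monotone_nat_of_le_succ filtration_le_succ
  have hx : x ∈ Subalgebra.toSubmodule (Algebra.adjoin k s) := by rw [hs]; trivial
  rw [Algebra.adjoin_eq_span] at hx
  induction hx using Submodule.span_induction with
  | zero => exact ⟨0, zero_mem _⟩
  | add x y _ _ hx hy =>
    obtain ⟨m, hm⟩ := hx
    obtain ⟨m', hm'⟩ := hy
    exact ⟨max m m', add_mem (hmono (le_max_left _ _) hm) (hmono (le_max_right _ _) hm')⟩
  | smul r x _ hx =>
    obtain ⟨m, hm⟩ := hx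
    exact ⟨m, Submodule.smul_mem _ _ hm⟩
  | mem x hx =>
    induction hx using Submonoid.closure_induction_left with
    | one => exact ⟨0, one_mem_groupLikeSpan⟩
    | mul_left a ha b _ hb =>
      obtain ⟨m, hm⟩ := hb
      exact ⟨m + 1, Submodule.mul_mem_mul (Submodule.subset_span (h a ha)) hm⟩

/-- A bialgebra generated by grouplike and skew-primitive elements is pointed: a simple subcoalgebra
that did not meet the span of the grouplike elements would contain an element of minimal filtration
degree, whose comultiplication would vanish by `eq_zero_of_mem_tensor`. -/
theorem isPointedCoalgebra_of_adjoin {s : Set C} (hs : Algebra.adjoin k s = ⊤)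
    (h : ∀ x ∈ s, IsGroupLikeElem k x ∨ IsSkewPrimitive k x) : IsPointedCoalgebra k C := by
  classical
  intro N hN hN0 hmin
  have hex : ∃ m, N ⊓ filtration k C m ≠ ⊥ := by
    obtain ⟨x, hx, hx0⟩ := Submodule.exists_mem_ne_zero_of_ne_bot hN0
    obtain ⟨m, hm⟩ := exists_mem_filtration hs h x
    exact ⟨m, (Submodule.ne_bot_iff _).2 ⟨x, ⟨hx, hm⟩, hx0⟩⟩
  have hmono : Monotone (filtration k C) := monotone_nat_of_le_succ filtration_le_succ
  have h0 : N ⊓ groupLikeSpan k C ≠ ⊥ := by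
    intro h0
    have hlt : ∀ m < Nat.find hex, N ⊓ filtration k C m = ⊥ := fun m hm =>
      not_not.1 (Nat.find_min hex hm)
    have hfind := Nat.find_spec hex
    obtain ⟨x, ⟨hxN, hx⟩, hx0⟩ := Submodule.exists_mem_ne_zero_of_ne_bot hfind
    have hpred : N ⊓ filtrationPred k C (Nat.find hex) = ⊥ := by
      rcases hm : Nat.find hex with _ | m
      · exact inf_bot_eq N
      · exact hlt m (by omega)
    refine hx0 (eq_zero_of_comul_eq_zero (k := k) (eq_zero_of_mem_tensor hpred h0 (hN x hxN) ?_))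
    have hle := sup_le_sup (tensor_mono (le_top : filtration k C (Nat.find hex) ≤ ⊤)
      (le_refl (groupLikeSpan k C)))
      (le_refl (tensor (filtrationPred k C (Nat.find hex)) (⊤ : Submodule k C)))
    exact hle (map_comul_filtration _ (Submodule.mem_map_of_mem hx))
  obtain ⟨g, hgN, hg⟩ := exists_groupLike_mem hN h0
  exact finrank_eq_one_of_groupLike_mem hmin hgN hg

end Bialgebra

end PointedCoalgebra

/-! ### Ordered monomials and joint eigenvectors -/

section QCommuting

variable {k A ι : Type*} [Field k] [Ring A] [Algebra k A] [DecidableEq ι]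

theorem exists_mul_ordered_prod {y : ι → A} (hc : ∀ i j, ∃ c : k, y i * y j = c • (y j * y i))
    (a : ι → ℕ) (j : ι) : ∀ L : List ι, L.Nodup → j ∈ L → ∃ c : k,
      y j * (L.map fun i => y i ^ a i).prod =
        c • (L.map fun i => y i ^ (Function.update a j (a j + 1)) i).prod := by
  intro L
  induction L with
  | nil => simp
  | cons i L ih =>
    intro hL hj
    rw [List.nodup_cons] at hL
    simp only [List.map_cons, List.prod_cons]
    by_cases hij : j = i
    · subst hij
      refine ⟨1, ?_⟩
      have h1 : (L.map fun i => y i ^ (Function.update a j (a j + 1)) i) =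
          L.map fun i => y i ^ a i := by
        refine List.map_congr_left fun i hi => ?_
        rw [Function.update_of_ne]
        rintro rfl
        exact hL.1 hi
      rw [h1, Function.update_self, one_smul, ← mul_assoc, ← pow_succ']
    · obtain ⟨c, h⟩ := ih hL.2 ((List.mem_cons.1 hj).resolve_left hij)
      obtain ⟨d, hd⟩ := hc j i
      refine ⟨d ^ a i * c, ?_⟩
      rw [← mul_assoc, QBinom.pow_mul_of_mul hd, smul_mul_assoc, mul_assoc, h, mul_smul_comm,
        smul_smul, Function.update_of_ne (Ne.symm hij)]

/-- An algebra generated by finitely many elements that commute up to scalars and have scalar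
`l`-th powers is spanned by the ordered monomials with exponents less than `l`. -/
theorem finrank_le_of_qcommuting [Fintype ι] (y : ι → A) (l : ℕ) (hl : l ≠ 0)
    (hgen : Algebra.adjoin k (Set.range y) = ⊤)
    (hc : ∀ i j, ∃ c : k, y i * y j = c • (y j * y i))
    (hp : ∀ i, ∃ c : k, y i ^ l = algebraMap k A c) :
    Module.finrank k A ≤ l ^ Fintype.card ι := by
  set m : (ι → ℕ) → A := fun a => (Finset.univ.toList.map fun i => y i ^ a i).prod with hm
  set S := Submodule.span k (Set.range m)
  have htop : ∀ a : A, a ∈ S := by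
    have hone : (1 : A) ∈ S := Submodule.subset_span ⟨0, by simp [hm]⟩
    have hmul : ∀ j, ∀ s ∈ S, y j * s ∈ S := by
      intro j s hs
      induction hs using Submodule.span_induction with
      | zero => simp
      | add s t _ _ hs ht => rw [mul_add]; exact add_mem hs ht
      | smul r s _ hs => rw [mul_smul_comm]; exact S.smul_mem _ hs
      | mem s hs =>
        obtain ⟨a, rfl⟩ := hs
        obtain ⟨c, h⟩ := exists_mul_ordered_prod hc a j Finset.univ.toList
          (Finset.nodup_toList _) (by simp)
        rw [hm, h]
        exact S.smul_mem _ (Submodule.subset_span ⟨_, rfl⟩)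
    have hsub : ∀ a ∈ Algebra.adjoin k (Set.range y), ∀ s ∈ S, a * s ∈ S := by
      intro a ha
      induction ha using Algebra.adjoin_induction with
      | mem x hx => obtain ⟨j, rfl⟩ := hx; exact hmul j
      | algebraMap r =>
        intro s hs
        rw [Algebra.algebraMap_eq_smul_one, smul_mul_assoc, one_mul]; exact S.smul_mem _ hs
      | add x y _ _ hx hy => intro s hs; rw [add_mul]; exact add_mem (hx s hs) (hy s hs)
      | mul x y _ _ hx hy => intro s hs; rw [mul_assoc]; exact hx _ (hy s hs)
    intro a
    rw [← mul_one a]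
    exact hsub a (hgen ▸ Algebra.mem_top) 1 hone
  have hred : ∀ a : ι → ℕ, ∀ L : List ι, ∃ c : k, (L.map fun i => y i ^ a i).prod =
      c • (L.map fun i => y i ^ (a i % l)).prod := by
    intro a L
    induction L with
    | nil => exact ⟨1, by simp⟩
    | cons i L ih =>
      obtain ⟨c, h⟩ := ih
      obtain ⟨d, hd⟩ := hp i
      refine ⟨d ^ (a i / l) * c, ?_⟩
      have h1 : y i ^ a i = d ^ (a i / l) • y i ^ (a i % l) := by
        conv_lhs => rw [← Nat.div_add_mod (a i) l, pow_add, pow_mul, hd, ← map_pow,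
          Algebra.algebraMap_eq_smul_one, smul_mul_assoc, one_mul]
      rw [List.map_cons, List.prod_cons, List.map_cons, List.prod_cons, h, h1, smul_mul_assoc,
        mul_smul_comm, smul_smul]
  have hS : Submodule.span k (Set.range fun a : ι → Fin l => m fun i => a i) = ⊤ := by
    rw [eq_top_iff]
    refine le_trans (fun a _ => htop a) (Submodule.span_le.2 ?_)
    rintro _ ⟨a, rfl⟩
    obtain ⟨c, h⟩ := hred a Finset.univ.toList
    refine (congrArg (· ∈ _) h).mpr ?_
    exact Submodule.smul_mem _ _ (Submodule.subset_span
      ⟨fun i => ⟨a i % l, Nat.mod_lt _ (Nat.pos_of_ne_zero hl)⟩, rfl⟩)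
  rw [← finrank_top k A, ← hS]
  exact (finrank_range_le_card _).trans (by simp)

end QCommuting

/-- A submodule stable under a family of operators contains the components of its elements in
the joint eigenspaces. -/
theorem Submodule.mem_of_sum_mem_of_eigenvector {k V σ τ : Type*} [Field k] [AddCommGroup V]
    [Module k V] [DecidableEq σ] (J : Submodule k V) (T : τ → V →ₗ[k] V)
    (hJ : ∀ t, ∀ v ∈ J, T t v ∈ J) (c : τ → σ → k) (hsep : ∀ s s', s ≠ s' → ∃ t, c t s ≠ c t s')
    (v : σ → V) (hv : ∀ t s, T t (v s) = c t s • v s) (S : Finset σ) (hS : ∑ s ∈ S, v s ∈ J) :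
    ∀ s ∈ S, v s ∈ J := by
  intro s₀ hs₀
  have key : ∀ R : Finset σ, s₀ ∉ R → ∃ (d : σ → k), d s₀ ≠ 0 ∧ (∀ s ∈ R, d s = 0) ∧
      ∑ s ∈ S, d s • v s ∈ J := by
    intro R
    induction R using Finset.induction_on with
    | empty => exact fun _ => ⟨fun _ => 1, one_ne_zero, by simp, by simpa using hS⟩
    | insert r R hr ih =>
      intro h
      rw [Finset.mem_insert, not_or] at h
      obtain ⟨d, hd, hR, hdJ⟩ := ih h.2
      obtain ⟨t, ht⟩ := hsep _ _ h.1
      refine ⟨fun s => (c t s - c t r) * d s, mul_ne_zero (sub_ne_zero.2 ht) hd, ?_, ?_⟩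
      · intro s hs
        rcases Finset.mem_insert.1 hs with rfl | hs
        · simp
        · simp [hR s hs]
      · have h1 := J.sub_mem (hJ t _ hdJ) (J.smul_mem (c t r) hdJ)
        rw [map_sum, Finset.smul_sum, ← Finset.sum_sub_distrib] at h1
        convert h1 using 2 with s _
        rw [map_smul, hv, smul_smul, smul_smul, ← sub_smul]
        ring_nf
  obtain ⟨d, hd, hR, hdJ⟩ := key (S.erase s₀) (Finset.notMem_erase _ _)
  rw [← Finset.add_sum_erase _ _ hs₀, Finset.sum_eq_zero fun s hs => by rw [hR s hs, zero_smul],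
    add_zero] at hdJ
  have := J.smul_mem (d s₀)⁻¹ hdJ
  rwa [smul_smul, inv_mul_cancel₀ hd, one_smul] at this

/-! ### Skew-primitive functionals -/

namespace DrinfeldDouble

open DualCop

variable {k H : Type*} [Field k] [Ring H] [HopfAlgebra k H]

/-- A `(κ, ε)`-derivation `ξ : H → k`; equivalently, a skew-primitive element of the dual. -/
structure IsCharDerivation (κ : H →ₐ[k] k) (ξ : DualCop k H) : Prop where
  map_mul : ∀ a b, toDual k H ξ (a * b) =
    κ a * toDual k H ξ b + toDual k H ξ a * Coalgebra.counit (R := k) b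

/-- The operator `h ↦ ∑ f(h₁) h₂`. -/
noncomputable def contractL (f : DualCop k H) : H →ₗ[k] H :=
  (TensorProduct.lid k H).toLinearMap ∘ₗ (toDual k H f).rTensor H ∘ₗ Coalgebra.comul

theorem toDual_mul_eq_contractL (f f' : DualCop k H) (h : H) :
    toDual k H (f * f') h = toDual k H f' (contractL f h) := by
  rw [DualCop.toDual_mul]
  simp only [contractL, LinearMap.comp_apply]
  generalize (Coalgebra.comul h : H ⊗[k] H) = t
  induction t with
  | zero => simp
  | add x y hx hy => simp only [map_add, hx, hy]
  | tmul a b => simp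

theorem IsCharDerivation.contractL_mul {κ : H →ₐ[k] k} {ξ : DualCop k H}
    (hξ : IsCharDerivation κ ξ) (a b : H) :
    contractL ξ (a * b) = translateL κ a * contractL ξ b + contractL ξ a * b := by
  have hb : b = TensorProduct.lid k H
      ((Coalgebra.counit (R := k)).rTensor H (Coalgebra.comul b)) := by simp
  conv_rhs => rw [hb]
  simp only [contractL, translateL, LinearMap.comp_apply, AlgHom.comp_apply,
    Bialgebra.comulAlgHom_apply, Bialgebra.comul_mul]
  rw [← hb]
  conv_rhs => enter [2, 2]; rw [hb]
  generalize (Coalgebra.comul a : H ⊗[k] H) = s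
  generalize (Coalgebra.comul b : H ⊗[k] H) = t
  induction s with
  | zero => simp
  | add x y hx hy => simp only [map_add, add_mul, hx, hy]; abel
  | tmul a₁ a₂ =>
    induction t with
    | zero => simp
    | add x y hx hy => simp only [map_add, mul_add, hx, hy]; abel
    | tmul b₁ b₂ =>
      simp [hξ.map_mul, add_smul, smul_smul, mul_comm]

theorem IsCharDerivation.comul_eq [Module.Finite k H] {κ : H →ₐ[k] k} {ξ : DualCop k H}
    (hξ : IsCharDerivation κ ξ) :
    Coalgebra.comul (R := k) ξ = ξ ⊗ₜ ofChar κ + 1 ⊗ₜ ξ := by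
  refine pair_ext fun a b => ?_
  rw [pair_comul_tmul, hξ.map_mul, map_add, LinearMap.add_apply, pair_tmul, pair_tmul,
    toDual_ofChar, DualCop.toDual_one]
  ring

theorem isGroupLikeElem_ofChar [Module.Finite k H] (χ : H →ₐ[k] k) :
    IsGroupLikeElem k (ofChar χ : DualCop k H) := by
  refine ⟨?_, pair_ext fun a b => ?_⟩
  · rw [DualCop.counit_apply, toDual_ofChar, map_one]
  · rw [pair_comul_tmul, pair_tmul, toDual_ofChar, toDual_ofChar, toDual_ofChar, map_mul, mul_comm]

end DrinfeldDouble

/-! ### The monomial basis and the dual of the Taft algebra -/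

namespace TaftAlgebra

open DualCop DrinfeldDouble

variable {k : Type*} [Field k] (q : k) (l : ℕ) {n : ℕ}

theorem torusChar_rels (hl : l ≠ 0) {c : Fin n → k} (hc : ∀ i, c i ^ l = 1) :
    Rels q l n (fun _ => (0 : k)) c where
  gg _ _ := mul_comm _ _
  gp := hc
  gx _ _ := by simp
  xx _ _ := by simp
  xp _ := by simp [hl]

/-- The character `x i ↦ 0`, `g i ↦ c i`. -/
noncomputable def torusChar [NeZero l] {c : Fin n → k} (hc : ∀ i, c i ^ l = 1) :
    TaftAlgebra k q l n →ₐ[k] k := lift (torusChar_rels q l (NeZero.ne l) hc)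

variable {q l}

theorem torusChar_x [NeZero l] {c : Fin n → k} (hc : ∀ i, c i ^ l = 1) (j : Fin n) :
    torusChar q l hc (x q l j) = 0 := lift_x _ j

theorem torusChar_g [NeZero l] {c : Fin n → k} (hc : ∀ i, c i ^ l = 1) (j : Fin n) :
    torusChar q l hc (g q l j) = c j := lift_g _ j

variable (q l)

/-- The scalars of `g j * x i = weight i j • (x i * g j)`. -/
def weight (i j : Fin n) : k := taftTheta q j i * q ^ (if j = i then 1 else 0)

variable {q l}

theorem weight_self (i : Fin n) : weight q i i = q := by simp [weight, theta_self]

theorem weight_pow (hq : q ^ l = 1) (i j : Fin n) : weight q i j ^ l = 1 := by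
  rw [weight, mul_pow, ← pow_mul, mul_comm _ l, pow_mul, hq, one_pow, mul_one, taftTheta]
  split_ifs <;> simp [hq]

theorem skewRep_rels (hl : l ≠ 0) (hq : q ^ l = 1) (i : Fin n) :
    Rels q l n (fun j => if i = j ∧ 1 < l then !![0, 1; 0, 0] else (0 : Matrix (Fin 2) (Fin 2) k))
      (fun j => !![weight q i j, 0; 0, 1]) where
  gg j j' := by simp [mul_comm]
  gp j := by
    have h : ∀ m : ℕ, (!![weight q i j, 0; 0, 1] : Matrix (Fin 2) (Fin 2) k) ^ m =
        !![weight q i j ^ m, 0; 0, 1] := by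
      intro m
      induction m with
      | zero => simp [Matrix.one_fin_two]
      | succ m ih => rw [pow_succ, ih]; simp [pow_succ]
    rw [h, weight_pow hq, Matrix.one_fin_two]
  gx j j' := by
    by_cases h1 : i = j' ∧ 1 < l
    · obtain ⟨rfl, h2⟩ := h1
      simp only [true_and, h2, if_true]
      ext a b
      change _ = (weight q i j • (!![0, 1; 0, 0] * !![weight q i j, 0; 0, 1]) :
        Matrix (Fin 2) (Fin 2) k) a b
      fin_cases a <;> fin_cases b <;> simp
    · simp [h1]
  xx j j' := by
    split_ifs with h1 h2 h2 <;> simp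
  xp j := by
    split_ifs with h1
    · obtain ⟨m, rfl⟩ : ∃ m, l = m + 2 := ⟨l - 2, by omega⟩
      have : (!![0, 1; 0, 0] : Matrix (Fin 2) (Fin 2) k) ^ 2 = 0 := by
        rw [pow_two]; ext a b; fin_cases a <;> fin_cases b <;> simp
      rw [pow_add, this, mul_zero]
    · exact zero_pow hl

section

variable (q l)

variable [hq : Fact (IsPrimitiveRoot q l)] [hl : NeZero l]

/-- The two-dimensional representation `x i ↦ E₁₂`, `x j ↦ 0` for `j ≠ i`,
`g j ↦ diag (weight i j, 1)`; for `l = 1`, where `x i = 0`, it sends `x i` to `0`. -/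
noncomputable def skewRep (i : Fin n) : TaftAlgebra k q l n →ₐ[k] Matrix (Fin 2) (Fin 2) k :=
  lift (skewRep_rels hl.out hq.out.pow_eq_one i)

/-- The character `g j ↦ weight i j`. -/
noncomputable def weightChar (i : Fin n) : TaftAlgebra k q l n →ₐ[k] k :=
  torusChar q l (weight_pow hq.out.pow_eq_one i)

/-- The skew-primitive functional dual to `x i`: the off-diagonal coefficient of `skewRep i`. -/
noncomputable def skewDual (i : Fin n) : DualCop k (TaftAlgebra k q l n) :=
  (toDual k _).symm (Matrix.entryLinearMap k k 0 1 ∘ₗ (skewRep q l i).toLinearMap)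

theorem skewDual_apply (i : Fin n) (a : TaftAlgebra k q l n) :
    toDual k _ (skewDual q l i) a = skewRep q l i a 0 1 := rfl

theorem weightChar_x (i j : Fin n) : weightChar q l i (x q l j) = 0 := torusChar_x _ j

theorem weightChar_g (i j : Fin n) : weightChar q l i (g q l j) = weight q i j := torusChar_g _ j

theorem skewRep_upper (i : Fin n) (a : TaftAlgebra k q l n) :
    skewRep q l i a 0 0 = weightChar q l i a ∧ skewRep q l i a 1 0 = 0 ∧
      skewRep q l i a 1 1 = Coalgebra.counit (R := k) a := by
  have ha : a ∈ Algebra.adjoin k (gens q l n) := adjoin_gens q l n ▸ Algebra.mem_top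
  induction ha using Algebra.adjoin_induction with
  | mem a ha =>
    rcases ha with ⟨j, rfl⟩ | ⟨j, rfl⟩
    · have h2 : skewRep q l i (x q l j) = _ := lift_x _ j
      rw [weightChar_x, h2, counit_x]
      split_ifs <;> simp
    · have h2 : skewRep q l i (g q l j) = _ := lift_g _ j
      rw [weightChar_g, h2, counit_g]
      simp
  | algebraMap r =>
    simp [Matrix.algebraMap_matrix_apply]
  | add a b _ _ ha hb => simp [ha, hb]
  | mul a b _ _ ha hb => simp [Matrix.mul_apply, ha, hb]

theorem isCharDerivation_skewDual (i : Fin n) :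
    IsCharDerivation (weightChar q l i) (skewDual q l i) where
  map_mul a b := by
    simp only [skewDual_apply, map_mul, Matrix.mul_apply, Fin.sum_univ_two]
    rw [(skewRep_upper q l i a).1, (skewRep_upper q l i b).2.2]

theorem skewDual_x (hl1 : 1 < l) (i j : Fin n) :
    toDual k _ (skewDual q l i) (x q l j) = if i = j then 1 else 0 := by
  rw [skewDual_apply, show skewRep q l i (x q l j) = _ from lift_x _ j]
  by_cases h : i = j <;> simp [h, hl1]

theorem skewDual_g (i j : Fin n) : toDual k _ (skewDual q l i) (g q l j) = 0 := by
  rw [skewDual_apply, show skewRep q l i (g q l j) = _ from lift_g _ j]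
  simp

/-- The `q`-derivative along `x i`, that is, `a ↦ ∑ ξ(a₁) a₂` for `ξ = skewDual q l i`. -/
noncomputable def deriv (i : Fin n) : TaftAlgebra k q l n →ₗ[k] TaftAlgebra k q l n :=
  contractL (skewDual q l i)

theorem deriv_mul (i : Fin n) (a b : TaftAlgebra k q l n) :
    deriv q l i (a * b) = translateL (weightChar q l i) a * deriv q l i b + deriv q l i a * b :=
  (isCharDerivation_skewDual q l i).contractL_mul a b

theorem deriv_one (i : Fin n) : deriv q l i 1 = 0 := by
  have h := deriv_mul q l i 1 1
  rw [map_one, one_mul, mul_one] at h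
  rw [one_mul] at h
  exact left_eq_add.1 h

theorem deriv_x (hl1 : 1 < l) (i j : Fin n) :
    deriv q l i (x q l j) = if i = j then 1 else 0 := by
  simp only [deriv, contractL, LinearMap.comp_apply, comul_x, map_add, LinearMap.rTensor_tmul,
    skewDual_x q l hl1, skewDual_g]
  split_ifs <;> simp

theorem deriv_g (i j : Fin n) : deriv q l i (g q l j) = 0 := by
  simp [deriv, contractL, comul_g, skewDual_g]

variable {q l}

theorem translateL_x {χ : TaftAlgebra k q l n →ₐ[k] k} (hχ : ∀ i, χ (x q l i) = 0) (j : Fin n) :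
    translateL χ (x q l j) = χ (g q l j) • x q l j := by
  simp [translateL, comul_x, hχ]

theorem translateL_g (χ : TaftAlgebra k q l n →ₐ[k] k) (j : Fin n) :
    translateL χ (g q l j) = χ (g q l j) • g q l j := by
  simp [translateL, comul_g]

theorem translateR_x {χ : TaftAlgebra k q l n →ₐ[k] k} (hχ : ∀ i, χ (x q l i) = 0) (j : Fin n) :
    translateR χ (x q l j) = x q l j := by
  simp [translateR, comul_x, hχ]

theorem translateR_g (χ : TaftAlgebra k q l n →ₐ[k] k) (j : Fin n) :
    translateR χ (g q l j) = χ (g q l j) • g q l j := by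
  simp [translateR, comul_g]

theorem deriv_x_pow (hl1 : 1 < l) (i : Fin n) (m : ℕ) :
    deriv q l i (x q l i ^ (m + 1)) = QBinom.qint q (m + 1) • x q l i ^ m := by
  induction m with
  | zero => simp [deriv_x q l hl1, QBinom.qint]
  | succ m ih =>
    rw [pow_succ', deriv_mul, ih, deriv_x q l hl1, translateL_x (weightChar_x q l i),
      weightChar_g, weight_self, if_pos rfl, one_mul, smul_mul_smul_comm, ← pow_succ']
    rw [show m + 1 + 1 = 1 + (m + 1) by ring, QBinom.qint_add q 1, add_smul, add_comm]
    simp [QBinom.qint]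

variable (q l) in
/-- The elements on which the `q`-derivative along `x i` vanishes. -/
noncomputable def derivKer (i : Fin n) : Subalgebra k (TaftAlgebra k q l n) where
  carrier := {a | deriv q l i a = 0}
  mul_mem' {a b} ha hb := by
    change deriv q l i a = 0 at ha
    change deriv q l i b = 0 at hb
    change deriv q l i (a * b) = 0
    rw [deriv_mul, ha, hb, mul_zero, zero_mul, add_zero]
  add_mem' {a b} ha hb := by
    change deriv q l i a = 0 at ha
    change deriv q l i b = 0 at hb
    change deriv q l i (a + b) = 0
    rw [map_add, ha, hb, add_zero]
  algebraMap_mem' r := by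
    change deriv q l i (algebraMap k _ r) = 0
    rw [Algebra.algebraMap_eq_smul_one, map_smul, deriv_one, smul_zero]

theorem mem_derivKer {i : Fin n} {a : TaftAlgebra k q l n} :
    a ∈ derivKer q l i ↔ deriv q l i a = 0 := Iff.rfl

omit hl in
theorem qint_ne_zero {m : ℕ} (hm : m ≠ 0) (hml : m < l) : QBinom.qint q m ≠ 0 := by
  intro h
  have h1 := hq.out.pow_ne_one_of_pos_of_lt hm hml
  have h2 := mul_neg_geom_sum q m
  rw [show ∑ t ∈ Finset.range m, q ^ t = 0 from h] at h2
  apply h1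
  linear_combination h2

/-- If the `q`-derivative of `r` along `x i` vanishes, then `q`-derivation reduces `x i ^ m * r` to a
multiple of `r`, which is nonzero for `m < l`. -/
theorem mem_of_x_pow_mul_mem {J : Submodule k (TaftAlgebra k q l n)}
    (hJ : ∀ i, ∀ v ∈ J, deriv q l i v ∈ J) (i : Fin n) {r : TaftAlgebra k q l n}
    (hr : r ∈ derivKer q l i) : ∀ m : ℕ, m < l → x q l i ^ m * r ∈ J → r ∈ J := by
  intro m
  induction m with
  | zero => intro _ h; simpa using h
  | succ m ih =>
    intro hm h
    have h1 := hJ i _ h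
    rw [deriv_mul, mem_derivKer.1 hr, mul_zero, zero_add, deriv_x_pow (by omega),
      smul_mul_assoc] at h1
    have h2 := J.smul_mem (QBinom.qint q (m + 1))⁻¹ h1
    rw [smul_smul, inv_mul_cancel₀ (qint_ne_zero (by omega) hm), one_smul] at h2
    exact ih (by omega) h2

theorem mem_of_ordered_prod_mul_mem {J : Submodule k (TaftAlgebra k q l n)}
    (hJ : ∀ i, ∀ v ∈ J, deriv q l i v ∈ J) (a : Fin n → Fin l) {h : TaftAlgebra k q l n}
    (hh : ∀ i, h ∈ derivKer q l i) : ∀ L : List (Fin n), L.Nodup →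
      (L.map fun i => x q l i ^ (a i : ℕ)).prod * h ∈ J → h ∈ J := by
  intro L
  induction L with
  | nil => simp
  | cons i L ih =>
    intro hL hmem
    rw [List.nodup_cons] at hL
    rw [List.map_cons, List.prod_cons, mul_assoc] at hmem
    refine ih hL.2 (mem_of_x_pow_mul_mem hJ i (mul_mem (list_prod_mem ?_) (hh i)) _ (a i).2 hmem)
    intro y hy
    obtain ⟨j, hj, rfl⟩ := List.mem_map.1 hy
    have hij : i ≠ j := by rintro rfl; exact hL.1 hj
    by_cases hl1 : 1 < l
    · refine pow_mem (mem_derivKer.2 ?_) _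
      rw [deriv_x q l hl1, if_neg hij]
    · rw [show (a j : ℕ) = 0 by omega, pow_zero]
      exact one_mem _

variable (q) in
/-- The ordered monomial `x^a g^b`. -/
noncomputable def monomial (s : (Fin n → Fin l) × (Fin n → Fin l)) : TaftAlgebra k q l n :=
  ((List.finRange n).map fun i => x q l i ^ (s.1 i : ℕ)).prod *
    ((List.finRange n).map fun i => g q l i ^ (s.2 i : ℕ)).prod

theorem monomial_notMem {J : Submodule k (TaftAlgebra k q l n)}
    (hJ : ∀ i, ∀ v ∈ J, deriv q l i v ∈ J) (hε : ∀ v ∈ J, Coalgebra.counit (R := k) v = 0)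
    (s : (Fin n → Fin l) × (Fin n → Fin l)) : monomial q s ∉ J := by
  intro h
  have h1 := hε _ (mem_of_ordered_prod_mul_mem hJ s.1 ?_ _ (List.nodup_finRange n) h)
  · have h2 : ∀ L : List (Fin n), Coalgebra.counit (R := k)
        ((L.map fun i => g q l i ^ (s.2 i : ℕ)).prod) = 1 := by
      intro L
      induction L with
      | nil => simp
      | cons i L ih => rw [List.map_cons, List.prod_cons, Bialgebra.counit_mul, ih,
          Bialgebra.counit_pow, counit_g, one_pow, one_mul]
    rw [h2] at h1
    exact one_ne_zero h1
  · intro i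
    refine list_prod_mem fun y hy => ?_
    obtain ⟨j, _, rfl⟩ := List.mem_map.1 hy
    exact pow_mem (mem_derivKer.2 (deriv_g q l i j)) _

theorem list_prod_smul {ι A : Type*} [Ring A] [Algebra k A] (d : ι → k) (y : ι → A) :
    ∀ L : List ι, (L.map fun i => d i • y i).prod = (L.map d).prod • (L.map y).prod := by
  intro L
  induction L with
  | nil => simp
  | cons i L ih => simp [ih, smul_smul, mul_comm]

omit hq hl in
theorem map_ordered_prod (F : TaftAlgebra k q l n →ₐ[k] TaftAlgebra k q l n)
    (y : Fin n → TaftAlgebra k q l n) (c : Fin n → k) (hF : ∀ i, F (y i) = c i • y i)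
    (a : Fin n → Fin l) : F ((List.finRange n).map fun i => y i ^ (a i : ℕ)).prod =
      (∏ i, c i ^ (a i : ℕ)) • ((List.finRange n).map fun i => y i ^ (a i : ℕ)).prod := by
  rw [map_list_prod, List.map_map, Fin.prod_univ_def, ← list_prod_smul]
  congr 1
  refine List.map_congr_left fun i _ => ?_
  rw [Function.comp_apply, map_pow, hF, smul_pow]

omit hl in
theorem single_pow (i j : Fin n) : (if i = j then q else 1) ^ l = 1 := by
  split_ifs
  · exact hq.out.pow_eq_one
  · exact one_pow l

variable (q l) in
/-- The character `x j ↦ 0`, `g i ↦ q`, `g j ↦ 1` for `j ≠ i`. -/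
noncomputable def singleChar (i : Fin n) : TaftAlgebra k q l n →ₐ[k] k :=
  torusChar q l (single_pow (q := q) (l := l) i)

omit hq hl in
theorem prod_single (i : Fin n) (a : Fin n → Fin l) :
    ∏ j, (if i = j then q else 1) ^ (a j : ℕ) = q ^ (a i : ℕ) := by
  simp [ite_pow]

theorem translateL_monomial (i : Fin n) (s : (Fin n → Fin l) × (Fin n → Fin l)) :
    translateL (singleChar q l i) (monomial q s) =
      q ^ ((s.1 i : ℕ) + s.2 i) • monomial q s := by
  have h1 := map_ordered_prod (translateL (singleChar q l i)) (x q l) _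
    (fun j => translateL_x (torusChar_x _) j) s.1
  have h2 := map_ordered_prod (translateL (singleChar q l i)) (g q l) _
    (fun j => translateL_g (singleChar q l i) j) s.2
  have h3 : ∀ j, singleChar q l i (g q l j) = if i = j then q else 1 := torusChar_g _
  simp only [torusChar_g, h3, prod_single] at h1 h2
  rw [monomial, map_mul, h1, h2, smul_mul_smul_comm, pow_add]

theorem translateR_monomial (i : Fin n) (s : (Fin n → Fin l) × (Fin n → Fin l)) :
    translateR (singleChar q l i) (monomial q s) = q ^ (s.2 i : ℕ) • monomial q s := by
  have h1 := map_ordered_prod (translateR (singleChar q l i)) (x q l) (fun _ => 1)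
    (fun j => (translateR_x (torusChar_x _) j).trans (one_smul k _).symm) s.1
  have h2 := map_ordered_prod (translateR (singleChar q l i)) (g q l) _
    (fun j => translateR_g (singleChar q l i) j) s.2
  have h3 : ∀ j, singleChar q l i (g q l j) = if i = j then q else 1 := torusChar_g _
  simp only [h3, prod_single, one_pow, Finset.prod_const_one, one_smul] at h1 h2
  rw [monomial, map_mul, h1, h2, mul_smul_comm]

/-- The monomials are linearly independent modulo every subspace of the augmentation ideal that
is stable under the `q`-derivatives and the translations by characters. -/
theorem coeff_eq_zero_of_sum_mem {J : Submodule k (TaftAlgebra k q l n)}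
    (hJ : ∀ i, ∀ v ∈ J, deriv q l i v ∈ J) (hε : ∀ v ∈ J, Coalgebra.counit (R := k) v = 0)
    (hL : ∀ χ : TaftAlgebra k q l n →ₐ[k] k, ∀ v ∈ J, translateL χ v ∈ J)
    (hR : ∀ χ : TaftAlgebra k q l n →ₐ[k] k, ∀ v ∈ J, translateR χ v ∈ J)
    (w : (Fin n → Fin l) × (Fin n → Fin l) → k) (hw : ∑ s, w s • monomial q s ∈ J) :
    ∀ s, w s = 0 := by
  classical
  intro s
  -- the left translations detect the exponents `a i + b i`, the right translations `b i`
  have h1 := J.mem_of_sum_mem_of_eigenvector (σ := (Fin n → Fin l) × (Fin n → Fin l))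
    (Sum.elim (fun i : Fin n => (translateL (singleChar q l i)).toLinearMap)
      fun i : Fin n => (translateR (singleChar q l i)).toLinearMap)
    (by rintro (i | i); exacts [hL _, hR _])
    (Sum.elim (fun i s => q ^ ((s.1 i : ℕ) + s.2 i)) fun i s => q ^ (s.2 i : ℕ))
    (by
      intro s s' hs
      by_contra! hcon
      have hb : s.2 = s'.2 := funext fun i =>
        Fin.ext (hq.out.pow_inj (s.2 i).2 (s'.2 i).2 (hcon (Sum.inr i)))
      refine hs (Prod.ext (funext fun i => Fin.ext ?_) hb)
      have h := hcon (Sum.inl i)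
      simp only [Sum.elim_inl, hb, pow_add] at h
      exact hq.out.pow_inj (s.1 i).2 (s'.1 i).2
        (mul_right_cancel₀ (pow_ne_zero _ (hq.out.ne_zero hl.out)) h))
    (fun s => w s • monomial q s)
    (by
      rintro (i | i) s
      · exact (map_smul _ _ _).trans
          ((congrArg _ (translateL_monomial i s)).trans (smul_comm _ _ _))
      · exact (map_smul _ _ _).trans
          ((congrArg _ (translateR_monomial i s)).trans (smul_comm _ _ _)))
    Finset.univ hw s (Finset.mem_univ s)
  by_contra h
  have h2 := J.smul_mem (w s)⁻¹ h1
  rw [smul_smul, inv_mul_cancel₀ h, one_smul] at h2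
  exact monomial_notMem hJ hε s h2

theorem linearIndependent_monomial :
    LinearIndependent k (monomial (k := k) (n := n) (l := l) q) := by
  rw [Fintype.linearIndependent_iff]
  intro w hw
  refine coeff_eq_zero_of_sum_mem (J := ⊥) ?_ ?_ ?_ ?_ w ((Submodule.mem_bot k).2 hw) <;>
    simp

omit hl in
theorem card_exponents : Fintype.card ((Fin n → Fin l) × (Fin n → Fin l)) = l ^ (2 * n) := by
  rw [Fintype.card_prod, Fintype.card_fun, Fintype.card_fin, Fintype.card_fin, two_mul, pow_add]

theorem finrank_eq : Module.finrank k (TaftAlgebra k q l n) = l ^ (2 * n) := by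
  classical
  refine le_antisymm ?_ ?_
  · refine (finrank_le_of_qcommuting (Sum.elim (x q l) (g q l)) l hl.out ?_ ?_ ?_).trans ?_
    · rw [Set.Sum.elim_range]
      exact adjoin_gens q l n
    · rintro (i | i) (j | j)
      · exact ⟨_, x_mul_x q l i j⟩
      · refine ⟨(taftTheta q j i * q ^ (if j = i then 1 else 0))⁻¹, ?_⟩
        have h0 : taftTheta q j i * q ^ (if j = i then 1 else 0) ≠ 0 := by
          intro h0
          have := weight_pow (n := n) hq.out.pow_eq_one i j
          rw [weight, h0, zero_pow hl.out] at this
          exact zero_ne_one this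
        simp only [Sum.elim_inl, Sum.elim_inr]
        rw [g_mul_x, smul_smul, inv_mul_cancel₀ h0, one_smul]
      · exact ⟨_, g_mul_x q l i j⟩
      · exact ⟨1, by rw [one_smul]; exact g_mul_g q l i j⟩
    · rintro (i | i)
      · exact ⟨0, by rw [map_zero]; exact x_pow q l i⟩
      · exact ⟨1, by rw [map_one]; exact g_pow q l i⟩
    · simp [two_mul]
  · rw [← card_exponents]
    exact linearIndependent_monomial.fintype_card_le_finrank

theorem span_monomial : Submodule.span k (Set.range (monomial (k := k) (n := n) (l := l) q)) = ⊤ :=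
  linearIndependent_monomial.span_eq_top_of_card_eq_finrank'
    (by rw [card_exponents, finrank_eq])

variable (q l n) in
/-- The dual of the Taft algebra is generated by the characters and the functionals dual to the
`x i`. -/
theorem adjoin_dual : Algebra.adjoin k (Set.range (ofChar (H := TaftAlgebra k q l n)) ∪
    Set.range (skewDual q l)) = ⊤ := by
  set B := Algebra.adjoin k (Set.range (ofChar (H := TaftAlgebra k q l n)) ∪
    Set.range (skewDual q l)) with hB
  set Φ : Submodule k (Module.Dual k (TaftAlgebra k q l n)) :=
    (Subalgebra.toSubmodule B).map (toDual k _).toLinearMap with hΦ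
  have hmem : ∀ v, v ∈ Φ.dualCoannihilator ↔ ∀ f ∈ B, toDual k _ f v = 0 := by
    intro v
    rw [Submodule.mem_dualCoannihilator]
    constructor
    · exact fun h f hf => h _ (Submodule.mem_map_of_mem hf)
    · rintro h _ ⟨f, hf, rfl⟩
      exact h f hf
  have hchar : ∀ χ, ofChar χ ∈ B := fun χ => Algebra.subset_adjoin (Or.inl ⟨χ, rfl⟩)
  have h0 : Φ.dualCoannihilator = ⊥ := by
    rw [eq_bot_iff]
    intro v hv
    obtain ⟨w, rfl⟩ := (Submodule.mem_span_range_iff_exists_fun k).1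
      (span_monomial (q := q) (l := l) (n := n) ▸ Submodule.mem_top : v ∈ _)
    rw [Submodule.mem_bot]
    refine Finset.sum_eq_zero fun s _ => ?_
    rw [coeff_eq_zero_of_sum_mem (J := Φ.dualCoannihilator) ?_ ?_ ?_ ?_ w hv, zero_smul]
    · intro i v hv
      rw [hmem] at hv ⊢
      intro f hf
      rw [deriv, ← toDual_mul_eq_contractL]
      exact hv _ (mul_mem (Algebra.subset_adjoin (Or.inr ⟨i, rfl⟩)) hf)
    · intro v hv
      exact (hmem v).1 hv 1 (one_mem B)
    · intro χ v hv
      rw [hmem] at hv ⊢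
      intro f hf
      rw [← toDual_ofChar_mul]
      exact hv _ (mul_mem (hchar χ) hf)
    · intro χ v hv
      rw [hmem] at hv ⊢
      intro f hf
      rw [← toDual_mul_ofChar]
      exact hv _ (mul_mem hf (hchar χ))
  have h1 : Φ = ⊤ := by
    rw [← Subspace.dualCoannihilator_dualAnnihilator_eq (W := Φ), h0,
      Submodule.dualAnnihilator_bot]
  rw [eq_top_iff]
  intro f _
  obtain ⟨f', hf', h⟩ : toDual k _ f ∈ Φ := h1 ▸ Submodule.mem_top
  rwa [← (toDual k _).injective h]

end

end TaftAlgebra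

/-! ### The double of the Taft algebra -/

namespace PointedCoalgebra

theorem IsSkewPrimitive.map {k C D : Type*} [Field k] [Ring C] [Bialgebra k C] [Ring D]
    [Bialgebra k D] {x : C} (hx : IsSkewPrimitive k x) (F : C →ₗc[k] D) :
    IsSkewPrimitive k (F x) := by
  obtain ⟨g, h, hg, hh, e⟩ := hx
  refine ⟨F g, F h, hg.map F, hh.map F, ?_⟩
  rw [← CoalgHomClass.map_comp_comul_apply, e]
  simp

end PointedCoalgebra

namespace DrinfeldDouble

open DualCop PointedCoalgebra

variable (k H : Type*) [Field k] [Ring H] [HopfAlgebra k H] [Module.Finite k H]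
  [HasBijectiveAntipode k H]

/-- `inclH` as a coalgebra map. -/
noncomputable def inclHCoalg : H →ₗc[k] DrinfeldDouble k H where
  toLinearMap := (inclH k H).toLinearMap
  counit_comp := LinearMap.ext counit_inclH
  map_comp_comul := LinearMap.ext fun h => (comul_inclH h).symm

/-- `inclDual` as a coalgebra map. -/
noncomputable def inclDualCoalg : DualCop k H →ₗc[k] DrinfeldDouble k H where
  toLinearMap := (inclDual k H).toLinearMap
  counit_comp := LinearMap.ext counit_inclDual
  map_comp_comul := LinearMap.ext fun h => (comul_inclDual h).symm

variable {k H}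

theorem isGroupLikeElem_inclH {a : H} (ha : IsGroupLikeElem k a) :
    IsGroupLikeElem k (inclH k H a) := ha.map (inclHCoalg k H)

theorem isGroupLikeElem_inclDual {f : DualCop k H} (hf : IsGroupLikeElem k f) :
    IsGroupLikeElem k (inclDual k H f) := hf.map (inclDualCoalg k H)

theorem isSkewPrimitive_inclH {a : H} (ha : IsSkewPrimitive k a) :
    IsSkewPrimitive k (inclH k H a) := ha.map (inclHCoalg k H)

theorem isSkewPrimitive_inclDual {f : DualCop k H} (hf : IsSkewPrimitive k f) :
    IsSkewPrimitive k (inclDual k H f) := hf.map (inclDualCoalg k H)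

theorem adjoin_eq_top {s : Set H} {t : Set (DualCop k H)} (hs : Algebra.adjoin k s = ⊤)
    (ht : Algebra.adjoin k t = ⊤) :
    Algebra.adjoin k (inclH k H '' s ∪ inclDual k H '' t) = ⊤ := by
  rw [eq_top_iff]
  intro d _
  induction d using induction_mul with
  | h0 => exact zero_mem _
  | hadd x y hx hy => exact add_mem (hx trivial) (hy trivial)
  | hmul f h =>
    refine mul_mem (Algebra.adjoin_mono Set.subset_union_right ?_)
      (Algebra.adjoin_mono Set.subset_union_left ?_)
    · rw [← AlgHom.map_adjoin, ht]
      exact ⟨f, trivial, rfl⟩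
    · rw [← AlgHom.map_adjoin, hs]
      exact ⟨h, trivial, rfl⟩

end DrinfeldDouble

namespace TaftAlgebra

open DualCop DrinfeldDouble PointedCoalgebra

variable {k : Type*} [Field k] {q : k} {l n : ℕ} [hq : Fact (IsPrimitiveRoot q l)]
  [hl : NeZero l]

theorem isGroupLikeElem_g (i : Fin n) : IsGroupLikeElem k (g q l i) :=
  ⟨counit_g q l i, comul_g q l i⟩

theorem isSkewPrimitive_x (i : Fin n) : IsSkewPrimitive k (x q l i) :=
  ⟨g q l i, 1, isGroupLikeElem_g i, IsGroupLikeElem.one, comul_x q l i⟩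

theorem isSkewPrimitive_skewDual (i : Fin n) : IsSkewPrimitive k (skewDual q l i) :=
  ⟨1, _, IsGroupLikeElem.one, isGroupLikeElem_ofChar _,
    (isCharDerivation_skewDual q l i).comul_eq⟩

variable (q l n) in
/-- Grouplike and skew-primitive generators of the double of the Taft algebra. -/
def doubleGens : Set (DrinfeldDouble k (TaftAlgebra k q l n)) :=
  inclH k _ '' gens q l n ∪ inclDual k _ ''
    (Set.range (ofChar (H := TaftAlgebra k q l n)) ∪ Set.range (skewDual q l))

theorem adjoin_doubleGens : Algebra.adjoin k (doubleGens q l n) = ⊤ :=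
  adjoin_eq_top (adjoin_gens q l n) (adjoin_dual q l n)

theorem isGroupLikeElem_or_isSkewPrimitive {d : DrinfeldDouble k (TaftAlgebra k q l n)}
    (hd : d ∈ doubleGens q l n) : IsGroupLikeElem k d ∨ IsSkewPrimitive k d := by
  rcases hd with ⟨_, ⟨i, rfl⟩ | ⟨i, rfl⟩, rfl⟩ | ⟨_, ⟨χ, rfl⟩ | ⟨i, rfl⟩, rfl⟩
  · exact Or.inr (isSkewPrimitive_inclH (isSkewPrimitive_x i))
  · exact Or.inl (isGroupLikeElem_inclH (isGroupLikeElem_g i))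
  · exact Or.inl (isGroupLikeElem_inclDual (isGroupLikeElem_ofChar χ))
  · exact Or.inr (isSkewPrimitive_inclDual (isSkewPrimitive_skewDual i))

theorem adjoin_image_mkₐ (I : Ideal (DrinfeldDouble k (TaftAlgebra k q l n))) [I.IsTwoSided] :
    Algebra.adjoin k (Ideal.Quotient.mkₐ k I '' doubleGens q l n) = ⊤ := by
  rw [← AlgHom.map_adjoin, adjoin_doubleGens, Algebra.map_top, AlgHom.range_eq_top]
  exact Ideal.Quotient.mk_surjective

theorem isPointedCoalgebra_quotient (I : Ideal (DrinfeldDouble k (TaftAlgebra k q l n)))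
    [I.IsTwoSided] [I.IsHopfIdeal k] :
    IsPointedCoalgebra k (DrinfeldDouble k (TaftAlgebra k q l n) ⧸ I) := by
  refine isPointedCoalgebra_of_adjoin (adjoin_image_mkₐ I) ?_
  rintro _ ⟨d, hd, rfl⟩
  exact (isGroupLikeElem_or_isSkewPrimitive hd).imp
    (fun h => h.map (Bialgebra.Quotient.mkBialgHom (R := k) I))
    (fun h => IsSkewPrimitive.map h (CoalgHomClass.toCoalgHom
      (Bialgebra.Quotient.mkBialgHom (R := k) I)))

variable (q l n) in
/-- The character `χ` with `χ(x i) = 0` and `χ(g i) = q`. -/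
noncomputable def rootChar : TaftAlgebra k q l n →ₐ[k] k :=
  character q hl.out n q hq.out.pow_eq_one

theorem rootChar_x (i : Fin n) : rootChar q l n (x q l i) = 0 := character_x ..

theorem rootChar_g (i : Fin n) : rootChar q l n (g q l i) = q := character_g ..

theorem weight_last (hn : 0 < n) (i : Fin n) :
    weight q i ⟨n - 1, Nat.sub_lt hn Nat.one_pos⟩ = q := by
  rcases eq_or_ne i ⟨n - 1, Nat.sub_lt hn Nat.one_pos⟩ with h | h
  · rw [h, weight_self]
  · have h1 : i < ⟨n - 1, Nat.sub_lt hn Nat.one_pos⟩ := by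
      rw [Fin.lt_def]
      have := i.2
      have h2 : (i : ℕ) ≠ n - 1 := fun h' => h (Fin.ext h')
      simp only
      omega
    simp [weight, taftTheta, h1, h.symm]

theorem exists_ofChar_eq_rootChar_pow (m : ℕ) : ∃ χ : TaftAlgebra k q l n →ₐ[k] k,
    ofChar (rootChar q l n) ^ m = ofChar χ ∧ (∀ i, χ (x q l i) = 0) ∧
      ∀ i, χ (g q l i) = q ^ m := by
  induction m with
  | zero =>
    refine ⟨Bialgebra.counitAlgHom k _, ?_, fun i => counit_x q l i, fun i => ?_⟩
    · rw [pow_zero]; rfl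
    · rw [pow_zero]; exact counit_g q l i
  | succ m ih =>
    obtain ⟨χ, h, hx, hg⟩ := ih
    refine ⟨χ.comp (translateL (rootChar q l n)), ?_, fun i => ?_, fun i => ?_⟩
    · rw [pow_succ', h]
      refine DualCop.ext fun a => ?_
      rw [toDual_ofChar_mul]; rfl
    · rw [AlgHom.comp_apply, translateL_x rootChar_x, map_smul, hx, smul_zero]
    · rw [AlgHom.comp_apply, translateL_g, rootChar_g, map_smul, hg, smul_eq_mul, pow_succ']

theorem ofChar_rootChar_pow : ofChar (rootChar q l n) ^ l = 1 := by
  obtain ⟨χ, h, hx, hg⟩ := exists_ofChar_eq_rootChar_pow (q := q) (l := l) (n := n) l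
  rw [h]
  have : χ = Bialgebra.counitAlgHom k _ := hom_ext (fun i => (hx i).trans (counit_x q l i).symm)
    fun i => ((hg i).trans hq.out.pow_eq_one).trans (counit_g q l i).symm
  rw [this]
  rfl

theorem isCentralPair [CharZero k] (hn : 0 < n) :
    IsCentralPair (rootChar q l n) (g q l ⟨n - 1, Nat.sub_lt hn Nat.one_pos⟩) l where
  groupLike := isGroupLikeElem_g _
  char_pow := ofChar_rootChar_pow
  pow_eq_one := g_pow q l _
  comm h := by
    have hh : h ∈ Algebra.adjoin k (gens q l n) := adjoin_gens q l n ▸ Algebra.mem_top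
    induction hh using Algebra.adjoin_induction with
    | mem a ha =>
      rcases ha with ⟨i, rfl⟩ | ⟨i, rfl⟩
      · rw [translateL_x rootChar_x, translateR_x rootChar_x, rootChar_g, g_mul_x, smul_mul_assoc]
        exact congrArg (· • _) (weight_last hn i).symm
      · rw [translateL_g, translateR_g, rootChar_g, smul_mul_assoc, mul_smul_comm, g_mul_g]
    | algebraMap r =>
      rw [AlgHom.commutes, AlgHom.commutes, Algebra.commutes]
    | add a b _ _ ha hb => rw [map_add, map_add, add_mul, mul_add, ha, hb]
    | mul a b _ _ ha hb => rw [map_mul, map_mul, mul_assoc, hb, ← mul_assoc, ha, mul_assoc]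
  ne_zero := Nat.cast_ne_zero.2 hl.out

theorem chiG_eq (hn : 0 < n) : chiG q l n hn =
    pairElem (rootChar q l n) (g q l ⟨n - 1, Nat.sub_lt hn Nat.one_pos⟩) :=
  (inclDual_mul_inclH _ _).symm

end TaftAlgebra

/-! ### The small quantum group -/

namespace SmallQuantumGroup

variable {k : Type*} [Field k] {p : k} {l : ℕ}

theorem exists_K_mul_F_pow (a : ℕ) : ∃ c : k, K p l * F p l ^ a = c • (F p l ^ a * K p l) :=
  ⟨_, QBinom.pow_mul_of_mul (K_mul_F p l) a⟩

theorem exists_E_mul_K_pow (hp : p ≠ 0) (b : ℕ) :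
    ∃ c : k, E p l * K p l ^ b = c • (K p l ^ b * E p l) := by
  have h : E p l * K p l = (p ^ 2)⁻¹ • (K p l * E p l) := by
    rw [K_mul_E, smul_smul, inv_mul_cancel₀ (pow_ne_zero 2 hp), one_smul]
  exact ⟨_, QBinom.pow_mul_of_mul h b⟩

/-- The small quantum group is spanned by the `l ^ 3` monomials `F^a K^b E^c`. -/
theorem span_monomials (hp : p ≠ 0) (hl : l ≠ 0) :
    Submodule.span k (Set.range fun s : Fin l × Fin l × Fin l =>
      F p l ^ (s.1 : ℕ) * (K p l ^ (s.2.1 : ℕ) * E p l ^ (s.2.2 : ℕ))) = ⊤ := by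
  set S := Submodule.span k (Set.range fun s : ℕ × ℕ × ℕ =>
    F p l ^ s.1 * (K p l ^ s.2.1 * E p l ^ s.2.2)) with hS
  have hmem : ∀ a b c : ℕ, F p l ^ a * (K p l ^ b * E p l ^ c) ∈ S := fun a b c =>
    Submodule.subset_span ⟨(a, b, c), rfl⟩
  have hF : ∀ s ∈ S, F p l * s ∈ S := by
    intro s hs
    induction hs using Submodule.span_induction with
    | zero => simp
    | add s t _ _ hs ht => rw [mul_add]; exact add_mem hs ht
    | smul r s _ hs => rw [mul_smul_comm]; exact S.smul_mem _ hs
    | mem s hs =>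
      obtain ⟨⟨a, b, c⟩, rfl⟩ := hs
      simp only
      rw [← mul_assoc, ← pow_succ']
      exact hmem _ _ _
  have hK : ∀ s ∈ S, K p l * s ∈ S := by
    intro s hs
    induction hs using Submodule.span_induction with
    | zero => simp
    | add s t _ _ hs ht => rw [mul_add]; exact add_mem hs ht
    | smul r s _ hs => rw [mul_smul_comm]; exact S.smul_mem _ hs
    | mem s hs =>
      obtain ⟨⟨a, b, c⟩, rfl⟩ := hs
      simp only
      obtain ⟨d, hd⟩ := exists_K_mul_F_pow (p := p) (l := l) a
      rw [← mul_assoc, hd, smul_mul_assoc, mul_assoc, ← mul_assoc (K p l), ← pow_succ']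
      exact S.smul_mem _ (hmem _ _ _)
  have hKpow : ∀ m : ℕ, ∀ s ∈ S, K p l ^ m * s ∈ S := by
    intro m
    induction m with
    | zero => simp
    | succ m ih => intro s hs; rw [pow_succ', mul_assoc]; exact hK _ (ih s hs)
  have hE : ∀ s ∈ S, E p l * s ∈ S := by
    intro s hs
    induction hs using Submodule.span_induction with
    | zero => simp
    | add s t _ _ hs ht => rw [mul_add]; exact add_mem hs ht
    | smul r s _ hs => rw [mul_smul_comm]; exact S.smul_mem _ hs
    | mem s hs =>
      obtain ⟨⟨a, b, c⟩, rfl⟩ := hs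
      simp only
      induction a with
      | zero =>
        obtain ⟨d, hd⟩ := exists_E_mul_K_pow (l := l) hp b
        rw [pow_zero, one_mul, ← mul_assoc, hd, smul_mul_assoc, mul_assoc, ← pow_succ',
          ← one_mul (K p l ^ b * _), ← pow_zero (F p l)]
        exact S.smul_mem _ (hmem _ _ _)
      | succ a ih =>
        have h : E p l * F p l = F p l * E p l + (p - p⁻¹)⁻¹ • (K p l - KInv p l) := by
          rw [← E_mul_F]; abel
        rw [pow_succ', mul_assoc (F p l), ← mul_assoc (E p l), h, add_mul, smul_mul_assoc, sub_mul,
          mul_assoc (F p l)]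
        exact add_mem (hF _ ih) (S.smul_mem _ (sub_mem (hK _ (hmem _ _ _))
          (hKpow _ _ (hmem _ _ _))))
  have htop : ∀ u : SmallQuantumGroup k p l, u ∈ S := by
    have hsub : ∀ u ∈ Algebra.adjoin k (gens p l), ∀ s ∈ S, u * s ∈ S := by
      intro u hu
      induction hu using Algebra.adjoin_induction with
      | mem u hu =>
        rcases hu with rfl | rfl | rfl
        exacts [hE, hF, hK]
      | algebraMap r =>
        intro s hs
        rw [Algebra.algebraMap_eq_smul_one, smul_mul_assoc, one_mul]; exact S.smul_mem _ hs
      | add x y _ _ hx hy => intro s hs; rw [add_mul]; exact add_mem (hx s hs) (hy s hs)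
      | mul x y _ _ hx hy => intro s hs; rw [mul_assoc]; exact hx _ (hy s hs)
    intro u
    rw [← mul_one u]
    refine hsub u (adjoin_gens p l ▸ Algebra.mem_top) 1 ?_
    have := hmem 0 0 0
    simpa using this
  rw [eq_top_iff]
  refine le_trans (fun u _ => htop u) (Submodule.span_le.2 ?_)
  rintro _ ⟨⟨a, b, c⟩, rfl⟩
  simp only
  by_cases ha : a < l
  · by_cases hc : c < l
    · have hb : K p l ^ b = K p l ^ (b % l) := by
        conv_lhs => rw [← Nat.div_add_mod b l, pow_add, pow_mul, K_pow, one_pow, one_mul]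
      rw [hb]
      exact Submodule.subset_span
        ⟨(⟨a, ha⟩, ⟨b % l, Nat.mod_lt _ (Nat.pos_of_ne_zero hl)⟩, ⟨c, hc⟩), rfl⟩
    · rw [pow_eq_zero_of_le (not_lt.1 hc) (E_pow p l), mul_zero, mul_zero]
      exact zero_mem _
  · rw [pow_eq_zero_of_le (not_lt.1 ha) (F_pow p l), zero_mul]
    exact zero_mem _

theorem finite (hp : p ≠ 0) (hl : l ≠ 0) : Module.Finite k (SmallQuantumGroup k p l) :=
  ⟨span_monomials hp hl ▸ Submodule.fg_span (Set.finite_range _)⟩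

theorem finrank_le (hp : p ≠ 0) (hl : l ≠ 0) :
    Module.finrank k (SmallQuantumGroup k p l) ≤ l ^ 3 := by
  rw [← finrank_top k, ← span_monomials hp hl]
  refine (finrank_range_le_card _).trans (le_of_eq ?_)
  simp only [Fintype.card_prod, Fintype.card_fin]
  ring

/-- The relations of the small quantum group, from those of a double in which `c = d⁻¹`. -/
theorem rels_of_double {B : Type*} [Ring B] [Algebra k B] {q : k} (hpq : p ^ 2 = q) (hp : p ≠ 0)
    (hl : l ≠ 0) {a b c d : B} (hcd : c * d = 1) (hd : d ^ l = 1) (ha : a ^ l = 0) (hb : b ^ l = 0)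
    (hda : d * a = q⁻¹ • (a * d)) (hdb : d * b = q • (b * d)) (hab : b * a + d = c + a * b) :
    Rels p l (-(p - p⁻¹)⁻¹ • a) b c := by
  have hq : q ≠ 0 := hpq ▸ pow_ne_zero 2 hp
  obtain ⟨m, rfl⟩ : ∃ m, l = m + 1 := ⟨l - 1, by omega⟩
  have hc : c = d ^ m := by
    rw [← mul_one c, ← hd, pow_succ', ← mul_assoc, hcd, one_mul]
  have hdc : d * c = 1 := by rw [hc, ← pow_succ', hd]
  have hcl : c ^ (m + 1) = 1 := by rw [hc, ← pow_mul, mul_comm, pow_mul, hd, one_pow]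
  have hcm : c ^ m = d := by
    rw [← mul_one (c ^ m), ← hcd, ← mul_assoc, ← pow_succ, hcl, one_mul]
  have flip : ∀ (r : k) (u : B), r ≠ 0 → d * u = r⁻¹ • (u * d) → c * u = r • (u * c) := by
    intro r u hr hu
    have h1 : u * d = r • (d * u) := by rw [hu, smul_smul, mul_inv_cancel₀ hr, one_smul]
    calc c * u = c * (u * d) * c := by rw [mul_assoc, mul_assoc, hdc, mul_one]
      _ = r • (u * c) := by
        rw [h1, mul_smul_comm, ← mul_assoc c, hcd, one_mul, smul_mul_assoc]
  refine ⟨hcl, ?_, hb, ?_, ?_, ?_⟩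
  · rw [smul_pow, ha, smul_zero]
  · rw [mul_smul_comm, flip q a hq hda, hpq, smul_mul_assoc, smul_comm]
  · rw [hpq]
    exact flip q⁻¹ b (inv_ne_zero hq) (by rw [inv_inv]; exact hdb)
  · rw [Nat.add_sub_cancel, hcm, smul_mul_assoc, mul_smul_comm, ← smul_sub, neg_smul, ← smul_neg]
    congr 1
    have : a * b = b * a + d - c := by rw [hab]; abel
    rw [this]; abel

end SmallQuantumGroup

/-! ### Rank one -/

namespace DrinfeldDouble

open DualCop

variable {k H : Type*} [Field k] [Ring H] [HopfAlgebra k H] [Module.Finite k H]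
  [HasBijectiveAntipode k H] (I : Ideal (DrinfeldDouble k H)) [I.IsTwoSided] [I.IsHopfIdeal k]

theorem comul_mkₐ (d : DrinfeldDouble k H) :
    Coalgebra.comul (R := k) (Ideal.Quotient.mkₐ k I d) =
      TensorProduct.map (Ideal.Quotient.mkₐ k I).toLinearMap
        (Ideal.Quotient.mkₐ k I).toLinearMap (Coalgebra.comul d) :=
  (CoalgHomClass.map_comp_comul_apply (Bialgebra.Quotient.mkBialgHom (R := k) I) d).symm

theorem counit_mkₐ (d : DrinfeldDouble k H) :
    Coalgebra.counit (R := k) (Ideal.Quotient.mkₐ k I d) = Coalgebra.counit (R := k) d := rfl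

theorem comul_mkₐ_inclH (h : H) :
    Coalgebra.comul (R := k) (Ideal.Quotient.mkₐ k I (inclH k H h)) = TensorProduct.map
      ((Ideal.Quotient.mkₐ k I).toLinearMap ∘ₗ (inclH k H).toLinearMap)
      ((Ideal.Quotient.mkₐ k I).toLinearMap ∘ₗ (inclH k H).toLinearMap) (Coalgebra.comul h) := by
  rw [comul_mkₐ, comul_inclH, TensorProduct.map_comp, LinearMap.comp_apply]

theorem comul_mkₐ_inclDual (f : DualCop k H) :
    Coalgebra.comul (R := k) (Ideal.Quotient.mkₐ k I (inclDual k H f)) = TensorProduct.map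
      ((Ideal.Quotient.mkₐ k I).toLinearMap ∘ₗ (inclDual k H).toLinearMap)
      ((Ideal.Quotient.mkₐ k I).toLinearMap ∘ₗ (inclDual k H).toLinearMap)
      (Coalgebra.comul f) := by
  rw [comul_mkₐ, comul_inclDual, TensorProduct.map_comp, LinearMap.comp_apply]

theorem counit_mkₐ_inclH (h : H) :
    Coalgebra.counit (R := k) (Ideal.Quotient.mkₐ k I (inclH k H h)) =
      Coalgebra.counit (R := k) h := by
  rw [counit_mkₐ, counit_inclH]

theorem counit_mkₐ_inclDual (f : DualCop k H) :
    Coalgebra.counit (R := k) (Ideal.Quotient.mkₐ k I (inclDual k H f)) =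
      Coalgebra.counit (R := k) f := by
  rw [counit_mkₐ, counit_inclDual]

end DrinfeldDouble

namespace TaftAlgebra

open DualCop DrinfeldDouble

variable {k : Type*} [Field k] {q : k} {l n : ℕ} [hq : Fact (IsPrimitiveRoot q l)]
  [hl : NeZero l]

theorem hitR_g_skewDual (i j : Fin n) :
    hitR k _ (g q l j) (skewDual q l i) = weight q i j • skewDual q l i := by
  refine DualCop.ext fun a => ?_
  rw [hitR_apply, (isCharDerivation_skewDual q l i).map_mul, skewDual_g, weightChar_g, zero_mul,
    add_zero, map_smul, LinearMap.smul_apply, smul_eq_mul]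

theorem hitL_g_skewDual (i j : Fin n) :
    hitL k _ (g q l j) (skewDual q l i) = skewDual q l i := by
  refine DualCop.ext fun a => ?_
  rw [hitL_apply, (isCharDerivation_skewDual q l i).map_mul, skewDual_g, counit_g, mul_one,
    mul_zero, zero_add]

theorem hitR_x_skewDual (hl1 : 1 < l) (i : Fin n) :
    hitR k _ (x q l i) (skewDual q l i) = 1 := by
  refine DualCop.ext fun a => ?_
  rw [hitR_apply, (isCharDerivation_skewDual q l i).map_mul, skewDual_x q l hl1, weightChar_x,
    zero_mul, zero_add, if_pos rfl, one_mul, DualCop.toDual_one]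

theorem hitL_x_skewDual (hl1 : 1 < l) (i : Fin n) :
    hitL k _ (x q l i) (skewDual q l i) = ofChar (weightChar q l i) := by
  refine DualCop.ext fun a => ?_
  rw [hitL_apply, (isCharDerivation_skewDual q l i).map_mul, skewDual_x q l hl1, counit_x,
    mul_zero, add_zero, if_pos rfl, mul_one, toDual_ofChar]

theorem g_mul_skewDual (i j : Fin n) :
    weight q i j • (inclH k _ (g q l j) * inclDual k _ (skewDual q l i)) =
      inclDual k _ (skewDual q l i) * inclH k _ (g q l j) := by
  have h := crossR_comul (skewDual q l i) (g q l j)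
  rwa [comul_g, crossR_tmul, crossL_tmul, hitR_g_skewDual, hitL_g_skewDual, map_smul,
    mul_smul_comm] at h

theorem x_mul_skewDual (hl1 : 1 < l) (i : Fin n) :
    inclH k _ (x q l i) * inclDual k _ (skewDual q l i) + inclH k _ (g q l i) =
      inclDual k _ (ofChar (weightChar q l i)) +
        inclDual k _ (skewDual q l i) * inclH k _ (x q l i) := by
  have h := crossR_comul (skewDual q l i) (x q l i)
  have h1 : hitR k _ 1 (skewDual q l i) = skewDual q l i :=
    DualCop.ext fun a => by rw [hitR_apply, one_mul]
  rwa [comul_x, map_add, map_add, crossR_tmul, crossL_tmul, crossR_tmul, crossL_tmul,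
    hitL_g_skewDual, hitR_x_skewDual hl1, hitL_x_skewDual hl1, h1, map_one, map_one, mul_one,
    mul_one] at h

theorem toDual_skewDual_pow (i : Fin n) (m : ℕ) (a : TaftAlgebra k q l n) :
    toDual k _ (skewDual q l i ^ m) a = Coalgebra.counit (R := k) ((deriv q l i ^ m) a) := by
  induction m generalizing a with
  | zero => rfl
  | succ m ih =>
    rw [pow_succ', toDual_mul_eq_contractL, ih, pow_succ]; rfl

theorem deriv_pow_x_pow_mul (i : Fin n) {r : TaftAlgebra k q l n} (hr : r ∈ derivKer q l i)
    (m : ℕ) (hl1 : 1 < l) : (deriv q l i ^ (m + 1)) (x q l i ^ m * r) = 0 := by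
  induction m with
  | zero => simpa using mem_derivKer.1 hr
  | succ m ih =>
    rw [pow_succ, Module.End.mul_apply, deriv_mul, mem_derivKer.1 hr, mul_zero, zero_add,
      deriv_x_pow hl1, smul_mul_assoc, map_smul, ih, smul_zero]

theorem skewDual_pow (hl1 : 1 < l) (i : Fin 1) : skewDual q l i ^ l = 0 := by
  refine (toDual k _).injective (LinearMap.ext_on_range
    (v := monomial (k := k) (n := 1) (l := l) q) span_monomial fun s => ?_)
  have hm : monomial q s = x q l i ^ (s.1 i : ℕ) * g q l i ^ (s.2 i : ℕ) := by
    obtain rfl := Subsingleton.elim 0 i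
    simp [monomial, List.finRange_succ]
  obtain ⟨m, hm'⟩ : ∃ m, l = m + ((s.1 i : ℕ) + 1) := ⟨l - (s.1 i + 1), by omega⟩
  have h0 : (deriv q l i ^ l) (monomial q s) = 0 := by
    rw [show (deriv q l i ^ l) = deriv q l i ^ (m + ((s.1 i : ℕ) + 1)) by rw [← hm'], pow_add,
      Module.End.mul_apply, hm, deriv_pow_x_pow_mul i (pow_mem
        (mem_derivKer.2 (deriv_g q l i i)) _) _ hl1, map_zero]
  rw [toDual_skewDual_pow, h0]
  simp

/-- In rank one every character is a power of `rootChar`. -/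
theorem exists_ofChar_eq_pow (χ : TaftAlgebra k q l 1 →ₐ[k] k) :
    ∃ m, ofChar χ = ofChar (rootChar q l 1) ^ m := by
  have h1 : χ (g q l 0) ^ l = 1 := by rw [← map_pow, g_pow, map_one]
  obtain ⟨m, -, hm⟩ := hq.out.eq_pow_of_pow_eq_one h1
  obtain ⟨χ', h, hx, hg⟩ := exists_ofChar_eq_rootChar_pow (q := q) (l := l) (n := 1) m
  refine ⟨m, ?_⟩
  rw [h]
  congr 1
  refine hom_ext (fun i => ?_) fun i => ?_
  · rw [hx]
    refine eq_zero_of_pow_eq_zero (n := l) ?_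
    rw [← map_pow, x_pow, map_zero]
  · obtain rfl := Subsingleton.elim 0 i
    rw [hg, hm]

theorem weightChar_zero : weightChar q l (0 : Fin 1) = rootChar q l 1 := by
  refine hom_ext (fun i => ?_) fun i => ?_
  · rw [weightChar_x, rootChar_x]
  · obtain rfl := Subsingleton.elim 0 i
    rw [weightChar_g, rootChar_g, weight_self]

section

variable {p : k} [hp : Fact (IsPrimitiveRoot p l)] [ho : Fact (Odd l)]
  (I : Ideal (DrinfeldDouble k (TaftAlgebra k q l 1))) [I.IsTwoSided]

omit hp ho in
theorem mkₐ_inclH_g (hI : pairElem (rootChar q l 1) (g q l 0) - 1 ∈ I) :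
    Ideal.Quotient.mkₐ k I (inclH k _ (g q l 0)) =
      Ideal.Quotient.mkₐ k I (inclDual k _ (ofChar (rootChar q l 1))) ^ (l - 1) := by
  have h1 : Ideal.Quotient.mkₐ k I (inclDual k _ (ofChar (rootChar q l 1))) *
      Ideal.Quotient.mkₐ k I (inclH k _ (g q l 0)) = 1 := by
    rw [← map_mul, ← map_one (Ideal.Quotient.mkₐ k I)]
    exact Ideal.Quotient.eq.2 hI
  rw [← mul_one (_ ^ (l - 1)), ← h1, ← mul_assoc, ← pow_succ,
    Nat.sub_add_cancel (NeZero.pos l), ← map_pow, ← map_pow, ofChar_rootChar_pow, map_one,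
    map_one, one_mul]

omit ho in
/-- Images in `D(A)/I`, for `n = 1`, that satisfy the relations of the small quantum group:
`E ↦ -(p - p⁻¹)⁻¹ ξ`, `F ↦ x`, `K ↦ χ`. -/
theorem quotient_rels (hl1 : 1 < l) (hpq : p ^ 2 = q)
    (hI : pairElem (rootChar q l 1) (g q l 0) - 1 ∈ I) :
    SmallQuantumGroup.Rels p l
      (-(p - p⁻¹)⁻¹ • Ideal.Quotient.mkₐ k I (inclDual k _ (skewDual q l 0)))
      (Ideal.Quotient.mkₐ k I (inclH k _ (x q l 0)))
      (Ideal.Quotient.mkₐ k I (inclDual k _ (ofChar (rootChar q l 1)))) := by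
  have hq0 : q ≠ 0 := hq.out.ne_zero hl.out
  refine SmallQuantumGroup.rels_of_double hpq (hp.out.ne_zero hl.out) hl.out
    (d := Ideal.Quotient.mkₐ k I (inclH k _ (g q l 0))) ?_ ?_ ?_ ?_ ?_ ?_ ?_
  · rw [← map_mul, ← map_one (Ideal.Quotient.mkₐ k I)]
    exact Ideal.Quotient.eq.2 hI
  · rw [← map_pow, ← map_pow, g_pow, map_one, map_one]
  · rw [← map_pow, ← map_pow, skewDual_pow hl1, map_zero, map_zero]
  · rw [← map_pow, ← map_pow, x_pow, map_zero, map_zero]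
  · rw [← map_mul, ← map_mul, ← g_mul_skewDual, weight_self, map_smul, smul_smul,
      inv_mul_cancel₀ hq0, one_smul]
  · rw [← map_mul, ← map_mul, ← map_mul, ← map_mul, g_mul_x, map_smul, map_smul]
    exact congrArg (· • _) (weight_self 0)
  · rw [← map_mul, ← map_mul, ← map_add, ← map_add, x_mul_skewDual hl1, weightChar_zero]

omit ho in
theorem lift_surjective (hl1 : 1 < l) (hpq : p ^ 2 = q)
    (hI : pairElem (rootChar q l 1) (g q l 0) - 1 ∈ I) :
    Function.Surjective (SmallQuantumGroup.lift (quotient_rels I hl1 hpq hI)) := by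
  set φ := SmallQuantumGroup.lift (quotient_rels I hl1 hpq hI) with hφ
  have hE : φ _ = _ := SmallQuantumGroup.lift_E (quotient_rels I hl1 hpq hI)
  have hF : φ _ = _ := SmallQuantumGroup.lift_F (quotient_rels I hl1 hpq hI)
  have hK : φ _ = _ := SmallQuantumGroup.lift_K (quotient_rels I hl1 hpq hI)
  have hp0 : p - p⁻¹ ≠ 0 := by
    intro h
    have h1 : p ^ 2 = 1 := by
      rw [pow_two]
      nth_rewrite 2 [sub_eq_zero.1 h]
      exact mul_inv_cancel₀ (hp.out.ne_zero hl.out)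
    exact hq.out.ne_one hl1 (hpq ▸ h1)
  rw [← AlgHom.range_eq_top, eq_top_iff, ← adjoin_image_mkₐ I, Algebra.adjoin_le_iff]
  have hχ : Ideal.Quotient.mkₐ k I (inclDual k _ (ofChar (rootChar q l 1))) ∈ φ.range :=
    ⟨_, hK⟩
  rintro _ ⟨_, ⟨_, ⟨i, rfl⟩ | ⟨i, rfl⟩, rfl⟩ | ⟨_, ⟨χ, rfl⟩ | ⟨i, rfl⟩, rfl⟩, rfl⟩
  · obtain rfl := Subsingleton.elim 0 i
    exact ⟨_, hF⟩
  · obtain rfl := Subsingleton.elim 0 i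
    rw [SetLike.mem_coe, mkₐ_inclH_g I hI]
    exact pow_mem hχ _
  · obtain ⟨m, hm⟩ := exists_ofChar_eq_pow χ
    rw [SetLike.mem_coe, hm, map_pow, map_pow]
    exact pow_mem hχ _
  · obtain rfl := Subsingleton.elim 0 i
    have h1 := φ.range.smul_mem ⟨_, hE⟩ (-(p - p⁻¹))
    rwa [smul_smul, neg_mul_neg, mul_inv_cancel₀ hp0, one_smul] at h1

variable [I.IsHopfIdeal k]

/-- The algebra map `u_p(sl₂) → D(A)/I` is compatible with the coalgebra structures. -/
noncomputable def liftBialgHom (hl1 : 1 < l) (hpq : p ^ 2 = q)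
    (hI : pairElem (rootChar q l 1) (g q l 0) - 1 ∈ I) :
    SmallQuantumGroup k p l →ₐc[k] DrinfeldDouble k (TaftAlgebra k q l 1) ⧸ I := by
  have hE := SmallQuantumGroup.lift_E (quotient_rels I hl1 hpq hI)
  have hF := SmallQuantumGroup.lift_F (quotient_rels I hl1 hpq hI)
  have hK := SmallQuantumGroup.lift_K (quotient_rels I hl1 hpq hI)
  refine BialgHom.ofAlgHom (SmallQuantumGroup.lift (quotient_rels I hl1 hpq hI)) ?_ ?_
  · refine SmallQuantumGroup.hom_ext ?_ ?_ ?_ <;>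
      simp only [AlgHom.comp_apply, Bialgebra.counitAlgHom_apply]
    · rw [hE, map_smul, counit_mkₐ_inclDual, DualCop.counit_apply, skewDual_apply, map_one,
        SmallQuantumGroup.counit_E]
      simp
    · rw [hF, counit_mkₐ_inclH, counit_x, SmallQuantumGroup.counit_F]
    · rw [hK, counit_mkₐ_inclDual, DualCop.counit_apply, toDual_ofChar, map_one,
        SmallQuantumGroup.counit_K]
  · refine SmallQuantumGroup.hom_ext ?_ ?_ ?_ <;>
      simp only [AlgHom.comp_apply, Bialgebra.comulAlgHom_apply]
    · rw [hE, map_smul, comul_mkₐ_inclDual, (isCharDerivation_skewDual q l 0).comul_eq,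
        SmallQuantumGroup.comul_E, weightChar_zero]
      simp only [map_add, Algebra.TensorProduct.map_tmul, TensorProduct.map_tmul, hE, hK, map_one,
        LinearMap.comp_apply, AlgHom.toLinearMap_apply, smul_add, TensorProduct.smul_tmul',
        TensorProduct.tmul_smul]
      rw [add_comm]
    · rw [hF, comul_mkₐ_inclH, comul_x, SmallQuantumGroup.comul_F]
      simp only [map_add, Algebra.TensorProduct.map_tmul, TensorProduct.map_tmul, hF, hK, map_one,
        LinearMap.comp_apply, AlgHom.toLinearMap_apply, mkₐ_inclH_g I hI, SmallQuantumGroup.KInv,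
        map_pow]
      rw [add_comm]
    · rw [hK, comul_mkₐ_inclDual, (isGroupLikeElem_ofChar _).comul_eq_tmul_self,
        SmallQuantumGroup.comul_K]
      simp only [Algebra.TensorProduct.map_tmul, TensorProduct.map_tmul, hK,
        LinearMap.comp_apply, AlgHom.toLinearMap_apply]

/-- The quotient of the double of the Taft algebra of rank one by `χ g - 1` is the small quantum
group. -/
theorem nonempty_bialgEquiv (hl1 : 1 < l) (hpq : p ^ 2 = q)
    (hI : pairElem (rootChar q l 1) (g q l 0) - 1 ∈ I)
    (hdim : Module.finrank k (DrinfeldDouble k (TaftAlgebra k q l 1) ⧸ I) = l ^ 3) :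
    Nonempty ((DrinfeldDouble k (TaftAlgebra k q l 1) ⧸ I) ≃ₐc[k] SmallQuantumGroup k p l) := by
  have hp0 : p ≠ 0 := hp.out.ne_zero hl.out
  have := SmallQuantumGroup.finite hp0 hl.out
  have hsurj := lift_surjective I hl1 hpq hI
  set φ := SmallQuantumGroup.lift (quotient_rels I hl1 hpq hI) with hφ
  have hfr : Module.finrank k (SmallQuantumGroup k p l) =
      Module.finrank k (DrinfeldDouble k (TaftAlgebra k q l 1) ⧸ I) :=
    le_antisymm ((SmallQuantumGroup.finrank_le hp0 hl.out).trans hdim.ge)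
      (LinearMap.finrank_le_finrank_of_surjective (f := φ.toLinearMap) hsurj)
  have hinj : Function.Injective φ :=
    (LinearMap.injective_iff_surjective_of_finrank_eq_finrank (f := φ.toLinearMap) hfr).2 hsurj
  exact ⟨(BialgEquiv.ofBijective (liftBialgHom I hl1 hpq hI) ⟨hinj, hsurj⟩).symm⟩

end

end TaftAlgebra

/-! ### Factorizable quotients of doubles of Taft algebras -/

theorem proposition4p3 {k : Type*} [Field k] [IsAlgClosed k] [CharZero k] (n l : ℕ) (hn : 0 < n)
    [Fact (Odd l)] (q : k) [Fact (IsPrimitiveRoot q l)] :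
    ∃ (_ : (TaftAlgebra.idealI q l n hn).IsTwoSided)
      (_ : (TaftAlgebra.idealI q l n hn).IsHopfIdeal k),
      IsFactorizable k (DrinfeldDouble k (TaftAlgebra k q l n) ⧸ TaftAlgebra.idealI q l n hn)
        (TensorProduct.map (Ideal.Quotient.mkₐ k (TaftAlgebra.idealI q l n hn)).toLinearMap
          (Ideal.Quotient.mkₐ k (TaftAlgebra.idealI q l n hn)).toLinearMap
          (DrinfeldDouble.universalR k (TaftAlgebra k q l n))) ∧
      Module.finrank k
        (DrinfeldDouble k (TaftAlgebra k q l n) ⧸ TaftAlgebra.idealI q l n hn) =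
          l ^ (4 * n - 1) ∧
      IsPointedCoalgebra k
        (DrinfeldDouble k (TaftAlgebra k q l n) ⧸ TaftAlgebra.idealI q l n hn) ∧
      (n = 1 → 1 < l → ∀ (p : k) [Fact (IsPrimitiveRoot p l)], p ^ 2 = q →
        Nonempty ((DrinfeldDouble k (TaftAlgebra k q l n) ⧸ TaftAlgebra.idealI q l n hn) ≃ₐc[k]
          SmallQuantumGroup k p l)) := by
  have hp := TaftAlgebra.isCentralPair (q := q) (l := l) hn
  have hc : IsPrimitiveRoot (TaftAlgebra.rootChar q l n
      (TaftAlgebra.g q l ⟨n - 1, Nat.sub_lt hn Nat.one_pos⟩) ^ 2) l := by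
    rw [TaftAlgebra.rootChar_g]
    exact (Fact.out : IsPrimitiveRoot q l).pow_of_coprime 2
      (Nat.coprime_two_left.2 Fact.out)
  have hts := hp.isCentralGroupLike.isTwoSided
  have hhi := hp.isCentralGroupLike.isHopfIdeal
  have hfac := hp.isFactorizable hc
  have hdim := hp.finrank_quotient hc
  have hI : TaftAlgebra.idealI q l n hn = augmentationIdeal k (DrinfeldDouble.pairElem
      (TaftAlgebra.rootChar q l n) (TaftAlgebra.g q l ⟨n - 1, Nat.sub_lt hn Nat.one_pos⟩)) := by
    rw [TaftAlgebra.idealI, TaftAlgebra.chiG_eq]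
  rw [hI]
  have hfr : Module.finrank k (DrinfeldDouble k (TaftAlgebra k q l n) ⧸
      augmentationIdeal k (DrinfeldDouble.pairElem (TaftAlgebra.rootChar q l n)
        (TaftAlgebra.g q l ⟨n - 1, Nat.sub_lt hn Nat.one_pos⟩))) = l ^ (4 * n - 1) := by
    refine Nat.eq_of_mul_eq_mul_right (NeZero.pos l) ?_
    rw [hdim, TaftAlgebra.finrank_eq, ← pow_mul, ← pow_succ]
    congr 1
    omega
  refine ⟨hts, hhi, hfac, hfr, TaftAlgebra.isPointedCoalgebra_quotient _, ?_⟩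
  rintro rfl hl1 p _ hpq
  refine TaftAlgebra.nonempty_bialgEquiv _ hl1 hpq ?_ hfr
  have h1 := neg_mem (hp.isCentralGroupLike.sub_pow_mem_augmentationIdeal 1)
  rwa [pow_one, neg_sub] at h1
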